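/- Let $N,n,d\ge 0$ be integers with $n+d=N$, and let $\rho=(\rho_1,\dots,\rho_d)\in\mathbb C[[Z,\zeta]]^d$, with $Z=(Z_1,\dots,Z_N)$ and $\zeta=(\zeta_1,\dots,\zeta_N)$, define a formal generic submanifold $M$ of $\mathbb C^N$ of codimension $d$ through $0$; that is, $\rho(Z,\zeta)=\bar\rho(\zeta,Z)$ (a bar over a power series means that its coefficients are conjugated), $\rho(0)=0$, and $\partial_Z\rho_1(0),\dots,\partial_Z\rho_d(0)$ are linearly independent over $\mathbb C$. A formal vector field $X=\sum_j \big(a_j\,\partial/\partial Z_j+b_j\,\partial/\partial\zeta_j\big)$ with $a_j,b_j\in\mathbb C[[Z,\zeta]]$ is tangent to $M$ if $X\rho=A\rho$ for some $d\times d$ matrix $A$ over $\mathbb C[[Z,\zeta]]$; it is of type $(1,0)$ if all $b_j=0$ and of type $(0,1)$ if all $a_j=0$. Let $\mathcal D_M$ be the $\mathbb C[[Z,\zeta]]$-module generated by all formal $(1,0)$ and $(0,1)$ vector fields tangent to $M$, let $\mathfrak g_M$ be the complex Lie algebra generated by $\mathcal D_M$, and let $\mathfrak g_M(0)\subset\mathbb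 C^{2N}$ be the space of values at $0$ of the coefficients of its elements. $M$ is of finite type at $0$ if $\dim_{\mathbb C}\mathfrak g_M(0)=2N-d$. Normal coordinates for $M$ at $0$ consist of an invertible formal mapping $Z=Z(z,w)\colon(\mathbb C^N,0)\to(\mathbb C^N,0)$, with $z=(z_1,\dots,z_n)$, $w=(w_1,\dots,w_d)$, and $Q\in\mathbb C[[z,\chi,\tau]]^d$, with $\chi=(\chi_1,\dots,\chi_n)$, $\tau=(\tau_1,\dots,\tau_d)$, such that $$\rho(Z(z,w),\bar Z(\chi,\tau))=a(z,w,\chi,\tau)\,\big(w-Q(z,\chi,\tau)\big)$$ for some invertible $d\times d$ matrix $a$ of formal power series, and $Q(0,\chi,\tau)=Q(z,0,\tau)=\tau$. The Segre mappings $v^k\colon(\mathbb C^{kn},0)\to(\mathbb C^N,0)$ are then defined by $v^0=(0,0)$ and $$v^{k+1}(z,\chi^1,z^1,\chi^2,\dots)=\Big(z,\;Q\big(z,\bar v^{k}(\chi^1,z^1,\chi^2,\dots)\big)\Big),\qquad k\ge 0,$$ so that $v^1=(z,0)$, $v^2=(z,Q(z,\chi^1,0))$, $v^3=(z,Q(z,\chi^1,\bar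 Q(\chi^1,z^1,0)))$, and so on. For a formal mapping $v\colon(\mathbb C^m,0)\to(\mathbb C^l,0)$ let $\mathrm{Rk}(v)$ be the rank of the matrix $(\partial v_i/\partial x_j)$ over the field of fractions of $\mathbb C[[x_1,\dots,x_m]]$. **Theorem 3.1.9.** Normal coordinates for $M$ at $0$ exist, and for every choice of normal coordinates the following are equivalent: (i) $M$ is of finite type at $0$; (ii) there exists an integer $0\le k_1\le d+1$ such that $\mathrm{Rk}(v^k)=N$ for all $k\ge k_1$. -/

import Mathlib

namespace FormalCR

open MvPowerSeries

noncomputable section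

/-- `bar f` is the formal power series obtained from `f` by replacing every coefficient by its
complex conjugate. -/
def bar {σ : Type*} (f : MvPowerSeries σ ℂ) : MvPowerSeries σ ℂ :=
  MvPowerSeries.map (starRingEnd ℂ) f

/-- `ℂ[[Z, ζ]]`, with `Z = (Z₁, …, Z_N)` (left summand) and `ζ = (ζ₁, …, ζ_N)` (right summand). -/
abbrev SeriesZζ (N : ℕ) : Type := MvPowerSeries (Fin N ⊕ Fin N) ℂ

/-- The series `ρ = (ρ₁, …, ρ_d) ∈ ℂ[[Z, ζ]]^d` defines a formal generic submanifold of `ℂ^N`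
through `0`, of codimension `d`. -/
structure IsFormalGeneric {N d : ℕ} (ρ : Fin d → SeriesZζ N) : Prop where
  /-- `ρ(Z, ζ) ∼ ρ̄(ζ, Z)` -/
  real : ∀ j, ρ j = rename Sum.swap (bar (ρ j))
  /-- `ρ(0) = 0` -/
  zero : ∀ j, constantCoeff (ρ j) = 0
  /-- `∂_Z ρ₁(0) ∧ … ∧ ∂_Z ρ_d(0) ≠ 0` -/
  generic : LinearIndependent ℂ
    (fun (j : Fin d) (i : Fin N) => constantCoeff (pderiv ℂ (Sum.inl i) (ρ j)))

/-- The formal vector field `∑ⱼ (aⱼ(Z, ζ) ∂/∂Zⱼ + bⱼ(Z, ζ) ∂/∂ζⱼ)`, as a derivation of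
`ℂ[[Z, ζ]]`. -/
def vectorField {N : ℕ} (a b : Fin N → SeriesZζ N) : Derivation ℂ (SeriesZζ N) (SeriesZζ N) :=
  ∑ j, (a j • pderiv ℂ (Sum.inl j) + b j • pderiv ℂ (Sum.inr j))

/-- `X` is tangent to the formal submanifold defined by `ρ`: `X ρ ∼ A ρ` for some `d × d` matrix
`A` of formal power series. -/
def IsTangent {N d : ℕ} (ρ : Fin d → SeriesZζ N)
    (X : Derivation ℂ (SeriesZζ N) (SeriesZζ N)) : Prop :=
  ∃ A : Matrix (Fin d) (Fin d) (SeriesZζ N), (fun j => X (ρ j)) = A.mulVec ρ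

/-- `𝒟_M`: the `ℂ[[Z, ζ]]`-module generated by all formal `(1,0)` and `(0,1)` vector fields
tangent to `M`. -/
def crModule {N d : ℕ} (ρ : Fin d → SeriesZζ N) :
    Submodule (SeriesZζ N) (Derivation ℂ (SeriesZζ N) (SeriesZζ N)) :=
  Submodule.span (SeriesZζ N)
    {X | IsTangent ρ X ∧ ((∃ a, X = vectorField a 0) ∨ (∃ b, X = vectorField 0 b))}

/-- `𝔤_M`: the complex Lie algebra generated by `𝒟_M`; the bracket is the commutator of
derivations. -/
def crLieAlgebra {N d : ℕ} (ρ : Fin d → SeriesZζ N) :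
    LieSubalgebra ℂ (Derivation ℂ (SeriesZζ N) (SeriesZζ N)) :=
  LieSubalgebra.lieSpan ℂ _ (crModule ρ : Set (Derivation ℂ (SeriesZζ N) (SeriesZζ N)))

/-- Evaluation at `0` of the coefficients of a formal vector field; the coefficient at `∂/∂x` is
the value of the field on the coordinate `x`. -/
def evalAtZero (N : ℕ) :
    Derivation ℂ (SeriesZζ N) (SeriesZζ N) →ₗ[ℂ] (Fin N ⊕ Fin N → ℂ) where
  toFun X i := constantCoeff (X (MvPowerSeries.X i))
  map_add' _ _ := by ext; simp
  map_smul' _ _ := by ext; simp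

/-- `M` is of finite type at `0`: `dim 𝔤_M(0) = 2 N - d`. -/
def IsFiniteType {N d : ℕ} (ρ : Fin d → SeriesZζ N) : Prop :=
  Module.finrank ℂ ((crLieAlgebra ρ).toSubmodule.map (evalAtZero N)) + d = 2 * N

/-- `F` is an invertible formal mapping `(ℂ^σ, 0) → (ℂ^τ, 0)`: it has no constant term and there
is a formal mapping `G : (ℂ^τ, 0) → (ℂ^σ, 0)` with `F ∘ G = id` and `G ∘ F = id`. -/
def IsFormalInvertible {σ τ : Type*} (F : τ → MvPowerSeries σ ℂ) : Prop :=
  (∀ i, constantCoeff (F i) = 0) ∧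
  ∃ G : σ → MvPowerSeries τ ℂ, (∀ i, constantCoeff (G i) = 0) ∧
    (∀ i, subst G (F i) = X i) ∧ (∀ i, subst F (G i) = X i)

/-- `Z = Z(z, w)`, `ζ = Z̄(χ, τ)` are normal coordinates for `M` at `0`, in which `M` is defined by
`w - Q(z, χ, τ)`. The series `Zᵢ` are in the variables `(z, w)`, indexed by `Fin n ⊕ Fin d`; the
series `Qⱼ` are in `(z, χ, τ)`, indexed by `Fin n ⊕ (Fin n ⊕ Fin d)`; and `(z, w, χ, τ)` is indexed
by `(Fin n ⊕ Fin d) ⊕ (Fin n ⊕ Fin d)`. -/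
structure IsNormalCoordinates {N n d : ℕ} (ρ : Fin d → SeriesZζ N)
    (Z : Fin N → MvPowerSeries (Fin n ⊕ Fin d) ℂ)
    (Q : Fin d → MvPowerSeries (Fin n ⊕ (Fin n ⊕ Fin d)) ℂ) : Prop where
  invertible : IsFormalInvertible Z
  /-- `ρ(Z(z, w), Z̄(χ, τ)) ∼ a(z, w, χ, τ) (w - Q(z, χ, τ))` with `a` invertible -/
  defining : ∃ a : Matrix (Fin d) (Fin d) (MvPowerSeries ((Fin n ⊕ Fin d) ⊕ (Fin n ⊕ Fin d)) ℂ),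
    IsUnit a ∧
    (fun j => subst (Sum.elim (fun i => rename Sum.inl (Z i))
      (fun i => rename Sum.inr (bar (Z i)))) (ρ j)) =
    a.mulVec (fun j => X (Sum.inl (Sum.inr j)) - rename (Sum.map Sum.inl id) (Q j))
  /-- `Qⱼ(0, χ, τ) ∼ τⱼ` -/
  normal_left : ∀ j, subst (Sum.elim (fun _ => 0) (fun s => X (Sum.inr s)) :
    Fin n ⊕ (Fin n ⊕ Fin d) → MvPowerSeries (Fin n ⊕ (Fin n ⊕ Fin d)) ℂ) (Q j) =
      X (Sum.inr (Sum.inr j))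
  /-- `Qⱼ(z, 0, τ) ∼ τⱼ` -/
  normal_right : ∀ j, subst (Sum.elim (fun i => X (Sum.inl i))
    (Sum.elim (fun _ => 0) (fun l => X (Sum.inr (Sum.inr l)))) :
    Fin n ⊕ (Fin n ⊕ Fin d) → MvPowerSeries (Fin n ⊕ (Fin n ⊕ Fin d)) ℂ) (Q j) =
      X (Sum.inr (Sum.inr j))

/-- The `k`-th Segre mapping `v^k : (ℂ^{kn}, 0) → (ℂ^N, 0)` in normal coordinates. The variables
`(z, χ¹, z¹, χ², …)` are the blocks `0, 1, 2, 3, …` of `Fin k × Fin n`. Here `v⁰ = (0, 0)` and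
`v^{k+1}(z, χ¹, z¹, …) = (z, Q(z, v̄^k(χ¹, z¹, …)))`. As `Q(z, 0, 0) = 0` in normal coordinates, this
unfolds to `v¹ = (z, 0)`, `v² = (z, Q(z, χ¹, 0))`, `v³ = (z, Q(z, χ¹, Q̄(χ¹, z¹, 0)))`,
`v⁴ = (z, Q(z, χ¹, Q̄(χ¹, z¹, Q(z¹, χ², 0))))`, and so on. -/
def segreMap {n d : ℕ} (Q : Fin d → MvPowerSeries (Fin n ⊕ (Fin n ⊕ Fin d)) ℂ) :
    (k : ℕ) → (Fin n ⊕ Fin d) → MvPowerSeries (Fin k × Fin n) ℂ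
  | 0 => fun _ => 0
  | k + 1 => Sum.elim (fun i => X (0, i)) (fun j =>
      subst (Sum.elim (fun i => X (0, i))
        (fun s => rename (Prod.map Fin.succ id) (bar (segreMap Q k s)))) (Q j))

/-- `Rk v`: the rank of the Jacobian matrix `(∂vᵢ/∂xⱼ)` over the field of fractions of
`ℂ[[x]]`. -/
def genericRank {σ τ : Type*} [Fintype σ] (v : τ → MvPowerSeries σ ℂ) : ℕ :=
  (Matrix.of fun i j =>
    algebraMap (MvPowerSeries σ ℂ) (FractionRing (MvPowerSeries σ ℂ)) (pderiv ℂ j (v i))).rank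

end

end FormalCR

/-! Normal coordinates: a linear change makes the linear part of `ρ j` equal to `-i(w_j - τ_j)`. The
set `M ∩ {χ = 0}` projects isomorphically to `(z, w)`-space, and the slice `z = χ = 0` carries a
real parameter, the average of its coordinates `w` and `τ`. Taking as new `w` the parameter of the
slice point with the same `τ` puts all points `(z, t, 0, t)` on `M` (`exists_straightening`).
Together with their conjugates, these points give both normality conditions for the graph function
`Q`.

The equivalence rests on the formal maps `V_k = (v^{k+1}(z, χ¹, …), v̄^k(χ¹, …))` (`segrePoint`, or
`segreVector` in the original coordinates). They take values in the complexification of `M`. As `w`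
is a function of `z` and `v̄^k`, and `z` does not occur in `v̄^k`, one has `Rk V_k = n + Rk v^k`
(`genericRank_segreVector`).

Finite type implies maximal rank. The fibres of both projections of the generic tangent space of `M`
have dimension `n`. Projecting `V_k` to `Z` therefore gives `Rk v^k ≤ Rk v^{k+1}`. In case of
equality, the generic tangent space of the image of `V_k` contains every `(1,0)` and `(0,1)` vector
tangent to `M`. All fields of `𝒟_M` are then `V_k`-related to meromorphic fields. Relatedness
survives brackets, so it holds for `𝔤_M`, and `dim 𝔤_M(0) ≤ n + Rk v^k`
(`genericRank_le_and_finrank_le`). With `dim 𝔤_M(0) = 2N - d = N + n` the rank can only stall at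
`N`. Since `Rk v^1 ≥ n`, at most `d` further steps are needed.

Maximal rank implies finite type. A formal Nagano theorem (`exists_isKilledBy`) yields `2N - dim
𝔤_M(0)` series with independent differentials at `0`, all of whose iterated derivatives along `𝔤_M`
vanish at `0`. A Taylor argument in the variable `z`, iterated over `k`, shows that they vanish
along every `V_k` (`subst_segreVector_eq_zero_of_stable`). Hence `n + Rk v^k ≤ dim 𝔤_M(0)`. The
opposite bound `dim 𝔤_M(0) ≤ 2N - d` holds because `𝔤_M` preserves the ideal of `ρ`. -/

namespace MvPowerSeries

/-! ### Orders of vanishing and division by variables. -/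

section Decomposition

variable {σ τ R : Type*} [CommRing R]

theorem eq_zero_of_forall_nat_le_order {f : MvPowerSeries σ R} (h : ∀ k : ℕ, (k : ℕ∞) ≤ f.order) :
    f = 0 := by
  rw [← order_eq_top_iff]
  exact ENat.eq_top_iff_forall_ge.2 h

theorem le_order_add {k : ℕ∞} {f g : MvPowerSeries σ R} (hf : k ≤ f.order) (hg : k ≤ g.order) :
    k ≤ (f + g).order :=
  (le_min hf hg).trans min_order_le_add

theorem le_order_sub {k : ℕ∞} {f g : MvPowerSeries σ R} (hf : k ≤ f.order) (hg : k ≤ g.order) :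
    k ≤ (f - g).order := by
  rw [sub_eq_add_neg]
  exact le_order_add hf (by rwa [order_neg])

theorem le_order_sum {ι : Type*} {k : ℕ∞} (s : Finset ι) {f : ι → MvPowerSeries σ R}
    (hf : ∀ i ∈ s, k ≤ (f i).order) : k ≤ (∑ i ∈ s, f i).order :=
  Finset.sum_induction f (fun g => k ≤ g.order) (fun _ _ => le_order_add) (by simp) hf

theorem le_order_mul_of_le {k l : ℕ∞} {f g : MvPowerSeries σ R} (hf : k ≤ f.order)
    (hg : l ≤ g.order) : k + l ≤ (f * g).order :=
  (add_le_add hf hg).trans le_order_mul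

theorem le_order_mul_of_le_right {k : ℕ∞} {f g : MvPowerSeries σ R} (hg : k ≤ g.order) :
    k ≤ (f * g).order := by
  simpa using le_order_mul_of_le (k := 0) (f := f) bot_le hg

theorem le_order_mul_of_le_left {k : ℕ∞} {f g : MvPowerSeries σ R} (hf : k ≤ f.order) :
    k ≤ (f * g).order := by
  rw [mul_comm]; exact le_order_mul_of_le_right hf

/-- A power series all of whose monomials involve a variable of `s` lies in the ideal generated by
the variables of `s`. -/
theorem exists_eq_sum_X_mul (s : Finset σ) (f : MvPowerSeries σ R)
    (hf : ∀ m : σ →₀ ℕ, (∀ i ∈ s, m i = 0) → coeff m f = 0) :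
    ∃ g : σ → MvPowerSeries σ R, f = ∑ i ∈ s, X i * g i := by
  classical
  induction s using Finset.induction_on generalizing f with
  | empty => exact ⟨0, by ext m; simpa using hf m⟩
  | insert i s hi ih =>
    let f₁ : MvPowerSeries σ R := fun m => if m i = 0 then 0 else coeff m f
    let f₂ : MvPowerSeries σ R := fun m => if m i = 0 then coeff m f else 0
    have h₁ : ∀ m, coeff m f₁ = if m i = 0 then 0 else coeff m f := fun m => rfl
    have h₂ : ∀ m, coeff m f₂ = if m i = 0 then coeff m f else 0 := fun m => rfl
    have hsum : f = f₁ + f₂ := by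
      ext m
      rw [map_add, h₁, h₂]
      split_ifs <;> simp
    obtain ⟨q, hq⟩ : X i ∣ f₁ := by
      rw [X_dvd_iff]
      intro m hm
      rw [h₁, if_pos hm]
    obtain ⟨g, hg⟩ := ih f₂ (by
      intro m hm
      rw [h₂]
      split_ifs with h0
      · exact hf m (by simpa [h0] using hm)
      · rfl)
    refine ⟨Function.update g i q, ?_⟩
    rw [Finset.sum_insert hi, Function.update_self, ← hq]
    conv_lhs => rw [hsum, hg]
    congr 1
    refine Finset.sum_congr rfl fun j hj => ?_
    rw [Function.update_of_ne (by rintro rfl; exact hi hj)]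

theorem exists_eq_C_add_sum_X_mul [Fintype σ] (f : MvPowerSeries σ R) :
    ∃ g : σ → MvPowerSeries σ R, f = C (constantCoeff f) + ∑ i, X i * g i := by
  obtain ⟨g, hg⟩ := exists_eq_sum_X_mul Finset.univ (f - C (constantCoeff f)) (by
    intro m hm
    have : m = 0 := by ext i; simpa using hm i
    subst this
    simp)
  exact ⟨g, by rw [← hg]; ring⟩

end Decomposition

/-! ### The chain rule for formal substitution. -/

section ChainRule

variable {σ τ R : Type*} [CommRing R] {a : σ → MvPowerSeries τ R}

theorem subst_zero_right (ha : HasSubst a) : subst a (0 : MvPowerSeries σ R) = 0 := by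
  rw [← coe_substAlgHom ha, map_zero]

theorem subst_sum {ι : Type*} (ha : HasSubst a) (s : Finset ι) (f : ι → MvPowerSeries σ R) :
    subst a (∑ i ∈ s, f i) = ∑ i ∈ s, subst a (f i) := by
  rw [← coe_substAlgHom ha, map_sum]

variable [Fintype σ]

theorem subst_C_of_constantCoeff_zero (ha : ∀ i, constantCoeff (a i) = 0) (r : R) :
    subst a (C r : MvPowerSeries σ R) = C r := by
  have := (substAlgHom (R := R) (hasSubst_of_constantCoeff_zero ha)).commutes r
  rwa [← coe_substAlgHom (hasSubst_of_constantCoeff_zero ha)]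

theorem constantCoeff_subst_of_constantCoeff_zero (ha : ∀ i, constantCoeff (a i) = 0)
    (f : MvPowerSeries σ R) : constantCoeff (subst a f) = constantCoeff f := by
  obtain ⟨g, hg⟩ := exists_eq_C_add_sum_X_mul f
  have hs := hasSubst_of_constantCoeff_zero ha
  conv_lhs => rw [hg, subst_add hs, subst_sum hs, subst_C_of_constantCoeff_zero ha]
  simp [subst_mul hs, subst_X hs, ha]

/-- A derivation along a substitution is determined by its values on the variables. -/
theorem eq_sum_of_leibniz_subst (ha : ∀ i, constantCoeff (a i) = 0)
    (D : MvPowerSeries σ R →ₗ[R] MvPowerSeries τ R)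
    (hD : ∀ f g, D (f * g) = subst a f * D g + subst a g * D f) (f : MvPowerSeries σ R) :
    D f = ∑ i, subst a (pderiv R i f) * D (X i) := by
  classical
  have hs := hasSubst_of_constantCoeff_zero ha
  let p := substAlgHom (R := R) hs
  have hp : ∀ f, subst a f = p f := fun f => (substAlgHom_apply hs f).symm
  let E : MvPowerSeries σ R →ₗ[R] MvPowerSeries τ R :=
    D - ∑ i, (LinearMap.mulRight R (D (X i))) ∘ₗ p.toLinearMap ∘ₗ (pderiv R i).toLinearMap
  have hE : ∀ f, E f = D f - ∑ i, subst a (pderiv R i f) * D (X i) := by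
    intro f
    simp [E, hp]
  have hEX : ∀ i, E (X i) = 0 := by
    intro i
    rw [hE, Finset.sum_eq_single i]
    · rw [pderiv_X_self, hp]; simp
    · intro j _ hj
      rw [pderiv_X_of_ne (Ne.symm hj), hp]; simp
    · simp
  have hEmul : ∀ f g, E (f * g) = subst a f * E g + subst a g * E f := by
    intro f g
    rw [hE, hE, hE, hD]
    simp only [hp, Derivation.leibniz, smul_eq_mul, map_add, map_mul, add_mul,
      Finset.sum_add_distrib, mul_sub, Finset.mul_sum]
    have h1 : ∀ x, p f * p (pderiv R x g) * D (X x) = p f * (p (pderiv R x g) * D (X x)) :=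
      fun x => mul_assoc _ _ _
    have h2 : ∀ x, p g * p (pderiv R x f) * D (X x) = p g * (p (pderiv R x f) * D (X x)) :=
      fun x => mul_assoc _ _ _
    simp only [h1, h2]
    ring
  have hEC : ∀ r : R, E (C r) = 0 := by
    have h1 : E 1 = 0 := by
      have := hEmul 1 1
      rw [hp] at this
      simpa using this
    intro r
    have : (C r : MvPowerSeries σ R) = r • 1 := by
      rw [smul_eq_C_mul, mul_one]
    rw [this, map_smul, h1, smul_zero]
  -- The error `E` kills constants and variables, so `E (X i * g) = a i * E g`. As `a i` has no
  -- constant term, each round gains one order of vanishing.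
  have key : ∀ k : ℕ, ∀ f, (k : ℕ∞) ≤ (E f).order := by
    intro k
    induction k with
    | zero => simp
    | succ k ih =>
      intro f
      obtain ⟨g, hg⟩ := exists_eq_C_add_sum_X_mul f
      rw [hg, map_add, hEC, zero_add, map_sum]
      refine le_order_sum _ fun i _ => ?_
      rw [hEmul, hEX, mul_zero, add_zero, subst_X hs]
      have := le_order_mul_of_le (one_le_order_iff_constCoeff_eq_zero.2 (ha i)) (ih (g i))
      simpa [add_comm] using this
  have := eq_zero_of_forall_nat_le_order fun k => key k f
  rw [hE] at this
  exact sub_eq_zero.1 this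

theorem derivation_subst (ha : ∀ i, constantCoeff (a i) = 0)
    (D : Derivation R (MvPowerSeries τ R) (MvPowerSeries τ R)) (f : MvPowerSeries σ R) :
    D (subst a f) = ∑ i, subst a (pderiv R i f) * D (a i) := by
  have hs := hasSubst_of_constantCoeff_zero ha
  have := eq_sum_of_leibniz_subst ha
    (D.toLinearMap ∘ₗ (substAlgHom (R := R) hs).toLinearMap) (by
      intro f g
      simp [Derivation.leibniz, subst_mul hs]) f
  simpa [subst_X hs] using this

theorem pderiv_subst (ha : ∀ i, constantCoeff (a i) = 0) (j : τ) (f : MvPowerSeries σ R) :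
    pderiv R j (subst a f) = ∑ i, subst a (pderiv R i f) * pderiv R j (a i) :=
  derivation_subst ha (pderiv R j) f

theorem subst_derivation (ha : ∀ i, constantCoeff (a i) = 0)
    (D : Derivation R (MvPowerSeries σ R) (MvPowerSeries σ R)) (f : MvPowerSeries σ R) :
    subst a (D f) = ∑ i, subst a (pderiv R i f) * subst a (D (X i)) := by
  have hs := hasSubst_of_constantCoeff_zero ha
  have := eq_sum_of_leibniz_subst ha
    ((substAlgHom (R := R) hs).toLinearMap ∘ₗ D.toLinearMap) (by
      intro f g
      simp [Derivation.leibniz, subst_mul hs, subst_add hs]) f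
  simpa using this

theorem derivation_eq_sum (D : Derivation R (MvPowerSeries σ R) (MvPowerSeries σ R))
    (f : MvPowerSeries σ R) : D f = ∑ i, pderiv R i f * D (X i) := by
  have := subst_derivation (a := (X : σ → MvPowerSeries σ R)) (by simp) D f
  simpa [subst_self] using this

end ChainRule

/-! ### Contraction estimates and the formal inverse and implicit function theorems. -/

section InverseFunction

variable {σ τ R : Type*} [CommRing R] [Fintype σ]

theorem le_order_subst_sub_subst {a b : σ → MvPowerSeries τ R}
    (ha : ∀ i, constantCoeff (a i) = 0) (hb : ∀ i, constantCoeff (b i) = 0) {k : ℕ∞}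
    (hab : ∀ i, k ≤ (a i - b i).order) (f : MvPowerSeries σ R) :
    k ≤ (subst a f - subst b f).order := by
  have hsa := hasSubst_of_constantCoeff_zero ha
  have hsb := hasSubst_of_constantCoeff_zero hb
  -- Truncation at a finite `l` makes induction possible: in `a g(a) - b g(b) = (a - b) g(a) + b
  -- (g(a) - g(b))` the factor `b` supplies the additional order.
  have key : ∀ l : ℕ, ∀ f : MvPowerSeries σ R, min k l ≤ (subst a f - subst b f).order := by
    intro l
    induction l with
    | zero => simp
    | succ l ih =>
      intro f
      obtain ⟨g, hg⟩ := exists_eq_C_add_sum_X_mul f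
      have : subst a f - subst b f =
          ∑ i, ((a i - b i) * subst a (g i) + b i * (subst a (g i) - subst b (g i))) := by
        rw [hg, subst_add hsa, subst_add hsb, subst_C_of_constantCoeff_zero ha,
          subst_C_of_constantCoeff_zero hb, add_sub_add_left_eq_sub,
          ← substAlgHom_apply hsa, ← substAlgHom_apply hsb, map_sum, map_sum,
          ← Finset.sum_sub_distrib]
        refine Finset.sum_congr rfl fun i _ => ?_
        rw [map_mul, map_mul, substAlgHom_X, substAlgHom_X, ← substAlgHom_apply hsa,
          ← substAlgHom_apply hsb]
        ring
      rw [this]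
      refine le_order_sum _ fun i _ => le_order_add ?_ ?_
      · exact (min_le_left _ _).trans (le_order_mul_of_le_left (hab i))
      · have := le_order_mul_of_le (one_le_order_iff_constCoeff_eq_zero.2 (hb i)) (ih (g i))
        refine le_trans ?_ this
        rw [← min_add_add_left, Nat.cast_add, Nat.cast_one, add_comm (l : ℕ∞)]
        exact min_le_min_right _ le_add_self
  by_contra h
  rw [not_le] at h
  obtain ⟨l, hl⟩ := ENat.ne_top_iff_exists.1 (ne_top_of_lt h)
  have := key (l + 1) f
  rw [← hl] at this h
  have h2 : ((l : ℕ∞) + 1) ≤ k := Order.add_one_le_of_lt h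
  rw [min_eq_right (by exact_mod_cast h2)] at this
  norm_cast at this
  omega

/-- Without linear terms the cofactors of the variables in `f` vanish at `0`, so both terms of the
difference gain an order. This is the contraction behind the fixed point below. -/
theorem le_order_subst_sub_subst_of_linear_zero {a b : σ → MvPowerSeries τ R}
    (ha : ∀ i, constantCoeff (a i) = 0) (hb : ∀ i, constantCoeff (b i) = 0) {k : ℕ∞}
    (hab : ∀ i, k ≤ (a i - b i).order) (f : MvPowerSeries σ R)
    (hf : ∀ i, constantCoeff (pderiv R i f) = 0) :
    k + 1 ≤ (subst a f - subst b f).order := by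
  classical
  have hsa := hasSubst_of_constantCoeff_zero ha
  have hsb := hasSubst_of_constantCoeff_zero hb
  obtain ⟨g, hg⟩ := exists_eq_C_add_sum_X_mul f
  have hg0 : ∀ i, constantCoeff (g i) = 0 := by
    intro i
    have := hf i
    rw [hg] at this
    simpa [map_sum, pderiv_X, Pi.single_apply, apply_ite constantCoeff] using this
  have : subst a f - subst b f =
      ∑ i, ((a i - b i) * subst a (g i) + b i * (subst a (g i) - subst b (g i))) := by
    rw [hg, subst_add hsa, subst_add hsb, subst_C_of_constantCoeff_zero ha,
      subst_C_of_constantCoeff_zero hb, add_sub_add_left_eq_sub,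
      ← substAlgHom_apply hsa, ← substAlgHom_apply hsb, map_sum, map_sum,
      ← Finset.sum_sub_distrib]
    refine Finset.sum_congr rfl fun i _ => ?_
    rw [map_mul, map_mul, substAlgHom_X, substAlgHom_X, ← substAlgHom_apply hsa,
      ← substAlgHom_apply hsb]
    ring
  rw [this]
  refine le_order_sum _ fun i _ => le_order_add ?_ ?_
  · refine le_order_mul_of_le (hab i) (one_le_order_iff_constCoeff_eq_zero.2 ?_)
    rw [constantCoeff_subst_of_constantCoeff_zero ha, hg0]
  · rw [add_comm]
    exact le_order_mul_of_le (one_le_order_iff_constCoeff_eq_zero.2 (hb i))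
      (le_order_subst_sub_subst ha hb hab _)

/-- A formal map `G ↦ c + H(G)`, with `H` free of linear terms, has a fixed point. -/
theorem exists_fixedPoint_add_subst (c : σ → MvPowerSeries τ R) (H : σ → MvPowerSeries σ R)
    (hc : ∀ i, constantCoeff (c i) = 0) (hH : ∀ i, constantCoeff (H i) = 0)
    (hH' : ∀ i j, constantCoeff (pderiv R j (H i)) = 0) :
    ∃ G : σ → MvPowerSeries τ R, (∀ i, constantCoeff (G i) = 0) ∧
      ∀ i, G i = c i + subst G (H i) := by
  -- Picard iteration. From the index `m` on, the iterates agree in all degrees below `m`.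
  obtain ⟨u, hu_zero, hu⟩ : ∃ u : ℕ → σ → MvPowerSeries τ R, (∀ i, u 0 i = 0) ∧
      ∀ m i, u (m + 1) i = c i + subst (u m) (H i) :=
    ⟨fun m => Nat.rec (fun _ => 0) (fun _ G i => c i + subst G (H i)) m,
      fun _ => rfl, fun _ _ => rfl⟩
  have hu0 : ∀ m i, constantCoeff (u m i) = 0 := by
    intro m
    induction m with
    | zero => intro i; rw [hu_zero, map_zero]
    | succ m ih =>
      intro i
      rw [hu, map_add, hc, constantCoeff_subst_of_constantCoeff_zero ih, hH, add_zero]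
  have hstep : ∀ (m : ℕ) i, (m : ℕ∞) ≤ (u (m + 1) i - u m i).order := by
    intro m
    induction m with
    | zero => simp
    | succ m ih =>
      intro i
      rw [hu (m + 1), hu m, add_sub_add_left_eq_sub]
      rw [Nat.cast_add, Nat.cast_one]
      exact le_order_subst_sub_subst_of_linear_zero (hu0 _) (hu0 _) ih (H i) (hH' i)
  have hstep' : ∀ (m l : ℕ) i, (m : ℕ∞) ≤ (u (m + l) i - u m i).order := by
    intro m l i
    induction l with
    | zero => simp
    | succ l ih =>
      have : u (m + (l + 1)) i - u m i = (u (m + l + 1) i - u (m + l) i) + (u (m + l) i - u m i) := by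
        rw [← add_assoc]; ring
      rw [this]
      refine le_order_add ((Nat.cast_le.2 (Nat.le_add_right m l)).trans (hstep (m + l) i)) ih
  -- The coefficient at a monomial `e` is final from the iterate of index `e.degree + 1` on.
  let G : σ → MvPowerSeries τ R := fun i e => coeff e (u (e.degree + 1) i)
  have hG : ∀ i e, coeff e (G i) = coeff e (u (e.degree + 1) i) := fun i e => rfl
  have hGu : ∀ (m : ℕ) i, (m : ℕ∞) ≤ (G i - u m i).order := by
    intro m i
    refine nat_le_order fun e he => ?_
    rw [map_sub, hG]
    obtain ⟨l, rfl⟩ := Nat.exists_eq_add_of_le (Nat.succ_le_of_lt he)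
    have := coeff_of_lt_order (d := e) (lt_of_lt_of_le (by norm_cast; omega)
      (hstep' (e.degree + 1) l i))
    rw [map_sub] at this
    rw [← neg_sub, neg_eq_zero]
    simpa [Nat.succ_eq_add_one] using this
  have hG0 : ∀ i, constantCoeff (G i) = 0 := by
    intro i
    have := hGu 1 i
    rw [Nat.cast_one, one_le_order_iff_constCoeff_eq_zero, map_sub, hu0, sub_zero] at this
    exact this
  refine ⟨G, hG0, fun i => sub_eq_zero.1 (eq_zero_of_forall_nat_le_order fun k => ?_)⟩
  have : G i - (c i + subst G (H i)) =
      (G i - u (k + 1) i) - (subst G (H i) - subst (u k) (H i)) := by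
    rw [hu]; ring
  rw [this]
  exact le_order_sub ((Nat.cast_le.2 k.le_succ).trans (hGu (k + 1) i))
    (le_order_subst_sub_subst hG0 (hu0 k) (hGu k) _)

end InverseFunction

end MvPowerSeries

namespace MvPowerSeries

section InverseFunctionTheorem

variable {σ τ R : Type*} [CommRing R] [Fintype σ]

theorem isUnit_matrix_of_constantCoeff {ι : Type*} [Fintype ι] [DecidableEq ι]
    {A : Matrix ι ι (MvPowerSeries τ R)} (hA : IsUnit (A.map constantCoeff)) : IsUnit A := by
  rw [Matrix.isUnit_iff_isUnit_det] at hA ⊢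
  rw [isUnit_iff_constantCoeff, RingHom.map_det]
  exact hA

theorem constantCoeff_pderiv_subst {a : σ → MvPowerSeries τ R}
    (ha : ∀ i, constantCoeff (a i) = 0) (j : τ) (f : MvPowerSeries σ R) :
    constantCoeff (pderiv R j (subst a f)) =
      ∑ i, constantCoeff (pderiv R i f) * constantCoeff (pderiv R j (a i)) := by
  simp [pderiv_subst ha, constantCoeff_subst_of_constantCoeff_zero ha]

variable [DecidableEq σ]

theorem exists_rightInverse (F : σ → MvPowerSeries σ R) (h0 : ∀ i, constantCoeff (F i) = 0)
    (hF : IsUnit (Matrix.of fun i j => constantCoeff (pderiv R j (F i)))) :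
    ∃ G : σ → MvPowerSeries σ R, (∀ i, constantCoeff (G i) = 0) ∧ ∀ i, subst G (F i) = X i := by
  set J : Matrix σ σ R := Matrix.of fun i j => constantCoeff (pderiv R j (F i)) with hJ
  obtain ⟨B, hJB, hBJ⟩ := isUnit_iff_exists.1 hF
  have hBJ' : ∀ i j, ∑ l, B i l * constantCoeff (pderiv R j (F l)) = if i = j then 1 else 0 := by
    intro i j
    have := congrFun (congrFun hBJ i) j
    rwa [Matrix.mul_apply, Matrix.one_apply] at this
  -- With `B` the inverse of the Jacobian at `0`, the fixed point equation `G = B x + (G - B F(G))`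
  -- means `B F(G) = B x`. The map `x - B F(x)` has no linear terms because `B J = 1`.
  obtain ⟨G, hG0, hG⟩ := exists_fixedPoint_add_subst
    (fun i => ∑ j, B i j • (X j : MvPowerSeries σ R)) (fun i => X i - ∑ j, B i j • F j)
    (by simp) (by simp [h0]) (by
      intro i j
      simp only [map_sub, map_sum, Derivation.map_smul, constantCoeff_smul, smul_eq_mul, hBJ' i j]
      by_cases hij : i = j
      · subst hij; simp
      · rw [pderiv_X_of_ne hij]; simp [hij])
  have hs := hasSubst_of_constantCoeff_zero hG0
  have hB : ∀ i, ∑ j, B i j • (subst G (F j) - X j) = 0 := by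
    intro i
    have := hG i
    rw [subst_sub hs, subst_X hs, subst_sum hs] at this
    simp only [subst_smul hs] at this
    simp only [smul_sub, Finset.sum_sub_distrib]
    linear_combination this
  refine ⟨G, hG0, fun i => sub_eq_zero.1 ?_⟩
  have : ∑ l, J i l • ∑ j, B l j • (subst G (F j) - X j) = subst G (F i) - X i := by
    simp only [Finset.smul_sum, smul_smul]
    rw [Finset.sum_comm]
    simp only [← Finset.sum_smul]
    have hJB' : ∀ j, ∑ l, J i l * B l j = if i = j then 1 else 0 := by
      intro j
      have := congrFun (congrFun hJB i) j
      rwa [Matrix.mul_apply, Matrix.one_apply] at this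
    simp [hJB']
  rw [← this]
  simp [hB]

/-- The formal inverse function theorem. -/
theorem exists_inverse (F : σ → MvPowerSeries σ R) (h0 : ∀ i, constantCoeff (F i) = 0)
    (hF : IsUnit (Matrix.of fun i j => constantCoeff (pderiv R j (F i)))) :
    ∃ G : σ → MvPowerSeries σ R, (∀ i, constantCoeff (G i) = 0) ∧ (∀ i, subst G (F i) = X i) ∧
      ∀ i, subst F (G i) = X i := by
  obtain ⟨G, hG0, hFG⟩ := exists_rightInverse F h0 hF
  have hJG : IsUnit (Matrix.of fun i j => constantCoeff (pderiv R j (G i))) := by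
    refine isUnit_of_mul_isUnit_right (x := Matrix.of fun i j => constantCoeff (pderiv R j (F i))) ?_
    convert isUnit_one
    ext i j
    rw [Matrix.mul_apply]
    simp only [Matrix.of_apply]
    rw [← constantCoeff_pderiv_subst hG0, hFG, Matrix.one_apply]
    by_cases hij : i = j
    · subst hij; simp
    · rw [pderiv_X_of_ne hij]; simp [hij]
  -- A right inverse of the right inverse is the original map: `F' = (F ∘ G) ∘ F' = F`.
  obtain ⟨F', hF'0, hGF'⟩ := exists_rightInverse G hG0 hJG
  have : F' = F := by
    funext i
    have hsG := hasSubst_of_constantCoeff_zero hG0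
    have hsF' := hasSubst_of_constantCoeff_zero hF'0
    have h1 := subst_comp_subst_apply (R := R) hsG hsF' (F i)
    rw [hFG, subst_X hsF'] at h1
    simp only [hGF'] at h1
    rw [h1]
    exact congrFun subst_self (F i)
  subst this
  exact ⟨G, hG0, hFG, hGF'⟩

end InverseFunctionTheorem

section ImplicitFunctionTheorem

variable {κ ι R : Type*} [CommRing R] [Fintype κ] [Fintype ι] [DecidableEq ι]

theorem pderiv_X' {σ : Type*} [DecidableEq σ] (i j : σ) :
    pderiv R i (X j) = if j = i then 1 else 0 := by
  split_ifs with h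
  · subst h; exact pderiv_X_self
  · exact pderiv_X_of_ne h

/-- The formal implicit function theorem, in the form of a factorization. -/
theorem exists_eq_mulVec_X_sub (ρ : ι → MvPowerSeries (κ ⊕ ι) R)
    (h0 : ∀ i, constantCoeff (ρ i) = 0)
    (hρ : IsUnit (Matrix.of fun i j => constantCoeff (pderiv R (Sum.inr j) (ρ i)))) :
    ∃ (Q : ι → MvPowerSeries κ R) (a : Matrix ι ι (MvPowerSeries (κ ⊕ ι) R)), IsUnit a ∧
      ρ = a.mulVec fun j => X (Sum.inr j) - rename Sum.inl (Q j) := by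
  classical
  let Ψ : κ ⊕ ι → MvPowerSeries (κ ⊕ ι) R := Sum.elim (fun k => X (Sum.inl k)) ρ
  have hΨ0 : ∀ i, constantCoeff (Ψ i) = 0 := by
    rintro (k | j)
    · simp [Ψ]
    · simp [Ψ, h0]
  have hΨ : IsUnit (Matrix.of fun i j => constantCoeff (pderiv R j (Ψ i))) := by
    have : (Matrix.of fun i j => constantCoeff (pderiv R j (Ψ i))) =
        Matrix.fromBlocks 1 0 (Matrix.of fun i j => constantCoeff (pderiv R (Sum.inl j) (ρ i)))
          (Matrix.of fun i j => constantCoeff (pderiv R (Sum.inr j) (ρ i))) := by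
      ext (i | i) (j | j) <;> simp [Ψ, pderiv_X', Matrix.one_apply, apply_ite constantCoeff]
    rw [this, Matrix.isUnit_iff_isUnit_det, Matrix.det_fromBlocks_zero₁₂, Matrix.det_one, one_mul,
      ← Matrix.isUnit_iff_isUnit_det]
    exact hρ
  obtain ⟨E, hE0, hEΨ, hΨE⟩ := exists_inverse Ψ hΨ0 hΨ
  have hsΨ := hasSubst_of_constantCoeff_zero hΨ0
  let e : κ ↪ κ ⊕ ι := Function.Embedding.inl
  -- `E` inverts `Ψ = (x, ρ)`, so the solution of `ρ = 0` is `E` with its last variables set to `0`.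
  -- The difference is divisible by those variables, and substituting `Ψ` turns them into the series
  -- `ρ`.
  let Q : ι → MvPowerSeries κ R := fun j => killCompl e (E (Sum.inr j))
  have hdec : ∀ j, ∃ g : κ ⊕ ι → MvPowerSeries (κ ⊕ ι) R,
      E (Sum.inr j) - rename Sum.inl (Q j) =
        ∑ i ∈ Finset.univ.map Function.Embedding.inr, X i * g i := by
    intro j
    refine exists_eq_sum_X_mul _ _ fun m hm => ?_
    obtain ⟨m', rfl⟩ : ∃ m' : κ →₀ ℕ, m = Finsupp.embDomain e m' := by
      refine ⟨m.comapDomain Sum.inl Sum.inl_injective.injOn, ?_⟩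
      ext (k | l)
      · have : (Sum.inl k : κ ⊕ ι) = e k := rfl
        rw [this, Finsupp.embDomain_apply_self]
        rfl
      · rw [Finsupp.embDomain_of_notMem_range]
        · exact hm _ (by simp)
        · simp [e]
    have h1 : coeff (Finsupp.embDomain e m') (rename Sum.inl (Q j)) = coeff m' (Q j) :=
      coeff_embDomain_rename e (Q j) m'
    rw [map_sub, h1, coeff_killCompl, sub_self]
  choose g hg using hdec
  have hren : ∀ f : MvPowerSeries κ R, subst Ψ (rename Sum.inl f) = rename Sum.inl f := by
    intro f
    rw [rename_eq_subst, subst_comp_subst_apply (HasSubst.X_comp _) hsΨ]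
    congr 1
    funext k
    simp [subst_X hsΨ, Ψ]
  let A : Matrix ι ι (MvPowerSeries (κ ⊕ ι) R) := Matrix.of fun j l => subst Ψ (g j (Sum.inr l))
  have hA : ∀ j, X (Sum.inr j) - rename Sum.inl (Q j) = ∑ l, A j l * ρ l := by
    intro j
    have := congrArg (subst Ψ) (hg j)
    rw [subst_sub hsΨ, hΨE, hren, Finset.sum_map, subst_sum hsΨ] at this
    rw [this]
    refine Finset.sum_congr rfl fun l _ => ?_
    rw [subst_mul hsΨ, Function.Embedding.inr_apply, subst_X hsΨ, mul_comm]
    rfl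
  -- Differentiating `y - Q(x) = A ρ` at `0`, where `ρ` vanishes, shows that the constant term of
  -- `A` inverts the Jacobian of `ρ` in `y`.
  have hAunit : IsUnit A := by
    apply isUnit_matrix_of_constantCoeff
    refine IsUnit.of_mul_eq_one
      (Matrix.of fun i j => constantCoeff (pderiv R (Sum.inr j) (ρ i))) ?_
    ext j m
    have := congrArg (fun f => constantCoeff (pderiv R (Sum.inr m) f)) (hA j)
    simp only [map_sub, map_sum, Derivation.leibniz, smul_eq_mul, map_add, map_mul, h0, zero_mul,
      add_zero] at this
    rw [Matrix.mul_apply, Matrix.one_apply]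
    simp only [Matrix.map_apply, Matrix.of_apply] at this ⊢
    rw [← this, rename_eq_subst, constantCoeff_pderiv_subst (by simp)]
    simp [pderiv_X', apply_ite constantCoeff]
  obtain ⟨B, hAB, hBA⟩ := isUnit_iff_exists.1 hAunit
  refine ⟨Q, B, ⟨⟨B, A, hBA, hAB⟩, rfl⟩, ?_⟩
  have : (fun j => X (Sum.inr j) - rename Sum.inl (Q j)) = A.mulVec ρ := by
    funext j
    rw [hA]
    rfl
  rw [this, Matrix.mulVec_mulVec, hBA, Matrix.one_mulVec]

end ImplicitFunctionTheorem

end MvPowerSeries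

namespace MvPowerSeries

/-! ### Renaming of variables. -/

section Rename

variable {σ τ υ R : Type*} [CommRing R] [Finite σ]

theorem subst_rename [Finite τ] (e : σ → τ) {a : τ → MvPowerSeries υ R}
    (ha : ∀ i, constantCoeff (a i) = 0) (f : MvPowerSeries σ R) :
    subst a (rename e f) = subst (fun i => a (e i)) f := by
  have hs := hasSubst_of_constantCoeff_zero ha
  rw [rename_eq_subst, subst_comp_subst_apply (HasSubst.X_comp _) hs]
  congr 1
  funext k
  simp [subst_X hs]

theorem rename_subst [Finite τ] (e : τ → υ) [Finite υ] {a : σ → MvPowerSeries τ R}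
    (ha : ∀ i, constantCoeff (a i) = 0) (f : MvPowerSeries σ R) :
    rename e (subst a f) = subst (fun i => rename e (a i)) f := by
  have hs := hasSubst_of_constantCoeff_zero ha
  rw [rename_eq_subst, subst_comp_subst_apply hs (HasSubst.X_comp _)]
  simp [rename_eq_subst]

theorem subst_subst [Finite τ] {a : σ → MvPowerSeries τ R} {b : τ → MvPowerSeries υ R}
    (ha : ∀ i, constantCoeff (a i) = 0) (hb : ∀ i, constantCoeff (b i) = 0)
    (f : MvPowerSeries σ R) : subst b (subst a f) = subst (fun i => subst b (a i)) f :=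
  subst_comp_subst_apply (hasSubst_of_constantCoeff_zero ha) (hasSubst_of_constantCoeff_zero hb) f

theorem pderiv_rename_of_injective [Finite τ] {e : σ → τ} (he : Function.Injective e) (i : σ)
    (f : MvPowerSeries σ R) : pderiv R (e i) (rename e f) = rename e (pderiv R i f) := by
  classical
  have := Fintype.ofFinite σ
  rw [rename_eq_subst, pderiv_subst (by simp), Finset.sum_eq_single i]
  · simp [rename_eq_subst, Function.comp_def]
  · intro j _ hj
    rw [Function.comp_apply, pderiv_X_of_ne (he.ne hj), mul_zero]
  · simp

theorem pderiv_rename_of_notMem_range [Finite τ] {e : σ → τ} {j : τ} (hj : j ∉ Set.range e)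
    (f : MvPowerSeries σ R) : pderiv R j (rename e f) = 0 := by
  have := Fintype.ofFinite σ
  rw [rename_eq_subst, pderiv_subst (by simp)]
  refine Finset.sum_eq_zero fun i _ => ?_
  rw [Function.comp_apply, pderiv_X_of_ne (fun h => hj ⟨i, h⟩), mul_zero]

end Rename

end MvPowerSeries

namespace FormalCR

open MvPowerSeries

noncomputable section

/-! ### Conjugation, complexified maps and real defining equations. -/

section Bar

variable {σ τ υ : Type*}

theorem bar_add (f g : MvPowerSeries σ ℂ) : bar (f + g) = bar f + bar g := map_add _ _ _

theorem bar_mul (f g : MvPowerSeries σ ℂ) : bar (f * g) = bar f * bar g := map_mul _ _ _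

@[simp] theorem bar_zero : bar (0 : MvPowerSeries σ ℂ) = 0 := map_zero _

theorem bar_sum {ι : Type*} (s : Finset ι) (f : ι → MvPowerSeries σ ℂ) :
    bar (∑ i ∈ s, f i) = ∑ i ∈ s, bar (f i) := map_sum _ _ _

@[simp] theorem bar_X (i : σ) : bar (X i : MvPowerSeries σ ℂ) = X i := map_X _ _

@[simp] theorem coeff_bar (m : σ →₀ ℕ) (f : MvPowerSeries σ ℂ) :
    coeff m (bar f) = starRingEnd ℂ (coeff m f) := coeff_map _ _ _

@[simp] theorem bar_bar (f : MvPowerSeries σ ℂ) : bar (bar f) = f := by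
  ext m
  simp

theorem bar_smul (c : ℂ) (f : MvPowerSeries σ ℂ) : bar (c • f) = starRingEnd ℂ c • bar f := by
  ext m
  simp

@[simp] theorem constantCoeff_bar (f : MvPowerSeries σ ℂ) :
    constantCoeff (bar f) = starRingEnd ℂ (constantCoeff f) := coeff_bar 0 f

theorem pderiv_bar (i : σ) (f : MvPowerSeries σ ℂ) :
    pderiv ℂ i (bar f) = bar (pderiv ℂ i f) := by
  ext m
  simp [coeff_pderiv]

theorem bar_injective : Function.Injective (bar : MvPowerSeries σ ℂ → MvPowerSeries σ ℂ) :=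
  Function.LeftInverse.injective bar_bar

theorem bar_rename [Finite σ] [Finite τ] (e : σ → τ) (f : MvPowerSeries σ ℂ) :
    bar (rename e f) = rename e (bar f) := (rename_map e _ f).symm

theorem bar_subst [Finite σ] {a : σ → MvPowerSeries τ ℂ} (ha : ∀ i, constantCoeff (a i) = 0)
    (f : MvPowerSeries σ ℂ) : bar (subst a f) = subst (fun i => bar (a i)) (bar f) :=
  map_subst (hasSubst_of_constantCoeff_zero ha) f

end Bar

section Complexify

variable {σ τ υ : Type*} [Finite σ]

/-- The complexification `(Z, ζ) ↦ (Φ(Z), Φ̄(ζ))` of a formal map `Φ`. -/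
def complexify (Φ : τ → MvPowerSeries σ ℂ) : τ ⊕ τ → MvPowerSeries (σ ⊕ σ) ℂ :=
  Sum.elim (fun i => rename Sum.inl (Φ i)) (fun i => rename Sum.inr (bar (Φ i)))

theorem constantCoeff_complexify {Φ : τ → MvPowerSeries σ ℂ} (hΦ : ∀ i, constantCoeff (Φ i) = 0)
    (i : τ ⊕ τ) : constantCoeff (complexify Φ i) = 0 := by
  rcases i with i | i <;> simp [complexify, hΦ]

/-- `f(Z, ζ) = f̄(ζ, Z)`. -/
def IsRealSeries (f : MvPowerSeries (σ ⊕ σ) ℂ) : Prop := f = rename Sum.swap (bar f)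

theorem IsRealSeries.bar_subst {f : MvPowerSeries (σ ⊕ σ) ℂ} (hf : IsRealSeries f)
    {p : σ ⊕ σ → MvPowerSeries τ ℂ} (hp : ∀ i, constantCoeff (p i) = 0) :
    bar (subst p f) = subst (fun i => bar (p i.swap)) f := by
  rw [FormalCR.bar_subst hp]
  conv_rhs => rw [hf]
  rw [subst_rename _ (by simp [hp])]
  simp

theorem IsRealSeries.subst_complexify [Finite τ] {f : MvPowerSeries (τ ⊕ τ) ℂ} (hf : IsRealSeries f)
    {Φ : τ → MvPowerSeries σ ℂ} (hΦ : ∀ i, constantCoeff (Φ i) = 0) :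
    IsRealSeries (subst (complexify Φ) f) := by
  have h0 := constantCoeff_complexify hΦ
  rw [IsRealSeries, hf.bar_subst h0, rename_subst _ (by simp [h0])]
  congr 1
  funext i
  rcases i with i | i
  · simp only [complexify, Sum.swap_inl, Sum.elim_inr, Sum.elim_inl, bar_rename, bar_bar]
    rw [rename_rename]
    rfl
  · simp only [complexify, Sum.swap_inr, Sum.elim_inr, Sum.elim_inl, bar_rename]
    rw [rename_rename]
    rfl

theorem subst_complexify_inl {Φ : τ → MvPowerSeries σ ℂ} {p : σ ⊕ σ → MvPowerSeries υ ℂ}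
    (hp : ∀ i, constantCoeff (p i) = 0) (i : τ) :
    subst p (complexify Φ (Sum.inl i)) = subst (fun j => p (Sum.inl j)) (Φ i) := by
  simp only [complexify, Sum.elim_inl]
  rw [subst_rename _ hp]

theorem subst_complexify_inr {Φ : τ → MvPowerSeries σ ℂ} {p : σ ⊕ σ → MvPowerSeries υ ℂ}
    (hp : ∀ i, constantCoeff (p i) = 0) (i : τ) :
    subst p (complexify Φ (Sum.inr i)) = subst (fun j => p (Sum.inr j)) (bar (Φ i)) := by
  simp only [complexify, Sum.elim_inr]
  rw [subst_rename _ hp]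

theorem complexify_comp [Finite τ] {Φ : υ → MvPowerSeries τ ℂ} {Φ' : τ → MvPowerSeries σ ℂ}
    (hΦ' : ∀ i, constantCoeff (Φ' i) = 0) (i : υ ⊕ υ) :
    subst (complexify Φ') (complexify Φ i) = complexify (fun j => subst Φ' (Φ j)) i := by
  have h0 := constantCoeff_complexify hΦ'
  rcases i with i | i
  · rw [subst_complexify_inl h0]
    simp [complexify, rename_subst _ hΦ']
  · rw [subst_complexify_inr h0]
    simp only [complexify, Sum.elim_inr]
    rw [bar_subst hΦ', rename_subst _ (by simp [hΦ'])]

theorem complexify_X : complexify (X : σ → MvPowerSeries σ ℂ) = X := by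
  funext i
  rcases i with i | i <;> simp [complexify]

end Complexify

/-! ### Defining equations in graph form. -/

section Graph

variable {α β υ : Type*} [Finite α] [Fintype β] [DecidableEq β]

/-- The series `ρ(z, w, χ, τ)` and `w - Q(z, χ, τ)` differ by an invertible matrix. -/
def IsGraph (ρ : β → MvPowerSeries ((α ⊕ β) ⊕ (α ⊕ β)) ℂ)
    (Q : β → MvPowerSeries (α ⊕ (α ⊕ β)) ℂ) : Prop :=
  ∃ a : Matrix β β (MvPowerSeries ((α ⊕ β) ⊕ (α ⊕ β)) ℂ), IsUnit a ∧
    ρ = a.mulVec (fun j => X (Sum.inl (Sum.inr j)) - rename (Sum.map Sum.inl id) (Q j))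

variable {ρ : β → MvPowerSeries ((α ⊕ β) ⊕ (α ⊕ β)) ℂ} {Q : β → MvPowerSeries (α ⊕ (α ⊕ β)) ℂ}

theorem IsGraph.subst_eq_zero_iff (h : IsGraph ρ Q)
    {p : (α ⊕ β) ⊕ (α ⊕ β) → MvPowerSeries υ ℂ} (hp : ∀ i, constantCoeff (p i) = 0) :
    (∀ j, subst p (ρ j) = 0) ↔ ∀ j, p (Sum.inl (Sum.inr j)) =
      subst (Sum.elim (fun i => p (Sum.inl (Sum.inl i))) (fun i => p (Sum.inr i))) (Q j) := by
  obtain ⟨a, ha, hρ⟩ := h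
  obtain ⟨b, hab, hba⟩ := isUnit_iff_exists.1 ha
  have hs := hasSubst_of_constantCoeff_zero hp
  have hsub : ∀ j, subst p (X (Sum.inl (Sum.inr j)) - rename (Sum.map Sum.inl id) (Q j)) =
      p (Sum.inl (Sum.inr j)) -
      subst (Sum.elim (fun i => p (Sum.inl (Sum.inl i))) (fun i => p (Sum.inr i))) (Q j) := by
    intro j
    rw [subst_sub hs, subst_X hs, subst_rename _ hp]
    congr 2
    funext i
    rcases i with i | i <;> rfl
  have hρ' : b.mulVec ρ =
      fun j => X (Sum.inl (Sum.inr j)) - rename (Sum.map Sum.inl id) (Q j) := by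
    rw [hρ, Matrix.mulVec_mulVec, hba, Matrix.one_mulVec]
  constructor
  · intro h0 j
    rw [← sub_eq_zero, ← hsub, ← congrFun hρ' j, Matrix.mulVec, dotProduct, subst_sum hs]
    simp [subst_mul hs, h0]
  · intro h0 j
    rw [hρ, Matrix.mulVec, dotProduct, subst_sum hs]
    simp only [subst_mul hs, hsub]
    simp only [← h0]
    simp

/-- Reality of `ρ` makes the zero set stable under conjugation combined with the swap of `Z` and
`ζ`. Hence the equations can also be solved for `τ`, by the conjugate of `Q`. -/
theorem IsGraph.subst_eq_zero_iff_bar (h : IsGraph ρ Q) (hreal : ∀ j, IsRealSeries (ρ j))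
    {p : (α ⊕ β) ⊕ (α ⊕ β) → MvPowerSeries υ ℂ} (hp : ∀ i, constantCoeff (p i) = 0) :
    (∀ j, subst p (ρ j) = 0) ↔ ∀ j, p (Sum.inr (Sum.inr j)) =
      subst (Sum.elim (fun i => p (Sum.inr (Sum.inl i))) (fun i => p (Sum.inl i))) (bar (Q j)) := by
  have h1 : (∀ j, subst p (ρ j) = 0) ↔ ∀ j, subst (fun i => bar (p i.swap)) (ρ j) = 0 := by
    refine forall_congr' fun j => ?_
    rw [← (hreal j).bar_subst hp, ← bar_injective.eq_iff, bar_zero]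
  rw [h1, h.subst_eq_zero_iff (by simp [hp])]
  refine forall_congr' fun j => ?_
  rw [← bar_injective.eq_iff, bar_subst (by rintro (i | i) <;> simp [hp])]
  simp only [Sum.swap_inl, bar_bar]
  have : (fun i : α ⊕ (α ⊕ β) => bar ((Sum.elim (fun i => bar (p (Sum.inr (Sum.inl i))))
      (fun i : α ⊕ β => bar (p (Sum.swap (Sum.inr i)))) : _ → MvPowerSeries υ ℂ) i)) =
      Sum.elim (fun i => p (Sum.inr (Sum.inl i))) (fun i => p (Sum.inl i)) := by
    funext i
    rcases i with i | i <;> simp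
  rw [this]

theorem exists_isGraph (ρ : β → MvPowerSeries ((α ⊕ β) ⊕ (α ⊕ β)) ℂ)
    (h0 : ∀ j, constantCoeff (ρ j) = 0)
    (hρ : IsUnit (Matrix.of fun i j =>
      constantCoeff (pderiv ℂ (Sum.inl (Sum.inr j)) (ρ i)))) :
    ∃ Q : β → MvPowerSeries (α ⊕ (α ⊕ β)) ℂ, IsGraph ρ Q := by
  have := Fintype.ofFinite α
  let e : (α ⊕ β) ⊕ (α ⊕ β) ≃ (α ⊕ (α ⊕ β)) ⊕ β :=
    { toFun := Sum.elim (Sum.elim (fun i => Sum.inl (Sum.inl i)) (fun j => Sum.inr j))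
        (fun s => Sum.inl (Sum.inr s))
      invFun := Sum.elim (Sum.elim (fun i => Sum.inl (Sum.inl i)) (fun s => Sum.inr s))
        (fun j => Sum.inl (Sum.inr j))
      left_inv := by rintro ((i | i) | (i | i)) <;> rfl
      right_inv := by rintro ((i | (i | i)) | i) <;> rfl }
  obtain ⟨Q, a, ha, hQ⟩ := exists_eq_mulVec_X_sub (fun j => rename e (ρ j)) (by simp [h0]) (by
    convert hρ using 4 with i j
    have : (Sum.inr j : (α ⊕ (α ⊕ β)) ⊕ β) = e (Sum.inl (Sum.inr j)) := rfl
    rw [this, pderiv_rename_of_injective e.injective, constantCoeff_rename])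
  have hee : ∀ f : MvPowerSeries ((α ⊕ β) ⊕ (α ⊕ β)) ℂ, rename e.symm (rename e f) = f :=
    (renameEquiv ℂ e).symm_apply_apply
  refine ⟨Q, a.map (rename e.symm), ha.map (RingHom.mapMatrix (rename e.symm).toRingHom), ?_⟩
  funext j
  have := congrArg (rename e.symm) (congrFun hQ j)
  rw [hee] at this
  rw [this, Matrix.mulVec, Matrix.mulVec, dotProduct, dotProduct, map_sum]
  refine Finset.sum_congr rfl fun l _ => ?_
  rw [map_mul, map_sub, rename_X, rename_rename, Matrix.map_apply]
  congr 4

end Graph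

end

end FormalCR

namespace FormalCR

open MvPowerSeries

noncomputable section

/-! ### Invertible formal maps and the construction of normal coordinates. -/

section Invertible

variable {σ τ υ : Type*} [Fintype σ] [Fintype τ] [Finite υ]

theorem IsFormalInvertible.comp {Φ : υ → MvPowerSeries τ ℂ} {F : τ → MvPowerSeries σ ℂ}
    (hΦ : IsFormalInvertible Φ) (hF : IsFormalInvertible F) :
    IsFormalInvertible fun i => subst F (Φ i) := by
  obtain ⟨hΦ0, Ψ, hΨ0, hΦΨ, hΨΦ⟩ := hΦ
  obtain ⟨hF0, G, hG0, hFG, hGF⟩ := hF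
  have hΦF0 : ∀ i, constantCoeff (subst F (Φ i)) = 0 := fun i => by
    rw [constantCoeff_subst_of_constantCoeff_zero hF0, hΦ0]
  have hGΨ0 : ∀ i, constantCoeff (subst Ψ (G i)) = 0 := fun i => by
    have := Fintype.ofFinite υ
    rw [constantCoeff_subst_of_constantCoeff_zero hΨ0, hG0]
  refine ⟨hΦF0, fun i => subst Ψ (G i), hGΨ0, fun i => ?_, fun i => ?_⟩
  · rw [subst_subst hF0 hGΨ0]
    have : (fun j => subst (fun i => subst Ψ (G i)) (F j)) = fun j => Ψ j := by
      funext j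
      rw [← subst_subst hG0 hΨ0, hFG, subst_X (hasSubst_of_constantCoeff_zero hΨ0)]
    rw [this, hΦΨ]
  · rw [subst_subst hΨ0 hΦF0]
    have : (fun j => subst (fun i => subst F (Φ i)) (Ψ j)) = fun j => F j := by
      funext j
      rw [← subst_subst hΦ0 hF0, hΨΦ, subst_X (hasSubst_of_constantCoeff_zero hF0)]
    rw [this, hGF]

theorem subst_linear_linear [DecidableEq σ] {A : Matrix σ τ ℂ} {B : Matrix τ σ ℂ} (hAB : A * B = 1)
    (i : σ) : subst (fun s => ∑ j, B s j • (X j : MvPowerSeries σ ℂ))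
      (∑ s, A i s • (X s : MvPowerSeries τ ℂ)) = X i := by
  have hs : HasSubst (fun s => ∑ j, B s j • (X j : MvPowerSeries σ ℂ)) :=
    hasSubst_of_constantCoeff_zero (by simp)
  rw [subst_sum hs]
  simp only [subst_smul hs, subst_X hs, Finset.smul_sum, smul_smul]
  rw [Finset.sum_comm]
  simp only [← Finset.sum_smul]
  have : ∀ j, ∑ l, A i l * B l j = if i = j then 1 else 0 := by
    intro j
    have := congrFun (congrFun hAB i) j
    rwa [Matrix.mul_apply, Matrix.one_apply] at this
  simp [this]

theorem isFormalInvertible_linear [DecidableEq τ] [DecidableEq σ] (L : Matrix τ σ ℂ)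
    (L' : Matrix σ τ ℂ) (h : L * L' = 1) (h' : L' * L = 1) :
    IsFormalInvertible fun i => ∑ s, L i s • (X s : MvPowerSeries σ ℂ) := by
  exact ⟨by simp, fun s => ∑ i, L' s i • X i, by simp, subst_linear_linear h, subst_linear_linear h'⟩

end Invertible

section Straightening

variable {α β : Type*} [Fintype α] [Fintype β] [DecidableEq α] [DecidableEq β]

theorem eq_of_subst_eq {β υ : Type*} [Finite β] {k : β → MvPowerSeries β ℂ}
    (hk : IsFormalInvertible k) {T T' : β → MvPowerSeries υ ℂ}
    (hT : ∀ i, constantCoeff (T i) = 0) (hT' : ∀ i, constantCoeff (T' i) = 0)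
    (h : ∀ j, subst T (k j) = subst T' (k j)) : T = T' := by
  obtain ⟨hk0, g, hg0, hkg, hgk⟩ := hk
  funext i
  have aux : ∀ {U : β → MvPowerSeries υ ℂ}, (∀ i, constantCoeff (U i) = 0) →
      U i = subst (fun j => subst U (k j)) (g i) := by
    intro U hU
    rw [← subst_subst hk0 hU, hgk, subst_X (hasSubst_of_constantCoeff_zero hU)]
  rw [aux hT, aux hT']
  simp only [h]

/-- Write `w - S = b ρ`. Since `ρ` vanishes at `0`, first derivatives at `0` see only `b(0)`. Those
in `w` force `b(0) = i`, and those in `(χ, τ)` then determine the derivatives of `S`. -/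
theorem IsGraph.linear_part {ρ : β → MvPowerSeries ((α ⊕ β) ⊕ (α ⊕ β)) ℂ}
    {S : β → MvPowerSeries (α ⊕ (α ⊕ β)) ℂ} (hS : IsGraph ρ S)
    (h0 : ∀ j, constantCoeff (ρ j) = 0)
    (hinl : ∀ j s, constantCoeff (pderiv ℂ (Sum.inl s) (ρ j)) =
      if s = Sum.inr j then -Complex.I else 0)
    (hinr : ∀ j s, constantCoeff (pderiv ℂ (Sum.inr s) (ρ j)) =
      if s = Sum.inr j then Complex.I else 0) :
    (∀ j, constantCoeff (S j) = 0) ∧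
      ∀ j s, constantCoeff (pderiv ℂ (Sum.inr s) (S j)) = if s = Sum.inr j then 1 else 0 := by
  obtain ⟨a, ha, hρ⟩ := hS
  obtain ⟨b, hab, hba⟩ := isUnit_iff_exists.1 ha
  have hb : ∀ j, X (Sum.inl (Sum.inr j)) - rename (Sum.map Sum.inl id) (S j) =
      ∑ l, b j l * ρ l := by
    intro j
    have : b.mulVec ρ =
        fun j => X (Sum.inl (Sum.inr j)) - rename (Sum.map Sum.inl id) (S j) := by
      rw [hρ, Matrix.mulVec_mulVec, hba, Matrix.one_mulVec]
    rw [← congrFun this j]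
    rfl
  have hd : ∀ j s, constantCoeff (pderiv ℂ s (X (Sum.inl (Sum.inr j)) -
      rename (Sum.map Sum.inl id) (S j))) =
      ∑ l, constantCoeff (b j l) * constantCoeff (pderiv ℂ s (ρ l)) := by
    intro j s
    rw [hb]
    simp [h0]
  have hb0 : ∀ j m, constantCoeff (b j m) = if m = j then Complex.I else 0 := by
    intro j m
    have := hd j (Sum.inl (Sum.inr m))
    rw [map_sub, pderiv_rename_of_notMem_range (by simp)] at this
    simp only [hinl, pderiv_X', sub_zero] at this
    simp only [Sum.inl.injEq, Sum.inr.injEq, mul_ite, mul_zero,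
      Finset.sum_ite_eq, Finset.mem_univ, if_true, apply_ite constantCoeff, map_one,
      map_zero] at this
    have h2 : constantCoeff (b j m) = Complex.I * (constantCoeff (b j m) * -Complex.I) := by
      linear_combination (constantCoeff (b j m)) * Complex.I_mul_I
    rw [h2, ← this]
    simp [eq_comm]
  constructor
  · intro j
    have := congrArg constantCoeff (hb j)
    simpa [h0] using this
  · intro j s
    have := hd j (Sum.inr s)
    have hs : (Sum.inr s : (α ⊕ β) ⊕ (α ⊕ β)) = Sum.map Sum.inl id (Sum.inr s : α ⊕ (α ⊕ β)) := rfl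
    rw [map_sub, pderiv_X_of_ne (by simp), zero_sub, hs,
      pderiv_rename_of_injective (Sum.map_injective.2 ⟨Sum.inl_injective, Function.injective_id⟩),
      map_neg, constantCoeff_rename, ← hs] at this
    simp only [hb0, hinr] at this
    simp only [ite_mul, zero_mul, Finset.sum_ite_eq', Finset.mem_univ, if_true] at this
    rw [← neg_eq_iff_eq_neg.2 this.symm]
    split_ifs <;> simp

theorem isFormalInvertible_of_jacobian_eq_one {σ : Type*} [Fintype σ] [DecidableEq σ]
    {F : σ → MvPowerSeries σ ℂ} (h0 : ∀ i, constantCoeff (F i) = 0)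
    (hF : ∀ i j, constantCoeff (pderiv ℂ j (F i)) = if j = i then 1 else 0) :
    IsFormalInvertible F := by
  refine ⟨h0, exists_inverse F h0 ?_⟩
  convert isUnit_one
  ext i j
  simp [hF, Matrix.one_apply, eq_comm]

/-- Coordinates `(z, w)` in which the graph `w = S(z, χ, τ)` contains all points `(z, t, 0, t)`. -/
theorem exists_straightening {ρ : β → MvPowerSeries ((α ⊕ β) ⊕ (α ⊕ β)) ℂ}
    (hreal : ∀ j, IsRealSeries (ρ j)) (h0 : ∀ j, constantCoeff (ρ j) = 0)
    (hinl : ∀ j s, constantCoeff (pderiv ℂ (Sum.inl s) (ρ j)) =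
      if s = Sum.inr j then -Complex.I else 0)
    (hinr : ∀ j s, constantCoeff (pderiv ℂ (Sum.inr s) (ρ j)) =
      if s = Sum.inr j then Complex.I else 0) :
    ∃ F : α ⊕ β → MvPowerSeries (α ⊕ β) ℂ, IsFormalInvertible F ∧
      (∀ i j, constantCoeff (pderiv ℂ j (F i)) = if j = i then 1 else 0) ∧
      ∀ (υ : Type) (z : α → MvPowerSeries υ ℂ) (t : β → MvPowerSeries υ ℂ),
        (∀ i, constantCoeff (z i) = 0) → (∀ i, constantCoeff (t i) = 0) →
        ∀ j, subst (Sum.elim (Sum.elim z t) (Sum.elim (fun _ => 0) t))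
          (subst (complexify F) (ρ j)) = 0 := by
  have hJ : IsUnit (Matrix.of fun i j =>
      constantCoeff (pderiv ℂ (Sum.inl (Sum.inr j)) (ρ i))) := by
    have : (Matrix.of fun i j => constantCoeff (pderiv ℂ (Sum.inl (Sum.inr j)) (ρ i))) =
        (-Complex.I) • (1 : Matrix β β ℂ) := by
      ext i j
      simp [hinl, Matrix.one_apply, eq_comm]
    rw [this]
    refine IsUnit.of_mul_eq_one (Complex.I • (1 : Matrix β β ℂ)) ?_
    simp [smul_smul]
  obtain ⟨S, hS⟩ := exists_isGraph ρ h0 hJ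
  obtain ⟨hS0, hS1⟩ := hS.linear_part h0 hinl hinr
  -- The slice `z = χ = 0` of the graph is `w = S0(τ)`.
  let S0 : β → MvPowerSeries β ℂ := fun j =>
    subst (Sum.elim (fun _ => 0) (Sum.elim (fun _ => 0) X) : α ⊕ (α ⊕ β) → MvPowerSeries β ℂ) (S j)
  have hz0 : ∀ i, constantCoeff ((Sum.elim (fun _ => 0) (Sum.elim (fun _ => 0) X) :
      α ⊕ (α ⊕ β) → MvPowerSeries β ℂ) i) = 0 := by rintro (i | i | i) <;> simp
  have hS00 : ∀ j, constantCoeff (S0 j) = 0 := fun j => by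
    rw [constantCoeff_subst_of_constantCoeff_zero hz0, hS0]
  -- The average of `τ` and `w` on this slice is unchanged by conjugation and swap, so it is a real
  -- parameter.
  let k : β → MvPowerSeries β ℂ := fun j => (2⁻¹ : ℂ) • (X j + S0 j)
  have hk0 : ∀ j, constantCoeff (k j) = 0 := fun j => by simp [k, hS00]
  have hk1 : ∀ i j, constantCoeff (pderiv ℂ j (k i)) = if j = i then 1 else 0 := by
    intro i j
    simp only [k, S0, Derivation.map_smul, constantCoeff_smul, map_add,
      constantCoeff_pderiv_subst hz0, pderiv_X', apply_ite constantCoeff, map_one, map_zero,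
      Fintype.sum_sum_type, Sum.elim_inl, Sum.elim_inr, mul_zero, Finset.sum_const_zero, zero_add,
      hS1]
    by_cases hij : j = i
    · subst hij; simp; norm_num
    · simp [hij, Ne.symm hij]
  have hk := isFormalInvertible_of_jacobian_eq_one hk0 hk1
  have hu0 : ∀ i, constantCoeff ((Sum.elim (fun _ => 0) X :
      α ⊕ (α ⊕ β) → MvPowerSeries (α ⊕ β) ℂ) i) = 0 := by rintro (i | i) <;> simp
  -- By reality, `U(z, w)` is the value of `τ` at the point of the graph above `(z, w)` with `χ =
  -- 0`.
  let U : β → MvPowerSeries (α ⊕ β) ℂ := fun j =>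
    subst (Sum.elim (fun _ => 0) X : α ⊕ (α ⊕ β) → MvPowerSeries (α ⊕ β) ℂ) (bar (S j))
  have hU0 : ∀ j, constantCoeff (U j) = 0 := fun j => by
    simp [U, constantCoeff_subst_of_constantCoeff_zero hu0, hS0]
  have hU1 : ∀ j s, constantCoeff (pderiv ℂ s (U j)) = if s = Sum.inr j then 1 else 0 := by
    intro j s
    simp only [U, constantCoeff_pderiv_subst hu0, pderiv_bar, constantCoeff_bar, pderiv_X',
      apply_ite constantCoeff, map_one, map_zero, Fintype.sum_sum_type (α₁ := α) (α₂ := α ⊕ β),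
      Sum.elim_inl, Sum.elim_inr, mul_zero, Finset.sum_const_zero, zero_add, hS1]
    simp
  -- The new `w` is the real parameter of the slice point having the same `τ`. The required
  -- coordinates are the inverse of this map.
  let G : α ⊕ β → MvPowerSeries (α ⊕ β) ℂ :=
    Sum.elim (fun i => X (Sum.inl i)) (fun j => subst U (k j))
  have hG0 : ∀ i, constantCoeff (G i) = 0 := by
    rintro (i | j)
    · simp [G]
    · simp [G, constantCoeff_subst_of_constantCoeff_zero hU0, hk0]
  have hG1 : ∀ i j, constantCoeff (pderiv ℂ j (G i)) = if j = i then 1 else 0 := by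
    rintro (i | i) j
    · simp [G, pderiv_X', apply_ite constantCoeff, eq_comm]
    · simp only [G, Sum.elim_inr, constantCoeff_pderiv_subst hU0, hk1, hU1, ite_mul, one_mul, zero_mul]
      rw [Finset.sum_ite_eq' Finset.univ i]
      simp
  obtain ⟨-, F, hF0, hGF, hFG⟩ := isFormalInvertible_of_jacobian_eq_one hG0 hG1
  have hF1 : ∀ i j, constantCoeff (pderiv ℂ j (F i)) = if j = i then 1 else 0 := by
    intro i j
    have := congrArg (fun f => constantCoeff (pderiv ℂ j f)) (hGF i)
    simpa [constantCoeff_pderiv_subst hF0, hG1, pderiv_X', apply_ite constantCoeff, eq_comm]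
      using this
  refine ⟨F, ⟨hF0, G, hG0, hFG, hGF⟩, hF1, ?_⟩
  intro υ z t hz ht
  have hFinl : ∀ i, F (Sum.inl i) = X (Sum.inl i) := by
    intro i
    have := hGF (Sum.inl i)
    simpa [G, subst_X (hasSubst_of_constantCoeff_zero hF0)] using this
  set p : (α ⊕ β) ⊕ (α ⊕ β) → MvPowerSeries υ ℂ :=
    Sum.elim (Sum.elim z t) (Sum.elim (fun _ => 0) t) with hp
  have hp0 : ∀ i, constantCoeff (p i) = 0 := by
    rintro ((i | i) | (i | i)) <;> simp [p, hz, ht]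
  have hzt0 : ∀ i, constantCoeff ((Sum.elim z t : α ⊕ β → MvPowerSeries υ ℂ) i) = 0 := by
    rintro (i | i) <;> simp [hz, ht]
  have h0t0 : ∀ i, constantCoeff ((Sum.elim (fun _ => 0) t : α ⊕ β → MvPowerSeries υ ℂ) i) = 0 := by
    rintro (i | i) <;> simp [ht]
  have hcF := constantCoeff_complexify hF0
  let q : α ⊕ β → MvPowerSeries υ ℂ := fun s => subst (Sum.elim z t) (F s)
  let q' : α ⊕ β → MvPowerSeries υ ℂ := fun s => subst (Sum.elim (fun _ => 0) t) (bar (F s))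
  have hq0 : ∀ i, constantCoeff (q i) = 0 := fun i => by
    simp only [q]
    rw [constantCoeff_subst_of_constantCoeff_zero hzt0, hF0]
  have hq'0 : ∀ i, constantCoeff (q' i) = 0 := fun i => by
    simp only [q']
    rw [constantCoeff_subst_of_constantCoeff_zero h0t0, constantCoeff_bar, hF0, map_zero]
  have hpq : (fun i => subst p (complexify F i)) = Sum.elim q q' := by
    funext i
    rcases i with i | i
    · rw [subst_complexify_inl hp0]
      rfl
    · rw [subst_complexify_inr hp0]
      rfl
  have hq'inl : ∀ i, q' (Sum.inl i) = 0 := by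
    intro i
    simp [q', hFinl, subst_X (hasSubst_of_constantCoeff_zero h0t0)]
  simp only [subst_subst hcF hp0, hpq]
  rw [hS.subst_eq_zero_iff_bar hreal (by rintro (i | i) <;> simp [hq0, hq'0])]
  simp only [Sum.elim_inl, Sum.elim_inr, hq'inl]
  -- both sides are sent to `t` by the injective map `k`
  let T : β → MvPowerSeries υ ℂ := fun j => subst q (U j)
  have hT0 : ∀ j, constantCoeff (T j) = 0 := fun j => by
    simp only [T]
    rw [constantCoeff_subst_of_constantCoeff_zero hq0, hU0]
  have hT : ∀ j, T j = subst (Sum.elim (fun _ => 0) q) (bar (S j)) := by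
    intro j
    simp only [T, U]
    rw [subst_subst hu0 hq0]
    congr 1
    funext i
    rcases i with i | i
    · simp [subst_zero_right (hasSubst_of_constantCoeff_zero hq0)]
    · simp [subst_X (hasSubst_of_constantCoeff_zero hq0)]
  have hkT : ∀ j, subst T (k j) = t j := by
    intro j
    have h1 : subst T (k j) = subst q (G (Sum.inr j)) := by
      simp only [T, G, Sum.elim_inr]
      rw [subst_subst hU0 hq0]
    rw [h1, ← subst_subst hF0 hzt0, hGF, subst_X (hasSubst_of_constantCoeff_zero hzt0)]
    rfl
  let t' : β → MvPowerSeries υ ℂ := fun j => q' (Sum.inr j)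
  have ht'0 : ∀ j, constantCoeff (t' j) = 0 := fun j => hq'0 _
  have hq' : q' = Sum.elim (fun _ => 0) t' := by
    funext i
    rcases i with i | i
    · simp [hq'inl]
    · rfl
  -- `(0, M, 0, t')` is the slice point with `τ = t'`. Solving its equations for `τ` instead of `w`
  -- gives `hMbar`.
  let M : β → MvPowerSeries υ ℂ := fun j => subst (Sum.elim (fun _ => 0) q') (S j)
  have h0q' : ∀ i, constantCoeff ((Sum.elim (fun _ => 0) q' :
      α ⊕ (α ⊕ β) → MvPowerSeries υ ℂ) i) = 0 := by
    rintro (i | i) <;> simp [hq'0]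
  have hM0 : ∀ j, constantCoeff (M j) = 0 := fun j => by
    simp only [M]
    rw [constantCoeff_subst_of_constantCoeff_zero h0q', hS0]
  have hMS0 : ∀ j, M j = subst t' (S0 j) := by
    intro j
    simp only [M, S0]
    rw [subst_subst hz0 ht'0, hq']
    congr 1
    funext i
    rcases i with i | i | i
    · simp [subst_zero_right (hasSubst_of_constantCoeff_zero ht'0)]
    · simp [subst_zero_right (hasSubst_of_constantCoeff_zero ht'0)]
    · simp [subst_X (hasSubst_of_constantCoeff_zero ht'0)]
  have hMbar : ∀ j, t' j = subst M (bar (S0 j)) := by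
    intro j
    let r : (α ⊕ β) ⊕ (α ⊕ β) → MvPowerSeries υ ℂ := Sum.elim (Sum.elim (fun _ => 0) M) q'
    have hr0 : ∀ i, constantCoeff (r i) = 0 := by
      rintro ((i | i) | i) <;> simp [r, hM0, hq'0]
    have h1 : ∀ j, subst r (ρ j) = 0 := (hS.subst_eq_zero_iff hr0).2 fun j => rfl
    rw [hS.subst_eq_zero_iff_bar hreal hr0] at h1
    have h2 := h1 j
    simp only [r, Sum.elim_inr, Sum.elim_inl, hq'inl] at h2
    simp only [t', S0]
    rw [h2, bar_subst hz0, subst_subst (fun i => by rw [constantCoeff_bar, hz0, map_zero]) hM0]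
    congr 1
    funext i
    rcases i with i | i | i
    · simp [subst_zero_right (hasSubst_of_constantCoeff_zero hM0)]
    · simp [subst_zero_right (hasSubst_of_constantCoeff_zero hM0)]
    · simp [subst_X (hasSubst_of_constantCoeff_zero hM0)]
  -- The average is symmetric, so `k(t') = k̄(M)`. As `M = Ū(q')`, this is the `w`-component of
  -- `Ḡ(F̄(0, t))`, which is `t`.
  have hkt' : ∀ j, subst t' (k j) = t j := by
    intro j
    have hst' := hasSubst_of_constantCoeff_zero ht'0
    have hsM := hasSubst_of_constantCoeff_zero hM0
    have h1 : subst t' (k j) = subst M (bar (k j)) := by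
      simp only [k]
      rw [bar_smul, subst_smul hst', subst_smul hsM, bar_add, subst_add hst', subst_add hsM, bar_X,
        subst_X hst', subst_X hsM, ← hMbar, ← hMS0, add_comm, map_inv₀, map_ofNat]
    have h2 : M = fun l => subst q' (bar (U l)) := by
      funext l
      simp only [M, U]
      rw [bar_subst hu0, bar_bar, subst_subst (fun i => by rw [constantCoeff_bar, hu0, map_zero]) hq'0]
      congr 1
      funext i
      rcases i with i | i
      · simp [subst_zero_right (hasSubst_of_constantCoeff_zero hq'0)]
      · simp [subst_X (hasSubst_of_constantCoeff_zero hq'0)]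
    have h3 : subst M (bar (k j)) = subst q' (bar (G (Sum.inr j))) := by
      rw [h2]
      simp only [G, Sum.elim_inr]
      rw [bar_subst hU0, subst_subst (by simp [hU0]) hq'0]
    rw [h1, h3]
    have h4 : subst q' (bar (G (Sum.inr j))) =
        subst (Sum.elim (fun _ => 0) t) (bar (subst F (G (Sum.inr j)))) := by
      rw [bar_subst hF0, subst_subst (by simp [hF0]) h0t0]
    rw [h4, hGF, bar_X, subst_X (hasSubst_of_constantCoeff_zero h0t0)]
    rfl
  have := eq_of_subst_eq hk hT0 ht'0 fun j => by rw [hkT, hkt']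
  intro j
  rw [← hT, this]

end Straightening

end

end FormalCR

namespace FormalCR

open MvPowerSeries

noncomputable section

section NormalCoordinates

theorem constantCoeff_pderiv_inl_subst_complexify {σ τ : Type*} [Fintype σ] [Fintype τ]
    {Φ : τ → MvPowerSeries σ ℂ} (hΦ : ∀ i, constantCoeff (Φ i) = 0)
    (f : MvPowerSeries (τ ⊕ τ) ℂ) (s : σ) :
    constantCoeff (pderiv ℂ (Sum.inl s) (subst (complexify Φ) f)) =
      ∑ i, constantCoeff (pderiv ℂ (Sum.inl i) f) * constantCoeff (pderiv ℂ s (Φ i)) := by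
  rw [constantCoeff_pderiv_subst (constantCoeff_complexify hΦ), Fintype.sum_sum_type]
  simp [complexify, pderiv_rename_of_injective Sum.inl_injective,
    pderiv_rename_of_notMem_range (e := Sum.inr) (j := (Sum.inl s : σ ⊕ σ)) (by simp)]

theorem IsRealSeries.constantCoeff_pderiv_inr {σ : Type*} [Finite σ] {f : MvPowerSeries (σ ⊕ σ) ℂ}
    (hf : IsRealSeries f) (i : σ) : constantCoeff (pderiv ℂ (Sum.inr i) f) =
      starRingEnd ℂ (constantCoeff (pderiv ℂ (Sum.inl i) f)) := by
  conv_lhs => rw [hf]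
  have : (Sum.inr i : σ ⊕ σ) = Sum.swap (Sum.inl i) := rfl
  rw [this, pderiv_rename_of_injective Sum.swap_leftInverse.injective, constantCoeff_rename,
    pderiv_bar, constantCoeff_bar]

theorem exists_basis_sum_extend {N n d : ℕ} (hN : n + d = N) {B : Fin d → Fin N → ℂ}
    (hB : LinearIndependent ℂ B) :
    ∃ b : Module.Basis (Fin n ⊕ Fin d) ℂ (Fin N → ℂ), ∀ j, b (Sum.inr j) = B j := by
  let b := Module.Basis.sumExtend hB
  have hfin : Finite (Fin d ⊕ Module.Basis.sumExtendIndex hB) := Module.Finite.finite_basis b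
  have hfin' : Finite (Module.Basis.sumExtendIndex hB) :=
    Finite.of_injective (Sum.inr : _ → Fin d ⊕ Module.Basis.sumExtendIndex hB) Sum.inr_injective
  have hcard := Module.finrank_eq_nat_card_basis b
  rw [Nat.card_sum, Module.finrank_fin_fun, Nat.card_fin] at hcard
  let e : Module.Basis.sumExtendIndex hB ≃ Fin n :=
    Finite.equivFinOfCardEq (by omega)
  refine ⟨b.reindex ((Equiv.sumComm _ _).trans (Equiv.sumCongr e (Equiv.refl _))), fun j => ?_⟩
  simp [b, Module.Basis.sumExtend]
  rfl

theorem exists_isNormalCoordinates {N n d : ℕ} (hN : n + d = N) (ρ : Fin d → SeriesZζ N)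
    (hM : IsFormalGeneric ρ) :
    ∃ (Z : Fin N → MvPowerSeries (Fin n ⊕ Fin d) ℂ)
      (Q : Fin d → MvPowerSeries (Fin n ⊕ (Fin n ⊕ Fin d)) ℂ), IsNormalCoordinates ρ Z Q := by
  have hreal : ∀ j, IsRealSeries (ρ j) := hM.real
  -- The factor `i` turns `∂_Z ρ_j(0)` into `-i dw_j` in the new coordinates. Reality then makes the
  -- `ζ`-part `i dτ_j`, so that `ρ_j` is a multiple of `w_j - τ_j` to first order.
  obtain ⟨b, hb⟩ := exists_basis_sum_extend hN
    (hM.generic.units_smul fun _ => Units.mk0 Complex.I Complex.I_ne_zero)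
  let E := Pi.basisFun ℂ (Fin N)
  let L : Matrix (Fin N) (Fin n ⊕ Fin d) ℂ := (b.toMatrix E).transpose
  let L' : Matrix (Fin n ⊕ Fin d) (Fin N) ℂ := (E.toMatrix b).transpose
  have hLL' : L * L' = 1 := by
    rw [← Matrix.transpose_mul, Module.Basis.toMatrix_mul_toMatrix_flip, Matrix.transpose_one]
  have hL'L : L' * L = 1 := by
    rw [← Matrix.transpose_mul, Module.Basis.toMatrix_mul_toMatrix_flip, Matrix.transpose_one]
  have hL'B : ∀ j i, L' (Sum.inr j) i =
      Complex.I * constantCoeff (pderiv ℂ (Sum.inl i) (ρ j)) := by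
    intro j i
    have := congrFun (hb j) i
    simpa [L', E, Module.Basis.toMatrix_apply, Units.smul_def] using this
  let Λ : Fin N → MvPowerSeries (Fin n ⊕ Fin d) ℂ := fun i => ∑ s, L i s • X s
  have hΛ : IsFormalInvertible Λ := isFormalInvertible_linear L L' hLL' hL'L
  have hΛ1 : ∀ i s, constantCoeff (pderiv ℂ s (Λ i)) = L i s := by
    intro i s
    simp only [Λ, map_sum, Derivation.map_smul, constantCoeff_smul, pderiv_X',
      apply_ite constantCoeff, map_one, map_zero]
    simp
  have hBL : ∀ j s, ∑ i, constantCoeff (pderiv ℂ (Sum.inl i) (ρ j)) * L i s =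
      if s = Sum.inr j then -Complex.I else 0 := by
    intro j s
    have h1 := congrFun (congrFun hL'L (Sum.inr j)) s
    rw [Matrix.mul_apply, Matrix.one_apply] at h1
    simp only [hL'B, mul_assoc, ← Finset.mul_sum] at h1
    have h2 : ∑ i, constantCoeff (pderiv ℂ (Sum.inl i) (ρ j)) * L i s = -Complex.I *
        (Complex.I * ∑ i, constantCoeff (pderiv ℂ (Sum.inl i) (ρ j)) * L i s) := by
      rw [← mul_assoc, neg_mul, Complex.I_mul_I, neg_neg, one_mul]
    rw [h2, h1]
    simp [eq_comm]
  let ρ₁ : Fin d → MvPowerSeries ((Fin n ⊕ Fin d) ⊕ (Fin n ⊕ Fin d)) ℂ := fun j =>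
    subst (complexify Λ) (ρ j)
  have hcΛ := constantCoeff_complexify hΛ.1
  have hreal₁ : ∀ j, IsRealSeries (ρ₁ j) := fun j => (hreal j).subst_complexify hΛ.1
  have hρ₁0 : ∀ j, constantCoeff (ρ₁ j) = 0 := fun j => by
    simp only [ρ₁]
    rw [constantCoeff_subst_of_constantCoeff_zero hcΛ, hM.zero]
  have hinl : ∀ j s, constantCoeff (pderiv ℂ (Sum.inl s) (ρ₁ j)) =
      if s = Sum.inr j then -Complex.I else 0 := by
    intro j s
    simp only [ρ₁, constantCoeff_pderiv_inl_subst_complexify hΛ.1, hΛ1, hBL]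
  have hinr : ∀ j s, constantCoeff (pderiv ℂ (Sum.inr s) (ρ₁ j)) =
      if s = Sum.inr j then Complex.I else 0 := by
    intro j s
    rw [(hreal₁ j).constantCoeff_pderiv_inr, hinl]
    split_ifs <;> simp
  obtain ⟨F, hF, hF1, hFpt⟩ := exists_straightening hreal₁ hρ₁0 hinl hinr
  have hcF := constantCoeff_complexify hF.1
  let ρ₂ : Fin d → MvPowerSeries ((Fin n ⊕ Fin d) ⊕ (Fin n ⊕ Fin d)) ℂ := fun j =>
    subst (complexify F) (ρ₁ j)
  have hreal₂ : ∀ j, IsRealSeries (ρ₂ j) := fun j => (hreal₁ j).subst_complexify hF.1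
  have hρ₂0 : ∀ j, constantCoeff (ρ₂ j) = 0 := fun j => by
    simp only [ρ₂]
    rw [constantCoeff_subst_of_constantCoeff_zero hcF, hρ₁0]
  obtain ⟨Q, hQ⟩ := exists_isGraph ρ₂ hρ₂0 (by
    refine IsUnit.of_mul_eq_one (Complex.I • (1 : Matrix (Fin d) (Fin d) ℂ)) ?_
    ext j l
    have : ∀ j l, constantCoeff (pderiv ℂ (Sum.inl (Sum.inr l)) (ρ₂ j)) =
        if l = j then -Complex.I else 0 := by
      intro j l
      simp only [ρ₂, constantCoeff_pderiv_inl_subst_complexify hF.1, hF1, hinl]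
      simp
    simp [this, Matrix.one_apply, eq_comm])
  have hZρ : ∀ j, subst (complexify fun i => subst F (Λ i)) (ρ j) = ρ₂ j := by
    intro j
    simp only [ρ₂, ρ₁]
    rw [subst_subst hcΛ hcF]
    congr 1
    funext i
    rw [complexify_comp hF.1]
  refine ⟨fun i => subst F (Λ i), Q, hΛ.comp hF, ?_, ?_, ?_⟩
  · obtain ⟨a, ha, haQ⟩ := hQ
    exact ⟨a, ha, by rw [← haQ]; exact funext hZρ⟩
  · have h1 : ∀ j, subst (Sum.elim (Sum.elim (fun i => X (Sum.inr (Sum.inl i)))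
        (fun l => X (Sum.inr (Sum.inr l)))) (Sum.elim (fun _ => 0)
        (fun l => X (Sum.inr (Sum.inr l)))) :
        _ → MvPowerSeries (Fin n ⊕ (Fin n ⊕ Fin d)) ℂ) (ρ₂ j) = 0 :=
      hFpt _ _ _ (by simp) (by simp)
    -- Conjugating and swapping the points `(χ, τ, 0, τ)` gives the points `(0, τ, χ, τ)`.
    have h2 : ∀ j, subst (Sum.elim (Sum.elim (fun _ => 0) (fun l => X (Sum.inr (Sum.inr l))))
        (fun s => X (Sum.inr s)) :
        _ → MvPowerSeries (Fin n ⊕ (Fin n ⊕ Fin d)) ℂ) (ρ₂ j) = 0 := by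
      intro j
      have := (hreal₂ j).bar_subst (p := (Sum.elim (Sum.elim (fun i => X (Sum.inr (Sum.inl i)))
        (fun l => X (Sum.inr (Sum.inr l)))) (Sum.elim (fun _ => 0)
        (fun l => X (Sum.inr (Sum.inr l)))) :
        _ → MvPowerSeries (Fin n ⊕ (Fin n ⊕ Fin d)) ℂ)) (by rintro ((i | i) | (i | i)) <;> simp)
      rw [h1, bar_zero] at this
      refine Eq.trans ?_ this.symm
      congr 1
      funext s
      rcases s with (s | s) | (s | s) <;> simp
    have h3 := (hQ.subst_eq_zero_iff (by rintro ((i | i) | (i | i)) <;> simp)).1 h2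
    intro j
    exact (h3 j).symm
  · have h1 : ∀ j, subst (Sum.elim (Sum.elim (fun i => X (Sum.inl i))
        (fun l => X (Sum.inr (Sum.inr l)))) (Sum.elim (fun _ => 0)
        (fun l => X (Sum.inr (Sum.inr l)))) :
        _ → MvPowerSeries (Fin n ⊕ (Fin n ⊕ Fin d)) ℂ) (ρ₂ j) = 0 :=
      hFpt _ _ _ (by simp) (by simp)
    have h3 := (hQ.subst_eq_zero_iff (by rintro ((i | i) | (i | i)) <;> simp)).1 h1
    intro j
    exact (h3 j).symm

end NormalCoordinates

end

end FormalCR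

/-! ### Ranks under change of field and dimensions of subspaces of a product. -/

section LinearAlgebra

/-- A maximal independent set of rows stays independent over the larger field, and the factorization
of the other rows through it is preserved. -/
theorem Matrix.rank_map_of_field {K L m n : Type*} [Field K] [Field L] [Finite m] [Fintype n]
    (φ : K →+* L) (M : Matrix m n K) : (M.map φ).rank = M.rank := by
  classical
  cases nonempty_fintype m
  obtain ⟨κ, a, ha, hspan, hli⟩ := exists_linearIndependent' K M.row
  have hfin : Finite κ := Finite.of_injective a ha
  cases nonempty_fintype κ
  have hrank : M.rank = Fintype.card κ := by
    rw [M.rank_eq_finrank_span_row, ← hspan, finrank_span_eq_card hli]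
  have hcomb : ∀ i, ∃ c : κ → K, ∑ l, c l • M.row (a l) = M.row i := by
    intro i
    have : M.row i ∈ Submodule.span K (Set.range (M.row ∘ a)) := by
      rw [hspan]
      exact Submodule.subset_span ⟨i, rfl⟩
    exact (Submodule.mem_span_range_iff_exists_fun K).1 this
  choose A hA using hcomb
  have hM : M = Matrix.of A * M.submatrix a id := by
    ext i j
    rw [Matrix.mul_apply]
    have := congrFun (hA i) j
    simpa using this.symm
  rw [hrank]
  apply le_antisymm
  · rw [hM, Matrix.map_mul]
    exact (Matrix.rank_mul_le_right _ _).trans (Matrix.rank_le_card_height _)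
  · let := φ.toAlgebra
    have hli' : LinearIndependent L ((M.map φ).submatrix a id).row := by
      have := (linearIndependent_algebraMap_comp_iff (S := L) (v := M.row ∘ a)).2 hli
      exact this
    rw [← hli'.rank_matrix]
    exact Matrix.rank_submatrix_le _ _ _

theorem Matrix.rank_map_algebraMap_comp {A B K L m n : Type*} [CommRing A] [CommRing B] [Field K]
    [Field L] [Algebra A K] [Algebra B L] [IsFractionRing A K] [FaithfulSMul B L] [IsDomain A]
    [Finite m] [Fintype n] {j : A →+* B} (hj : Function.Injective j) (M : Matrix m n A) :
    (M.map fun x => algebraMap B L (j x)).rank = (M.map (algebraMap A K)).rank := by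
  have hinj : Function.Injective ((algebraMap B L).comp j) :=
    (FaithfulSMul.algebraMap_injective B L).comp hj
  rw [← Matrix.rank_map_of_field (IsFractionRing.lift (K := K) hinj) (M.map (algebraMap A K))]
  congr 1
  ext i l
  simp [IsFractionRing.lift_algebraMap]

theorem Matrix.exists_mul_eq_one_of_linearIndependent {K ι κ : Type*} [Field K] [Fintype ι]
    [Fintype κ] [DecidableEq ι] {U : Matrix ι κ K} (hU : LinearIndependent K U.row) :
    ∃ W : Matrix κ ι K, U * W = 1 := by
  rw [← Matrix.mulVec_surjective_iff_exists_right_inverse]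
  have : Function.Surjective U.mulVecLin := by
    rw [← LinearMap.range_eq_top]
    apply Submodule.eq_top_of_finrank_eq
    rw [← Matrix.rank, hU.rank_matrix, Module.finrank_fintype_fun_eq_card]
  exact this

theorem Submodule.finrank_eq_finrank_map_fst_add {K A B : Type*} [Field K] [AddCommGroup A]
    [Module K A] [AddCommGroup B] [Module K B] [FiniteDimensional K A] [FiniteDimensional K B]
    (T : Submodule K (A × B)) : Module.finrank K T =
      Module.finrank K (T.map (LinearMap.fst K A B)) +
        Module.finrank K (T.comap (LinearMap.inr K A B)) := by
  have hker : Module.finrank K (LinearMap.ker ((LinearMap.fst K A B).domRestrict T)) =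
      Module.finrank K (T.comap (LinearMap.inr K A B)) := by
    refine LinearEquiv.finrank_eq (LinearEquiv.ofBijective
      (((LinearMap.snd K A B ∘ₗ T.subtype) ∘ₗ Submodule.subtype _).codRestrict _ ?_) ⟨?_, ?_⟩)
    · rintro ⟨⟨⟨a, b⟩, hab⟩, h⟩
      have : a = 0 := h
      subst this
      exact hab
    · rintro ⟨⟨⟨a, b⟩, hab⟩, h⟩ ⟨⟨⟨a', b'⟩, hab'⟩, h'⟩ heq
      have h1 : a = 0 := h
      have h2 : a' = 0 := h'
      have h3 : b = b' := congrArg Subtype.val heq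
      subst h1 h2 h3
      rfl
    · rintro ⟨b, hb⟩
      exact ⟨⟨⟨(0, b), hb⟩, rfl⟩, rfl⟩
  have hrn := LinearMap.finrank_range_add_finrank_ker ((LinearMap.fst K A B).domRestrict T)
  rwa [hker, LinearMap.range_domRestrict, eq_comm] at hrn

/-- If `T ⊆ A × B` meets `0 × B` inside `0 × E`, then `dim T ≤ dim (pr₁ T) + dim E`, and in case of
equality `T` contains `0 × E`. -/
theorem Submodule.finrank_le_finrank_map_fst_add {K A B : Type*} [Field K] [AddCommGroup A]
    [Module K A] [AddCommGroup B] [Module K B] [FiniteDimensional K A] [FiniteDimensional K B]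
    (T : Submodule K (A × B)) (E : Submodule K B) (hT : ∀ b, ((0 : A), b) ∈ T → b ∈ E) :
    Module.finrank K T ≤ Module.finrank K (T.map (LinearMap.fst K A B)) + Module.finrank K E ∧
      (Module.finrank K T = Module.finrank K (T.map (LinearMap.fst K A B)) + Module.finrank K E →
        ∀ b ∈ E, ((0 : A), b) ∈ T) := by
  have hle : T.comap (LinearMap.inr K A B) ≤ E := fun b hb => hT b hb
  have hrn := T.finrank_eq_finrank_map_fst_add
  refine ⟨by rw [hrn]; exact Nat.add_le_add_left (Submodule.finrank_mono hle) _, ?_⟩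
  intro heq b hb
  have : T.comap (LinearMap.inr K A B) = E :=
    Submodule.eq_of_le_of_finrank_eq hle (by omega)
  rw [← this] at hb
  exact hb

end LinearAlgebra

namespace FormalCR

open MvPowerSeries

noncomputable section

/-! ### The generic rank of a formal map. -/

section GenericRank

instance {σ : Type*} : IsDomain (MvPowerSeries σ ℂ) := NoZeroDivisors.to_isDomain _

variable {σ τ υ : Type*}

/-- The Jacobian matrix of a formal map, over the field of fractions. -/
def jacobian (v : τ → MvPowerSeries σ ℂ) : Matrix τ σ (FractionRing (MvPowerSeries σ ℂ)) :=
  Matrix.of fun i j =>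
    algebraMap (MvPowerSeries σ ℂ) (FractionRing (MvPowerSeries σ ℂ)) (pderiv ℂ j (v i))

theorem jacobian_subst [Fintype τ] {v : τ → MvPowerSeries σ ℂ}
    (hv : ∀ i, constantCoeff (v i) = 0) (Φ : υ → MvPowerSeries τ ℂ) :
    jacobian (fun j => subst v (Φ j)) =
      (Matrix.of fun j i => algebraMap _ _ (subst v (pderiv ℂ i (Φ j))) :
        Matrix υ τ (FractionRing (MvPowerSeries σ ℂ))) * jacobian v := by
  refine Matrix.ext fun j l => ?_
  rw [Matrix.mul_apply]
  simp [jacobian, pderiv_subst hv, map_sum]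

/-- A right inverse of the matrix of values at `0` produces a square matrix with constant term `1`.
That matrix is invertible over the power series, which keeps the rows independent. -/
theorem linearIndependent_of_constantCoeff {ι κ : Type*} [Fintype ι] [Fintype κ]
    {u : ι → κ → MvPowerSeries σ ℂ}
    (hu : LinearIndependent ℂ fun i k => constantCoeff (u i k)) :
    LinearIndependent (FractionRing (MvPowerSeries σ ℂ))
      fun i k => algebraMap (MvPowerSeries σ ℂ) (FractionRing (MvPowerSeries σ ℂ)) (u i k) := by
  classical
  obtain ⟨W, hW⟩ := Matrix.exists_mul_eq_one_of_linearIndependent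
    (U := Matrix.of fun i k => constantCoeff (u i k)) hu
  let W' : Matrix κ ι (MvPowerSeries σ ℂ) := W.map C
  have hunit : IsUnit (Matrix.of u * W') := by
    apply isUnit_matrix_of_constantCoeff
    rw [Matrix.map_mul]
    have : W'.map constantCoeff = W := by
      ext i j
      simp [W']
    rw [this]
    exact hW ▸ isUnit_one
  obtain ⟨P, hP, -⟩ := isUnit_iff_exists.1 hunit
  have hP' : (Matrix.of u).map (algebraMap _ (FractionRing (MvPowerSeries σ ℂ))) *
      ((W' * P).map (algebraMap _ (FractionRing (MvPowerSeries σ ℂ)))) = 1 := by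
    rw [← Matrix.map_mul, ← Matrix.mul_assoc, hP]
    simp
  have hinj : Function.Injective ((Matrix.of u).map
      (algebraMap _ (FractionRing (MvPowerSeries σ ℂ)))).vecMul := by
    intro x y hxy
    have := congrArg (fun z => Matrix.vecMul z
      ((W' * P).map (algebraMap _ (FractionRing (MvPowerSeries σ ℂ))))) hxy
    simpa only [Matrix.vecMul_vecMul, hP', Matrix.vecMul_one] using this
  rw [Matrix.vecMul_injective_iff] at hinj
  exact hinj

variable [Fintype σ]

theorem genericRank_eq_rank_jacobian (v : τ → MvPowerSeries σ ℂ) :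
    genericRank v = (jacobian v).rank := rfl

theorem genericRank_subst_le [Fintype τ] {v : τ → MvPowerSeries σ ℂ}
    (hv : ∀ i, constantCoeff (v i) = 0) (Φ : υ → MvPowerSeries τ ℂ) :
    genericRank (fun j => subst v (Φ j)) ≤ genericRank v := by
  rw [genericRank_eq_rank_jacobian, jacobian_subst hv]
  exact Matrix.rank_mul_le_right _ _

theorem genericRank_subst_of_isFormalInvertible [Fintype τ] [Fintype υ]
    {v : τ → MvPowerSeries σ ℂ} (hv : ∀ i, constantCoeff (v i) = 0) {Φ : υ → MvPowerSeries τ ℂ}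
    (hΦ : IsFormalInvertible Φ) : genericRank (fun j => subst v (Φ j)) = genericRank v := by
  refine le_antisymm (genericRank_subst_le hv Φ) ?_
  obtain ⟨hΦ0, Ψ, hΨ0, hΦΨ, hΨΦ⟩ := hΦ
  have h0 : ∀ j, constantCoeff (subst v (Φ j)) = 0 := fun j => by
    rw [constantCoeff_subst_of_constantCoeff_zero hv, hΦ0]
  refine le_trans (le_of_eq ?_) (genericRank_subst_le h0 Ψ)
  congr 1
  funext i
  rw [← subst_subst hΦ0 hv, hΨΦ, subst_X (hasSubst_of_constantCoeff_zero hv)]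

theorem genericRank_le_card [Fintype τ] (v : τ → MvPowerSeries σ ℂ) :
    genericRank v ≤ Fintype.card τ :=
  Matrix.rank_le_card_height _

/-- Functions vanishing along `v`, with differentials that are independent at `0`, bound the generic
rank of `v`. -/
theorem genericRank_add_card_le [Fintype τ] {ι : Type*} [Fintype ι] {v : τ → MvPowerSeries σ ℂ}
    (hv : ∀ i, constantCoeff (v i) = 0) {f : ι → MvPowerSeries τ ℂ}
    (hf : LinearIndependent ℂ fun s i => constantCoeff (pderiv ℂ i (f s)))
    (hfv : ∀ s, subst v (f s) = 0) : genericRank v + Fintype.card ι ≤ Fintype.card τ := by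
  -- Differentiating `f ∘ v = 0` makes the matrix of `df` along `v`, of full row rank, annihilate
  -- the Jacobian of `v`.
  have hmul := (jacobian_subst hv f).symm
  have hzero : jacobian (fun j => subst v (f j)) = 0 := by
    ext j l
    simp [jacobian, hfv]
  rw [hzero] at hmul
  have := Matrix.rank_add_rank_le_card_of_mul_eq_zero hmul
  rw [← genericRank_eq_rank_jacobian, LinearIndependent.rank_matrix] at this
  · omega
  · exact linearIndependent_of_constantCoeff
      (u := fun s i => subst v (pderiv ℂ i (f s)))
      (by simpa only [constantCoeff_subst_of_constantCoeff_zero hv] using hf)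

/-- Transport along an injective map of variables followed by conjugation. -/
theorem genericRank_rename_bar [Fintype υ] [Fintype τ] {e : υ → σ} (he : Function.Injective e)
    (v : τ → MvPowerSeries υ ℂ) :
    genericRank (fun i => rename e (bar (v i))) = genericRank v := by
  classical
  -- Conjugation is not `ℂ`-linear, but an injective ring homomorphism suffices to preserve ranks
  -- over fraction fields.
  let j : MvPowerSeries υ ℂ →+* MvPowerSeries σ ℂ :=
    (rename e).toRingHom.comp (MvPowerSeries.map (starRingEnd ℂ))
  have hj : Function.Injective j :=
    (rename_injective ⟨e, he⟩).comp bar_injective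
  have hsub : (jacobian fun i => rename e (bar (v i))).submatrix id e =
      (Matrix.of fun i l => pderiv ℂ l (v i)).map
        fun x => algebraMap _ (FractionRing (MvPowerSeries σ ℂ)) (j x) := by
    refine Matrix.ext fun i l => ?_
    simp only [jacobian, Matrix.submatrix_apply, Matrix.of_apply, id, Matrix.map_apply]
    rw [pderiv_rename_of_injective he, pderiv_bar]
    rfl
  -- The columns of variables outside the range of `e` are zero.
  have hfull : (jacobian fun i => rename e (bar (v i))) =
      (jacobian fun i => rename e (bar (v i))).submatrix id e *
        (Matrix.of fun l s => if e l = s then 1 else 0 :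
          Matrix υ σ (FractionRing (MvPowerSeries σ ℂ))) := by
    refine Matrix.ext fun i s => ?_
    rw [Matrix.mul_apply]
    simp only [Matrix.submatrix_apply, id, Matrix.of_apply, mul_ite, mul_one, mul_zero]
    by_cases hs : s ∈ Set.range e
    · obtain ⟨l, rfl⟩ := hs
      simp [he.eq_iff]
    · rw [Finset.sum_eq_zero]
      · simp only [jacobian, Matrix.of_apply]
        rw [pderiv_rename_of_notMem_range hs, map_zero]
      · intro l _
        rw [if_neg fun h => hs ⟨l, h⟩]
  have h1 : genericRank v = ((jacobian fun i => rename e (bar (v i))).submatrix id e).rank := by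
    rw [hsub]
    exact (Matrix.rank_map_algebraMap_comp hj _).symm
  rw [h1, genericRank_eq_rank_jacobian]
  refine le_antisymm ?_ (Matrix.rank_submatrix_le _ _ _)
  conv_lhs => rw [hfull]
  exact Matrix.rank_mul_le_left _ _

end GenericRank

end

end FormalCR

namespace FormalCR

open MvPowerSeries

noncomputable section

theorem derivation_sum_apply {R A M ι : Type*} [CommSemiring R] [CommSemiring A] [AddCommMonoid M]
    [Algebra R A] [Module A M] [Module R M] (s : Finset ι) (D : ι → Derivation R A M) (f : A) :
    (∑ i ∈ s, D i) f = ∑ i ∈ s, D i f := by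
  rw [← Finset.sum_apply, ← Derivation.coeFnAddMonoidHom_apply, map_sum]
  rfl

/-! ### Vector fields related along a formal map. -/

section Related

variable {σ τ : Type*} [Fintype τ]

/-- `X` is `V`-related to a formal vector field with meromorphic coefficients. -/
def IsRelated (V : τ → MvPowerSeries σ ℂ)
    (X : Derivation ℂ (MvPowerSeries τ ℂ) (MvPowerSeries τ ℂ)) : Prop :=
  ∃ s : MvPowerSeries σ ℂ, s ≠ 0 ∧
    ∃ D : Derivation ℂ (MvPowerSeries σ ℂ) (MvPowerSeries σ ℂ),
      ∀ f, D (subst V f) = s * subst V (X f)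

variable {V : τ → MvPowerSeries σ ℂ}

theorem IsRelated.add {X Y : Derivation ℂ (MvPowerSeries τ ℂ) (MvPowerSeries τ ℂ)}
    (hV : ∀ i, constantCoeff (V i) = 0)
    (hX : IsRelated V X) (hY : IsRelated V Y) : IsRelated V (X + Y) := by
  have hs := hasSubst_of_constantCoeff_zero hV
  obtain ⟨s, hs0, D, hD⟩ := hX
  obtain ⟨t, ht0, E, hE⟩ := hY
  refine ⟨s * t, mul_ne_zero hs0 ht0, t • D + s • E, fun f => ?_⟩
  simp only [Derivation.add_apply, Derivation.smul_apply, smul_eq_mul, hD, hE, subst_add hs]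
  ring

theorem isRelated_zero (hV : ∀ i, constantCoeff (V i) = 0) :
    IsRelated V (0 : Derivation ℂ (MvPowerSeries τ ℂ) (MvPowerSeries τ ℂ)) :=
  ⟨1, one_ne_zero, 0, fun f => by
    simp [subst_zero_right (hasSubst_of_constantCoeff_zero hV)]⟩

theorem IsRelated.smul {X : Derivation ℂ (MvPowerSeries τ ℂ) (MvPowerSeries τ ℂ)}
    (hV : ∀ i, constantCoeff (V i) = 0)
    (hX : IsRelated V X) (a : MvPowerSeries τ ℂ) : IsRelated V (a • X) := by
  have hs := hasSubst_of_constantCoeff_zero hV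
  obtain ⟨s, hs0, D, hD⟩ := hX
  refine ⟨s, hs0, subst V a • D, fun f => ?_⟩
  simp only [Derivation.smul_apply, smul_eq_mul, hD, subst_mul hs]
  ring

theorem IsRelated.lie {X Y : Derivation ℂ (MvPowerSeries τ ℂ) (MvPowerSeries τ ℂ)}
    (hV : ∀ i, constantCoeff (V i) = 0)
    (hX : IsRelated V X) (hY : IsRelated V Y) : IsRelated V ⁅X, Y⁆ := by
  have hs := hasSubst_of_constantCoeff_zero hV
  obtain ⟨s, hs0, D, hD⟩ := hX
  obtain ⟨t, ht0, E, hE⟩ := hY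
  -- The meromorphic fields are `D/s` and `E/t`. Multiplication by `(s t)²` clears the denominators
  -- of their commutator.
  refine ⟨(s * t) * (s * t), mul_ne_zero (mul_ne_zero hs0 ht0) (mul_ne_zero hs0 ht0),
    (s * t) • ⁅D, E⁆ - (s * D t) • E + (t * E s) • D, fun f => ?_⟩
  simp only [Derivation.add_apply, Derivation.sub_apply, Derivation.smul_apply, smul_eq_mul,
    Derivation.commutator_apply, hD, hE, subst_sub hs, Derivation.leibniz]
  ring

/-- The Lie algebra of the `V`-related vector fields. -/
def relatedLieSubalgebra (hV : ∀ i, constantCoeff (V i) = 0) :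
    LieSubalgebra ℂ (Derivation ℂ (MvPowerSeries τ ℂ) (MvPowerSeries τ ℂ)) where
  carrier := {X | IsRelated V X}
  add_mem' := fun hX hY => hX.add hV hY
  zero_mem' := isRelated_zero hV
  smul_mem' := fun c X hX => by
    have := hX.smul hV (C c)
    rwa [show (C c : MvPowerSeries τ ℂ) • X = c • X from by
      ext f; simp [smul_eq_C_mul]] at this
  lie_mem' := fun hX hY => hX.lie hV hY

/-- By the chain rule it is enough to compare values on the variables. Relatedness thus becomes a
linear system for the Jacobian, and a common denominator of a solution serves as `s`. -/
theorem isRelated_iff [Fintype σ] (hV : ∀ i, constantCoeff (V i) = 0)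
    {X : Derivation ℂ (MvPowerSeries τ ℂ) (MvPowerSeries τ ℂ)} :
    IsRelated V X ↔ (fun i => algebraMap (MvPowerSeries σ ℂ) (FractionRing (MvPowerSeries σ ℂ))
      (subst V (X (MvPowerSeries.X i)))) ∈ LinearMap.range (jacobian V).mulVecLin := by
  have hs := hasSubst_of_constantCoeff_zero hV
  have hinj : Function.Injective
      (algebraMap (MvPowerSeries σ ℂ) (FractionRing (MvPowerSeries σ ℂ))) :=
    IsFractionRing.injective _ _
  constructor
  · rintro ⟨s, hs0, D, hD⟩
    refine ⟨fun j => (algebraMap _ _ s)⁻¹ * algebraMap _ _ (D (MvPowerSeries.X j)), ?_⟩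
    funext i
    have h1 := hD (MvPowerSeries.X i)
    rw [subst_X hs, derivation_eq_sum] at h1
    have h2 := congrArg (algebraMap _ (FractionRing (MvPowerSeries σ ℂ))) h1
    rw [map_sum, map_mul] at h2
    have hs1 : algebraMap _ (FractionRing (MvPowerSeries σ ℂ)) s ≠ 0 := by
      rwa [Ne, map_eq_zero_iff _ hinj]
    rw [Matrix.mulVecLin_apply, Matrix.mulVec, dotProduct]
    rw [← mul_right_inj' hs1, ← h2, Finset.mul_sum]
    refine Finset.sum_congr rfl fun j _ => ?_
    simp only [jacobian, Matrix.of_apply, map_mul]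
    field_simp
  · rintro ⟨Y, hY⟩
    obtain ⟨b, hb⟩ := IsLocalization.exist_integer_multiples_of_finite
      (nonZeroDivisors (MvPowerSeries σ ℂ)) Y
    choose y hy using hb
    have hDV : ∀ i, (∑ j, y j • pderiv ℂ j) (V i) = b * subst V (X (MvPowerSeries.X i)) := by
      intro i
      apply hinj
      have := congrFun hY i
      rw [Matrix.mulVecLin_apply, Matrix.mulVec, dotProduct] at this
      rw [map_mul, ← this, derivation_sum_apply, map_sum, Finset.mul_sum]
      refine Finset.sum_congr rfl fun j _ => ?_
      rw [Derivation.smul_apply, smul_eq_mul, map_mul, hy, Algebra.smul_def]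
      simp only [jacobian, Matrix.of_apply]
      ring
    refine ⟨b, nonZeroDivisors.coe_ne_zero b, ∑ j, y j • pderiv ℂ j, fun f => ?_⟩
    rw [derivation_subst hV, subst_derivation hV, Finset.mul_sum]
    refine Finset.sum_congr rfl fun i _ => ?_
    rw [hDV]
    ring

end Related

/-! ### Growth of ranks and the upper bound for `𝔤_M(0)`. -/

section Tangent

variable {N d : ℕ}

theorem vectorField_apply_X_inl (a b : Fin N → SeriesZζ N) (i : Fin N) :
    vectorField a b (X (Sum.inl i)) = a i := by
  classical
  simp [vectorField, derivation_sum_apply, pderiv_X']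

theorem vectorField_apply_X_inr (a b : Fin N → SeriesZζ N) (i : Fin N) :
    vectorField a b (X (Sum.inr i)) = b i := by
  classical
  simp [vectorField, derivation_sum_apply, pderiv_X']

theorem IsTangent.subst_eq_zero {ρ : Fin d → SeriesZζ N} {σ : Type*}
    {X : Derivation ℂ (SeriesZζ N) (SeriesZζ N)} (hX : IsTangent ρ X)
    {V : Fin N ⊕ Fin N → MvPowerSeries σ ℂ} (hV : ∀ i, constantCoeff (V i) = 0)
    (hρ : ∀ j, subst V (ρ j) = 0) (j : Fin d) : subst V (X (ρ j)) = 0 := by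
  have hs := hasSubst_of_constantCoeff_zero hV
  obtain ⟨A, hA⟩ := hX
  rw [congrFun hA j, Matrix.mulVec, dotProduct, subst_sum hs]
  simp [subst_mul hs, hρ]

theorem crLieAlgebra_le {ρ : Fin d → SeriesZζ N}
    {K : LieSubalgebra ℂ (Derivation ℂ (SeriesZζ N) (SeriesZζ N))}
    (hsmul : ∀ (a : SeriesZζ N), ∀ X ∈ K, a • X ∈ K)
    (hK : ∀ X, IsTangent ρ X → ((∃ a, X = vectorField a 0) ∨ (∃ b, X = vectorField 0 b)) → X ∈ K) :
    crLieAlgebra ρ ≤ K := by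
  refine LieSubalgebra.lieSpan_le.2 fun X hX => ?_
  refine Submodule.span_induction (p := fun X _ => X ∈ K) ?_ K.zero_mem
    (fun _ _ _ _ => K.add_mem) (fun a X _ hX => hsmul a X hX) hX
  rintro X ⟨h1, h2⟩
  exact hK X h1 h2

theorem IsFormalGeneric.linearIndependent_inr {ρ : Fin d → SeriesZζ N} (hM : IsFormalGeneric ρ) :
    LinearIndependent ℂ
      (fun (j : Fin d) (i : Fin N) => constantCoeff (pderiv ℂ (Sum.inr i) (ρ j))) := by
  have hreal : ∀ j, IsRealSeries (ρ j) := hM.real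
  simp only [fun j i => (hreal j).constantCoeff_pderiv_inr i]
  have h := hM.generic
  rw [Fintype.linearIndependent_iff] at h ⊢
  intro g hg j
  have := h (fun j => starRingEnd ℂ (g j)) (by
    funext i
    have := congrArg (starRingEnd ℂ) (congrFun hg i)
    simpa [map_sum, Finset.sum_apply] using this) j
  simpa using this

/-- The rank inequalities for a formal map into the complexification of `M`, and the bound for
`dim 𝔤_M(0)` in case of equality. -/
theorem genericRank_le_and_finrank_le {n : ℕ} (hN : n + d = N) {ρ : Fin d → SeriesZζ N}
    (hM : IsFormalGeneric ρ) {σ : Type*} [Fintype σ] {V : Fin N ⊕ Fin N → MvPowerSeries σ ℂ}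
    (hV : ∀ i, constantCoeff (V i) = 0) (hρ : ∀ j, subst V (ρ j) = 0) :
    genericRank V ≤ genericRank (fun i => V (Sum.inl i)) + n ∧
      (genericRank V = genericRank (fun i => V (Sum.inl i)) + n →
        genericRank V = genericRank (fun i => V (Sum.inr i)) + n →
        Module.finrank ℂ ((crLieAlgebra ρ).toSubmodule.map (evalAtZero N)) ≤ genericRank V) := by
  classical
  let K := FractionRing (MvPowerSeries σ ℂ)
  let V₁ : Fin N → MvPowerSeries σ ℂ := fun i => V (Sum.inl i)
  let V₂ : Fin N → MvPowerSeries σ ℂ := fun i => V (Sum.inr i)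
  let e := LinearEquiv.sumArrowLequivProdArrow (Fin N) (Fin N) K K
  -- `T` is the generic tangent space of the image of `V`, split into its `Z`- and `ζ`-components.
  let T : Submodule K ((Fin N → K) × (Fin N → K)) :=
    (LinearMap.range (jacobian V).mulVecLin).map e.toLinearMap
  have hmemT : ∀ {y : Fin N ⊕ Fin N → K}, y ∈ LinearMap.range (jacobian V).mulVecLin ↔
      ((fun i => y (Sum.inl i)), (fun i => y (Sum.inr i))) ∈ T := by
    intro y
    have : ((fun i => y (Sum.inl i)), (fun i => y (Sum.inr i))) = e y := rfl
    rw [this, Submodule.mem_map_equiv, LinearEquiv.symm_apply_apply]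
  have hTfin : Module.finrank K T = genericRank V := e.finrank_map_eq _
  have hfst : T.map (LinearMap.fst K _ _) = LinearMap.range (jacobian V₁).mulVecLin := by
    rw [← Submodule.map_comp, ← LinearMap.range_comp]
    rfl
  have hsnd : T.map (LinearMap.snd K _ _) = LinearMap.range (jacobian V₂).mulVecLin := by
    rw [← Submodule.map_comp, ← LinearMap.range_comp]
    rfl
  let P₁ : Matrix (Fin d) (Fin N) K :=
    Matrix.of fun j i => algebraMap _ K (subst V (pderiv ℂ (Sum.inl i) (ρ j)))
  let P₂ : Matrix (Fin d) (Fin N) K :=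
    Matrix.of fun j i => algebraMap _ K (subst V (pderiv ℂ (Sum.inr i) (ρ j)))
  have hP₁ : P₁.rank = d := by
    have := LinearIndependent.rank_matrix (M := P₁) (linearIndependent_of_constantCoeff
      (u := fun j i => subst V (pderiv ℂ (Sum.inl i) (ρ j)))
      (by simpa only [constantCoeff_subst_of_constantCoeff_zero hV] using hM.generic))
    simpa using this
  have hP₂ : P₂.rank = d := by
    have := LinearIndependent.rank_matrix (M := P₂) (linearIndependent_of_constantCoeff
      (u := fun j i => subst V (pderiv ℂ (Sum.inr i) (ρ j)))
      (by simpa only [constantCoeff_subst_of_constantCoeff_zero hV] using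
        hM.linearIndependent_inr))
    simpa using this
  have hker : ∀ {P : Matrix (Fin d) (Fin N) K}, P.rank = d →
      Module.finrank K (LinearMap.ker P.mulVecLin) = n := by
    intro P hP
    have := LinearMap.finrank_range_add_finrank_ker P.mulVecLin
    rw [Module.finrank_fin_fun] at this
    rw [Matrix.rank] at hP
    omega
  -- This is the derivative of `ρ ∘ V = 0`. It confines the purely `Z`- or `ζ`-directed vectors of
  -- `T` to the kernels of `P₁` and `P₂`, both of dimension `n`.
  have hTP : ∀ y ∈ T, P₁.mulVec y.1 + P₂.mulVec y.2 = 0 := by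
    rintro _ ⟨_, ⟨Y, rfl⟩, rfl⟩
    have h1 : (jacobian fun j => subst V (ρ j)).mulVec Y = 0 := by
      have : (jacobian fun j => subst V (ρ j)) = 0 := by
        refine Matrix.ext fun j l => ?_
        simp [jacobian, hρ]
      rw [this, Matrix.zero_mulVec]
    rw [jacobian_subst hV, ← Matrix.mulVec_mulVec] at h1
    rw [← h1]
    funext j
    simp only [Pi.add_apply, Matrix.mulVec, dotProduct, Fintype.sum_sum_type]
    rfl
  have h1 := Submodule.finrank_le_finrank_map_fst_add T (LinearMap.ker P₂.mulVecLin) (by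
    intro b hb
    have := hTP _ hb
    rwa [Matrix.mulVec_zero, zero_add] at this)
  have h2 := Submodule.finrank_le_finrank_map_fst_add
    (T.map (LinearEquiv.prodComm K _ _).toLinearMap) (LinearMap.ker P₁.mulVecLin) (by
    rintro b ⟨⟨b₁, b₂⟩, hb, hb'⟩
    obtain ⟨rfl, rfl⟩ := Prod.mk.inj hb'
    have := hTP _ hb
    rwa [Matrix.mulVec_zero, add_zero] at this)
  have hswap : (T.map (LinearEquiv.prodComm K _ _).toLinearMap).map (LinearMap.fst K _ _) =
      LinearMap.range (jacobian V₂).mulVecLin := by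
    rw [← hsnd, ← Submodule.map_comp]
    rfl
  rw [hTfin, hfst, hker hP₂] at h1
  rw [LinearEquiv.finrank_map_eq, hTfin, hswap, hker hP₁] at h2
  refine ⟨h1.1, fun he₁ he₂ => ?_⟩
  have hc₂ := h1.2 he₁
  have hc₁ : ∀ b ∈ LinearMap.ker P₁.mulVecLin, (b, (0 : Fin N → K)) ∈ T := by
    intro b hb
    obtain ⟨⟨b₁, b₂⟩, hb, hb'⟩ := h2.2 he₂ b hb
    obtain ⟨h₂, h₁⟩ := Prod.mk.inj hb'
    rwa [← h₁, ← h₂]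
  -- Under the two equalities `T` contains these whole kernels, and the tangent `(1,0)` and `(0,1)`
  -- fields have their values along `V` there.
  have hrel : crLieAlgebra ρ ≤ relatedLieSubalgebra hV := by
    refine crLieAlgebra_le (fun a X hX => hX.smul hV a) fun X hX hX' => ?_
    refine (isRelated_iff hV).2 (hmemT.2 ?_)
    have htan : ∀ j, ∑ i, subst V (pderiv ℂ i (ρ j)) * subst V (X (MvPowerSeries.X i)) = 0 :=
      fun j => by rw [← subst_derivation hV, hX.subst_eq_zero hV hρ]
    have h0 : subst V (0 : SeriesZζ N) = 0 :=
      subst_zero_right (hasSubst_of_constantCoeff_zero hV)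
    rcases hX' with ⟨a, rfl⟩ | ⟨b, rfl⟩
    · simp only [vectorField_apply_X_inl, vectorField_apply_X_inr, Pi.zero_apply, h0, map_zero]
      refine hc₁ _ ?_
      rw [LinearMap.mem_ker, Matrix.mulVecLin_apply]
      funext j
      have := htan j
      simp only [Fintype.sum_sum_type, vectorField_apply_X_inl, vectorField_apply_X_inr,
        Pi.zero_apply, h0, mul_zero, Finset.sum_const_zero, add_zero] at this
      simpa [P₁, Matrix.mulVec, dotProduct] using congrArg (algebraMap _ K) this
    · simp only [vectorField_apply_X_inl, vectorField_apply_X_inr, Pi.zero_apply, h0, map_zero]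
      refine hc₂ _ ?_
      rw [LinearMap.mem_ker, Matrix.mulVecLin_apply]
      funext j
      have := htan j
      simp only [Fintype.sum_sum_type, vectorField_apply_X_inl, vectorField_apply_X_inr,
        Pi.zero_apply, h0, mul_zero, Finset.sum_const_zero, zero_add] at this
      simpa [P₂, Matrix.mulVec, dotProduct] using congrArg (algebraMap _ K) this
  let W := (crLieAlgebra ρ).toSubmodule.map (evalAtZero N)
  let b := Module.finBasis ℂ W
  have hex : ∀ l, ∃ X ∈ crLieAlgebra ρ, evalAtZero N X = b l := fun l => (b l).2
  choose X hXg hXb using hex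
  -- Fields of `𝔤_M` whose values at `0` form a basis of `𝔤_M(0)` are independent along `V` as well,
  -- and their values there lie in the column space of the Jacobian.
  have hli : LinearIndependent ℂ
      (fun l i => constantCoeff (subst V (X l (MvPowerSeries.X i)))) := by
    have : (fun l i => constantCoeff (subst V (X l (MvPowerSeries.X i)))) =
        fun l => ((b l : W) : Fin N ⊕ Fin N → ℂ) := by
      funext l
      rw [← hXb]
      funext i
      rw [constantCoeff_subst_of_constantCoeff_zero hV]
      rfl
    rw [this]
    exact b.linearIndependent.map' W.subtype W.ker_subtype
  have hli' := linearIndependent_of_constantCoeff hli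
  have hli'' : LinearIndependent K (fun l => (⟨_, (isRelated_iff hV).1 (hrel (hXg l))⟩ :
      LinearMap.range (jacobian V).mulVecLin)) :=
    LinearIndependent.of_comp (Submodule.subtype _) hli'
  have := hli''.fintype_card_le_finrank
  rwa [Fintype.card_fin] at this

end Tangent

end

end FormalCR

namespace FormalCR

open MvPowerSeries

noncomputable section

/-! ### Iterated derivatives along a Lie algebra of fields. -/

section Words

variable {τ : Type*}

/-- Successive application of the derivations of a list, the last one first. -/
def applyWord (l : List (Derivation ℂ (MvPowerSeries τ ℂ) (MvPowerSeries τ ℂ))) :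
    MvPowerSeries τ ℂ →ₗ[ℂ] MvPowerSeries τ ℂ :=
  l.foldr (fun X φ => X.toLinearMap ∘ₗ φ) LinearMap.id

@[simp] theorem applyWord_nil (f : MvPowerSeries τ ℂ) : applyWord [] f = f := rfl

@[simp] theorem applyWord_cons (X : Derivation ℂ (MvPowerSeries τ ℂ) (MvPowerSeries τ ℂ))
    (l : List (Derivation ℂ (MvPowerSeries τ ℂ) (MvPowerSeries τ ℂ))) (f : MvPowerSeries τ ℂ) :
    applyWord (X :: l) f = X (applyWord l f) := rfl

theorem applyWord_append (l l' : List (Derivation ℂ (MvPowerSeries τ ℂ) (MvPowerSeries τ ℂ)))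
    (f : MvPowerSeries τ ℂ) : applyWord (l ++ l') f = applyWord l (applyWord l' f) := by
  induction l with
  | nil => rfl
  | cons X l ih => rw [List.cons_append, applyWord_cons, ih, applyWord_cons]

/-- All derivatives of `f` along words in `g` vanish at `0`. -/
def IsKilledBy (g : LieSubalgebra ℂ (Derivation ℂ (MvPowerSeries τ ℂ) (MvPowerSeries τ ℂ)))
    (f : MvPowerSeries τ ℂ) : Prop :=
  ∀ l : List (Derivation ℂ (MvPowerSeries τ ℂ) (MvPowerSeries τ ℂ)), (∀ X ∈ l, X ∈ g) →
    constantCoeff (applyWord l f) = 0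

/-- The value at `0` of a formal vector field. -/
def valueAtZero (τ : Type*) :
    Derivation ℂ (MvPowerSeries τ ℂ) (MvPowerSeries τ ℂ) →ₗ[ℂ] (τ → ℂ) where
  toFun X i := constantCoeff (X (MvPowerSeries.X i))
  map_add' _ _ := by ext; simp
  map_smul' _ _ := by ext; simp

theorem valueAtZero_apply (X : Derivation ℂ (MvPowerSeries τ ℂ) (MvPowerSeries τ ℂ)) (i : τ) :
    valueAtZero τ X i = constantCoeff (X (MvPowerSeries.X i)) := rfl

variable {g : LieSubalgebra ℂ (Derivation ℂ (MvPowerSeries τ ℂ) (MvPowerSeries τ ℂ))}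

/-- Exchanging two adjacent letters changes the word by a shorter one that contains their bracket,
which still lies in `g`. The prefix `pre` lets the induction over permutations reach inner
positions. -/
theorem constantCoeff_applyWord_perm {f : MvPowerSeries τ ℂ} {s : ℕ}
    (hs : ∀ l : List (Derivation ℂ (MvPowerSeries τ ℂ) (MvPowerSeries τ ℂ)), l.length < s →
      (∀ X ∈ l, X ∈ g) → constantCoeff (applyWord l f) = 0)
    {l l' : List (Derivation ℂ (MvPowerSeries τ ℂ) (MvPowerSeries τ ℂ))} (h : l.Perm l') :
    ∀ pre : List (Derivation ℂ (MvPowerSeries τ ℂ) (MvPowerSeries τ ℂ)),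
      (∀ X ∈ pre ++ l, X ∈ g) → (pre ++ l).length = s →
      constantCoeff (applyWord (pre ++ l) f) = constantCoeff (applyWord (pre ++ l') f) := by
  induction h with
  | nil => intro _ _ _; rfl
  | cons x _ ih =>
    intro pre h1 h2
    have := ih (pre ++ [x]) (by simpa using h1) (by simpa using h2)
    simpa using this
  | swap x y l =>
    intro pre h1 h2
    have hlie : ⁅y, x⁆ ∈ g := g.lie_mem (h1 y (by simp)) (h1 x (by simp))
    have h3 := hs (pre ++ ⁅y, x⁆ :: l) (by
      rw [← h2]; simp) (by
      intro X hX
      simp only [List.mem_append, List.mem_cons] at hX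
      rcases hX with hX | rfl | hX
      · exact h1 X (by simp [hX])
      · exact hlie
      · exact h1 X (by simp [hX]))
    rw [applyWord_append, applyWord_cons, Derivation.commutator_apply, map_sub, map_sub,
      sub_eq_zero] at h3
    simpa only [applyWord_append, applyWord_cons] using h3
  | trans h₁ _ ih₁ ih₂ =>
    intro pre h1 h2
    rw [ih₁ pre h1 h2]
    refine ih₂ pre (fun X hX => h1 X ?_) ?_
    · exact ((List.Perm.append_left pre h₁).mem_iff).2 hX
    · rw [← h2]
      exact ((List.Perm.append_left pre h₁).length_eq).symm

variable [Fintype τ]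

theorem constantCoeff_eq_zero_of_valueAtZero
    {Z : Derivation ℂ (MvPowerSeries τ ℂ) (MvPowerSeries τ ℂ)} (hZ : valueAtZero τ Z = 0)
    (f : MvPowerSeries τ ℂ) : constantCoeff (Z f) = 0 := by
  rw [derivation_eq_sum, map_sum]
  refine Finset.sum_eq_zero fun i _ => ?_
  rw [map_mul, ← valueAtZero_apply, hZ, Pi.zero_apply, mul_zero]

/-- If `g` is spanned by the `X i` and by fields vanishing at `0`, it suffices to test words in the
`X i` whose letters are in increasing order. -/
theorem isKilledBy_of_sorted {ι : Type*} [Fintype ι] [LinearOrder ι]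
    {X : ι → Derivation ℂ (MvPowerSeries τ ℂ) (MvPowerSeries τ ℂ)} (hX : ∀ i, X i ∈ g)
    (hspan : ∀ Y ∈ g, ∃ c : ι → ℂ, valueAtZero τ (Y - ∑ i, c i • X i) = 0)
    {f : MvPowerSeries τ ℂ}
    (hf : ∀ μ : Multiset ι, constantCoeff (applyWord ((μ.sort (· ≤ ·)).map X) f) = 0) :
    IsKilledBy g f := by
  classical
  suffices ∀ s : ℕ, ∀ l : List (Derivation ℂ (MvPowerSeries τ ℂ) (MvPowerSeries τ ℂ)),
      l.length = s → (∀ X ∈ l, X ∈ g) → constantCoeff (applyWord l f) = 0 from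
    fun l => this _ l rfl
  intro s
  induction s using Nat.strong_induction_on with
  | _ s ih =>
  have ih' : ∀ l : List (Derivation ℂ (MvPowerSeries τ ℂ) (MvPowerSeries τ ℂ)), l.length < s →
      (∀ X ∈ l, X ∈ g) → constantCoeff (applyWord l f) = 0 := fun l hl => ih _ hl l rfl
  -- A letter vanishing at `0` can be moved to the front, where it is applied last and makes the
  -- constant term vanish.
  have hvanish : ∀ (l l' : List (Derivation ℂ (MvPowerSeries τ ℂ) (MvPowerSeries τ ℂ))) (Z),
      valueAtZero τ Z = 0 → (∀ X ∈ l ++ Z :: l', X ∈ g) → (l ++ Z :: l').length = s →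
      constantCoeff (applyWord (l ++ Z :: l') f) = 0 := by
    intro l l' Z hZ h1 h2
    have := constantCoeff_applyWord_perm ih' (List.perm_middle (a := Z) (l₁ := l) (l₂ := l')) []
      h1 h2
    rw [List.nil_append, List.nil_append] at this
    rw [this, applyWord_cons]
    exact constantCoeff_eq_zero_of_valueAtZero hZ _
  -- The letters of `l` are replaced one at a time by combinations of the `X i`, modulo fields
  -- vanishing at `0`. Once `l` is exhausted, the word is sorted.
  have hmain : ∀ (l : List (Derivation ℂ (MvPowerSeries τ ℂ) (MvPowerSeries τ ℂ))) (m : List ι),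
      (∀ X ∈ l, X ∈ g) → m.length + l.length = s →
      constantCoeff (applyWord (m.map X ++ l) f) = 0 := by
    intro l
    induction l with
    | nil =>
      intro m _ hm
      have hp : m.Perm ((m : Multiset ι).sort (· ≤ ·)) := by
        rw [← Multiset.coe_eq_coe, Multiset.sort_eq]
      have := constantCoeff_applyWord_perm ih' (hp.map X) [] (by
        intro Y hY
        simp only [List.nil_append, List.mem_map] at hY
        obtain ⟨i, -, rfl⟩ := hY
        exact hX i) (by simpa using hm)
      rw [List.nil_append, List.nil_append] at this
      rw [List.append_nil, this, hf]
    | cons Y l ihl =>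
      intro m hl hm
      have hlg : ∀ X ∈ l, X ∈ g := fun X hX => hl X (by simp [hX])
      obtain ⟨c, hc⟩ := hspan Y (hl Y (by simp))
      have hZg : Y - ∑ i, c i • X i ∈ g :=
        g.toSubmodule.sub_mem (hl Y (by simp))
          (g.toSubmodule.sum_mem fun i _ => g.toSubmodule.smul_mem _ (hX i))
      have h1 := hvanish (m.map X) l _ hc (by
        intro X' hX'
        simp only [List.mem_append, List.mem_map, List.mem_cons] at hX'
        rcases hX' with ⟨i, -, rfl⟩ | rfl | hX'
        · exact hX i
        · exact hZg
        · exact hlg _ hX') (by simpa using hm)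
      have h2 : ∀ i, constantCoeff (applyWord (m.map X) (X i (applyWord l f))) = 0 := by
        intro i
        have := ihl (m ++ [i]) hlg (by simp at hm ⊢; omega)
        simpa [applyWord_append] using this
      rw [applyWord_append, applyWord_cons, Derivation.sub_apply, derivation_sum_apply, map_sub,
        map_sub, map_sum, map_sum, Finset.sum_eq_zero, sub_zero] at h1
      · rwa [applyWord_append, applyWord_cons]
      · intro i _
        rw [Derivation.smul_apply, map_smul, constantCoeff_smul, h2, smul_zero]
  intro l hl hlg
  exact hmain l [] hlg (by simpa using hl)

end Words

/-! ### A formal Nagano theorem. -/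

section OrbitFunctions

variable {ι : Type*}

theorem exists_coeff_applyWord_pderiv [DecidableEq ι] (l : List ι) : ∀ β : ι →₀ ℕ, ∃ c : ℂ, c ≠ 0 ∧
    ∀ φ : MvPowerSeries ι ℂ, coeff β (applyWord (l.map (pderiv ℂ)) φ) =
      c * coeff (β + Multiset.toFinsupp (l : Multiset ι)) φ := by
  induction l with
  | nil => exact fun β => ⟨1, one_ne_zero, fun φ => by simp⟩
  | cons i l ih =>
    intro β
    obtain ⟨c, hc, h⟩ := ih (β + Finsupp.single i 1)
    refine ⟨c * (β i + 1), mul_ne_zero hc (Nat.cast_add_one_ne_zero _), fun φ => ?_⟩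
    rw [List.map_cons, applyWord_cons, coeff_pderiv, h, ← Multiset.cons_coe,
      ← Multiset.singleton_add, map_add, Multiset.toFinsupp_singleton, add_assoc]
    ring

/-- Sorted words correspond to monomials, and each derivative at `0` is a nonzero multiple of one
coefficient. All of them can therefore be prescribed freely. -/
theorem exists_constantCoeff_applyWord_pderiv_eq [LinearOrder ι] (v : Multiset ι → ℂ) :
    ∃ φ : MvPowerSeries ι ℂ, ∀ μ : Multiset ι,
      constantCoeff (applyWord ((μ.sort (· ≤ ·)).map (pderiv ℂ)) φ) = v μ := by
  choose c hc h using fun μ : Multiset ι =>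
    exists_coeff_applyWord_pderiv (μ.sort (· ≤ ·)) (0 : ι →₀ ℕ)
  let φ : MvPowerSeries ι ℂ := fun α => v (Finsupp.toMultiset α) / c (Finsupp.toMultiset α)
  refine ⟨φ, fun μ => ?_⟩
  have h1 : coeff (Multiset.toFinsupp μ) φ = v μ / c μ := by
    change v (Finsupp.toMultiset (Multiset.toFinsupp μ)) /
      c (Finsupp.toMultiset (Multiset.toFinsupp μ)) = _
    rw [Multiset.toFinsupp_toMultiset]
  rw [← coeff_zero_eq_constantCoeff_apply, h, zero_add, Multiset.sort_eq, h1]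
  field_simp [hc μ]

variable {τ : Type*} [Fintype τ]

/-- The linear form with coefficients `c`, as a power series. -/
def linearSeries (c : (τ → ℂ) →ₗ[ℂ] ℂ) : MvPowerSeries τ ℂ :=
  open Classical in ∑ t, c (Pi.single t 1) • X t

theorem constantCoeff_linearSeries (c : (τ → ℂ) →ₗ[ℂ] ℂ) :
    constantCoeff (linearSeries c) = 0 := by
  simp [linearSeries]

theorem constantCoeff_derivation_linearSeries (c : (τ → ℂ) →ₗ[ℂ] ℂ)
    (D : Derivation ℂ (MvPowerSeries τ ℂ) (MvPowerSeries τ ℂ)) :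
    constantCoeff (D (linearSeries c)) = c (valueAtZero τ D) := by
  classical
  rw [linearSeries, map_sum, map_sum]
  conv_rhs => rw [LinearMap.pi_apply_eq_sum_univ c]
  refine Finset.sum_congr rfl fun t _ => ?_
  rw [Derivation.map_smul, constantCoeff_smul, smul_eq_mul, smul_eq_mul, mul_comm,
    valueAtZero_apply]
  congr 2
  funext s
  simp [Pi.single_apply, eq_comm]

theorem constantCoeff_pderiv_linearSeries [DecidableEq τ] (c : (τ → ℂ) →ₗ[ℂ] ℂ) (t : τ) :
    constantCoeff (pderiv ℂ t (linearSeries c)) = c (Pi.single t 1) := by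
  rw [constantCoeff_derivation_linearSeries]
  congr 1
  funext s
  rw [valueAtZero_apply, pderiv_X', apply_ite constantCoeff, map_one, map_zero, Pi.single_apply]

/-- Formal version of Nagano's theorem: the functions vanishing on the orbit of `g` through `0`. -/
theorem exists_isKilledBy
    (g : LieSubalgebra ℂ (Derivation ℂ (MvPowerSeries τ ℂ) (MvPowerSeries τ ℂ)))
    (hsmul : ∀ (a : MvPowerSeries τ ℂ), ∀ X ∈ g, a • X ∈ g) :
    ∃ (m : ℕ) (f : Fin m → MvPowerSeries τ ℂ),
      m + Module.finrank ℂ (g.toSubmodule.map (valueAtZero τ)) = Fintype.card τ ∧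
      LinearIndependent ℂ (fun s i => constantCoeff (pderiv ℂ i (f s))) ∧
      ∀ s, IsKilledBy g (f s) := by
  classical
  let W := g.toSubmodule.map (valueAtZero τ)
  let b := Module.finBasis ℂ W
  set r := Module.finrank ℂ W with hr
  have hex : ∀ i, ∃ X ∈ g, valueAtZero τ X = b i := fun i => (b i).2
  choose X₀ hX₀g hX₀b using hex
  have hext : ∀ i, ∃ c : (τ → ℂ) →ₗ[ℂ] ℂ, c ∘ₗ W.subtype = b.coord i := fun i =>
    LinearMap.exists_extend _
  choose ℓ hℓ using hext
  have hℓb : ∀ i j, ℓ i (b j) = if j = i then 1 else 0 := by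
    intro i j
    have := congrArg (fun φ => φ (b j)) (hℓ i)
    simpa [Finsupp.single_apply] using this
  let L : Fin r → MvPowerSeries τ ℂ := fun i => linearSeries (ℓ i)
  have hL0 : ∀ i, constantCoeff (L i) = 0 := fun i => constantCoeff_linearSeries _
  let A : Matrix (Fin r) (Fin r) (MvPowerSeries τ ℂ) := Matrix.of fun i j => X₀ i (L j)
  have hA0 : A.map constantCoeff = 1 := by
    ext i j
    simp [A, L, constantCoeff_derivation_linearSeries, hX₀b, hℓb, Matrix.one_apply]
  obtain ⟨B, hAB, hBA⟩ := isUnit_iff_exists.1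
    (isUnit_matrix_of_constantCoeff (A := A) (hA0 ▸ isUnit_one))
  have hB0 : B.map constantCoeff = 1 := by
    have := congrArg (fun M => M.map constantCoeff) hBA
    rw [Matrix.map_mul, hA0, mul_one] at this
    rw [this]
    exact Matrix.map_one _ (map_zero _) (map_one _)
  -- Multiplying by the inverse of `A` gives `Y i (L j) = δ` identically and not only at `0`. Words
  -- in the `Y i` then act on series in `L` as words of partial derivatives.
  let Y : Fin r → Derivation ℂ (MvPowerSeries τ ℂ) (MvPowerSeries τ ℂ) := fun i =>
    ∑ k, B i k • X₀ k
  have hYg : ∀ i, Y i ∈ g := fun i =>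
    g.toSubmodule.sum_mem fun k _ => hsmul _ _ (hX₀g k)
  have hYL : ∀ i j, Y i (L j) = if i = j then 1 else 0 := by
    intro i j
    have := congrFun (congrFun hBA i) j
    rw [Matrix.mul_apply, Matrix.one_apply] at this
    simpa [Y, A, derivation_sum_apply] using this
  have hYb : ∀ i, valueAtZero τ (Y i) = b i := by
    intro i
    funext t
    have hB0' : ∀ k, constantCoeff (B i k) = if i = k then 1 else 0 := fun k => by
      have := congrFun (congrFun hB0 i) k
      rwa [Matrix.map_apply, Matrix.one_apply] at this
    rw [valueAtZero_apply, ← hX₀b]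
    simp only [Y, derivation_sum_apply, Derivation.smul_apply, smul_eq_mul, map_sum, map_mul, hB0']
    simp [valueAtZero_apply]
  have hspan : ∀ Z ∈ g, ∃ c : Fin r → ℂ, valueAtZero τ (Z - ∑ i, c i • Y i) = 0 := by
    intro Z hZ
    let w : W := ⟨valueAtZero τ Z, Submodule.mem_map_of_mem hZ⟩
    refine ⟨fun i => b.repr w i, ?_⟩
    rw [map_sub, map_sum, sub_eq_zero]
    simp only [map_smul, hYb]
    have := congrArg W.subtype (b.sum_repr w)
    rw [map_sum] at this
    exact this.symm
  let lam := Module.finBasis ℂ W.dualAnnihilator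
  have hlamW : ∀ s i, (lam s : Module.Dual ℂ (τ → ℂ)) (b i) = 0 := fun s i =>
    (Submodule.mem_dualAnnihilator _).1 (lam s).2 _ (b i).2
  let Λ : Fin (Module.finrank ℂ W.dualAnnihilator) → MvPowerSeries τ ℂ := fun s =>
    linearSeries (lam s : Module.Dual ℂ (τ → ℂ))
  -- `φ s` is chosen so that `φ s` evaluated at `L` has the same ordered `Y`-derivatives at `0` as
  -- the linear form `Λ s`. Their difference is the series sought.
  choose φ hφ using fun s => exists_constantCoeff_applyWord_pderiv_eq
    (fun μ : Multiset (Fin r) => constantCoeff (applyWord ((μ.sort (· ≤ ·)).map Y) (Λ s)))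
  have hword : ∀ (m : List (Fin r)) (ψ : MvPowerSeries (Fin r) ℂ),
      applyWord (m.map Y) (subst L ψ) = subst L (applyWord (m.map (pderiv ℂ)) ψ) := by
    intro m ψ
    induction m with
    | nil => rfl
    | cons i m ih =>
      rw [List.map_cons, List.map_cons, applyWord_cons, applyWord_cons, ih, derivation_subst hL0]
      simp [hYL]
  refine ⟨_, fun s => Λ s - subst L (φ s), ?_, ?_, fun s => ?_⟩
  · have := Subspace.finrank_add_finrank_dualAnnihilator_eq W
    rw [Module.finrank_fintype_fun_eq_card] at this
    rw [add_comm]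
    exact this
  -- The form `lam s` annihilates the values of `g` at `0`, so the correction has no linear terms
  -- and leaves the differential of `Λ s` unchanged.
  · have hφ1 : ∀ s j, constantCoeff (pderiv ℂ j (φ s)) = 0 := by
      intro s j
      have := hφ s {j}
      simp only [Multiset.sort_singleton, List.map_cons, List.map_nil, applyWord_cons,
        applyWord_nil] at this
      rw [this]
      simp only [Λ]
      rw [constantCoeff_derivation_linearSeries, hYb, hlamW]
    have heq : (fun s i => constantCoeff (pderiv ℂ i (Λ s - subst L (φ s)))) =
        fun s i => (lam s : Module.Dual ℂ (τ → ℂ)) (Pi.single i 1) := by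
      funext s i
      rw [map_sub, map_sub, constantCoeff_pderiv_subst hL0]
      simp only [hφ1, zero_mul, Finset.sum_const_zero, sub_zero, Λ]
      exact constantCoeff_pderiv_linearSeries _ i
    rw [heq]
    let ev : Module.Dual ℂ (τ → ℂ) →ₗ[ℂ] (τ → ℂ) :=
      { toFun := fun c i => c (Pi.single i 1)
        map_add' := fun _ _ => rfl
        map_smul' := fun _ _ => rfl }
    have hev : LinearMap.ker ev = ⊥ := by
      rw [LinearMap.ker_eq_bot']
      intro c hc
      refine LinearMap.pi_ext' fun i => LinearMap.ext_ring ?_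
      simpa [ev] using congrFun hc i
    exact (lam.linearIndependent.map' (Submodule.subtype _) (Submodule.ker_subtype _)).map' ev hev
  · refine isKilledBy_of_sorted hYg hspan fun μ => ?_
    rw [map_sub, map_sub, hword, constantCoeff_subst_of_constantCoeff_zero hL0, hφ, sub_self]

end OrbitFunctions

/-! ### Module structure of `𝔤_M` and its dimension bound. -/

section CRLieAlgebra

variable {N d : ℕ}

theorem smul_mem_crLieAlgebra (ρ : Fin d → SeriesZζ N) (a : SeriesZζ N)
    {X : Derivation ℂ (SeriesZζ N) (SeriesZζ N)} (hX : X ∈ crLieAlgebra ρ) :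
    a • X ∈ crLieAlgebra ρ := by
  let K : LieSubalgebra ℂ (Derivation ℂ (SeriesZζ N) (SeriesZζ N)) :=
    { carrier := {X | X ∈ crLieAlgebra ρ ∧ ∀ a : SeriesZζ N, a • X ∈ crLieAlgebra ρ}
      add_mem' := fun hX hY => ⟨add_mem hX.1 hY.1, fun a => by
        rw [smul_add]; exact add_mem (hX.2 a) (hY.2 a)⟩
      zero_mem' := ⟨zero_mem _, fun a => by rw [smul_zero]; exact zero_mem _⟩
      smul_mem' := fun c X hX => ⟨(crLieAlgebra ρ).smul_mem c hX.1, fun a => by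
        rw [smul_comm]; exact (crLieAlgebra ρ).smul_mem c (hX.2 a)⟩
      lie_mem' := by
        intro X Y hX hY
        refine ⟨(crLieAlgebra ρ).lie_mem hX.1 hY.1, fun a => ?_⟩
        have : a • ⁅X, Y⁆ = ⁅a • X, Y⁆ + Y a • X := by
          refine Derivation.ext fun f => ?_
          simp only [Derivation.smul_apply, Derivation.add_apply, Derivation.commutator_apply,
            smul_eq_mul, Derivation.leibniz]
          ring
        rw [this]
        exact add_mem ((crLieAlgebra ρ).lie_mem (hX.2 a) hY.1) (hX.2 _) }
  have hle : crLieAlgebra ρ ≤ K := LieSubalgebra.lieSpan_le.2 fun X hX =>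
    ⟨LieSubalgebra.subset_lieSpan hX, fun a =>
      LieSubalgebra.subset_lieSpan ((crModule ρ).smul_mem a hX)⟩
  exact (hle hX).2 a

/-- Fields preserving the ideal of `ρ` form a Lie algebra containing `𝔤_M`. Their values at `0` are
annihilated by the `d` independent differentials of `ρ`. -/
theorem finrank_evalAtZero_add_le {ρ : Fin d → SeriesZζ N} (hM : IsFormalGeneric ρ) :
    Module.finrank ℂ ((crLieAlgebra ρ).toSubmodule.map (evalAtZero N)) + d ≤ 2 * N := by
  let I : Ideal (SeriesZζ N) := Ideal.span (Set.range ρ)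
  have hI0 : ∀ f ∈ I, constantCoeff f = 0 := by
    have : I ≤ RingHom.ker (constantCoeff : SeriesZζ N →+* ℂ) := by
      rw [Ideal.span_le]
      rintro _ ⟨j, rfl⟩
      exact hM.zero j
    exact fun f hf => this hf
  let K : LieSubalgebra ℂ (Derivation ℂ (SeriesZζ N) (SeriesZζ N)) :=
    { carrier := {X | ∀ f ∈ I, X f ∈ I}
      add_mem' := fun hX hY f hf => I.add_mem (hX f hf) (hY f hf)
      zero_mem' := fun f _ => I.zero_mem
      smul_mem' := fun c X hX f hf => by
        rw [Derivation.smul_apply, smul_eq_C_mul]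
        exact I.mul_mem_left _ (hX f hf)
      lie_mem' := fun {X Y} hX hY f hf => by
        rw [Derivation.commutator_apply]
        exact I.sub_mem (hX _ (hY f hf)) (hY _ (hX f hf)) }
  have hle : crLieAlgebra ρ ≤ K := by
    refine crLieAlgebra_le (fun a X hX f hf => I.mul_mem_left _ (hX f hf)) ?_
    rintro X ⟨A, hA⟩ -
    intro f hf
    refine Submodule.span_induction (p := fun f _ => X f ∈ I) ?_ ?_ ?_ ?_ hf
    · rintro _ ⟨j, rfl⟩
      rw [congrFun hA j]
      exact Ideal.sum_mem I (t := Finset.univ) (f := fun l => A j l * ρ l) fun l _ =>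
        I.mul_mem_left _ (Ideal.subset_span ⟨l, rfl⟩)
    · rw [map_zero]; exact I.zero_mem
    · intro x y _ _ hx hy
      rw [map_add]
      exact I.add_mem hx hy
    · intro a x hx hXx
      rw [smul_eq_mul, Derivation.leibniz]
      refine I.add_mem (I.mul_mem_left _ hXx) ?_
      rw [smul_eq_mul]
      exact I.mul_mem_right _ hx
  let P : Matrix (Fin d) (Fin N ⊕ Fin N) ℂ :=
    Matrix.of fun j i => constantCoeff (pderiv ℂ i (ρ j))
  have hP : P.rank = d := by
    have hli : LinearIndependent ℂ P.row := by
      have : LinearIndependent ℂ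
          ((LinearMap.funLeft ℂ ℂ (Sum.inl : Fin N → Fin N ⊕ Fin N)) ∘ P.row) := hM.generic
      exact this.of_comp _
    simpa using hli.rank_matrix
  have hker : (crLieAlgebra ρ).toSubmodule.map (evalAtZero N) ≤ LinearMap.ker P.mulVecLin := by
    rintro _ ⟨X, hX, rfl⟩
    rw [LinearMap.mem_ker, Matrix.mulVecLin_apply]
    funext j
    have h1 := hI0 _ (hle hX (ρ j) (Ideal.subset_span ⟨j, rfl⟩))
    rw [derivation_eq_sum, map_sum] at h1
    simpa [P, Matrix.mulVec, dotProduct, evalAtZero] using h1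
  have h1 := Submodule.finrank_mono hker
  have h2 := LinearMap.finrank_range_add_finrank_ker P.mulVecLin
  rw [Module.finrank_fintype_fun_eq_card, Fintype.card_sum, Fintype.card_fin] at h2
  rw [Matrix.rank] at hP
  omega

end CRLieAlgebra

end

end FormalCR

namespace FormalCR

open MvPowerSeries

noncomputable section

/-! ### Vanishing by Taylor expansion in part of the variables. -/

section Taylor

variable {ι ν : Type*} [Fintype ι] [Finite ν]

theorem le_order_subst_of_le {υ : Type*} {a : ι → MvPowerSeries υ ℂ}
    (ha : ∀ i, constantCoeff (a i) = 0) {k : ℕ∞} {f : MvPowerSeries ι ℂ} (hf : k ≤ f.order) :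
    k ≤ (subst a f).order := by
  refine hf.trans (le_trans ?_ (le_order_subst (hasSubst_of_constantCoeff_zero ha) f))
  exact le_mul_of_one_le_left zero_le
    (le_iInf fun i => one_le_order_iff_constCoeff_eq_zero.2 (ha i))

/-- A set of power series that is stable under differentiation in some of the variables, and whose
elements vanish after a substitution for these variables, consists of `0`. -/
theorem eq_zero_of_pderiv_mem (e : ν ↪ ι) {H : Set (MvPowerSeries ι ℂ)}
    (hH : ∀ h ∈ H, ∀ i ∉ Set.range e, pderiv ℂ i h ∈ H) {a : ι → MvPowerSeries ι ℂ}
    (ha0 : ∀ i, constantCoeff (a i) = 0) (hae : ∀ i, a (e i) = X (e i))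
    (ha : ∀ h ∈ H, subst a h = 0) {h : MvPowerSeries ι ℂ} (hh : h ∈ H) : h = 0 := by
  have hs := hasSubst_of_constantCoeff_zero ha0
  suffices ∀ k : ℕ, ∀ h ∈ H, (k : ℕ∞) ≤ h.order from
    eq_zero_of_forall_nat_le_order fun k => this k h hh
  intro k
  induction k with
  | zero => simp
  | succ k ih =>
    intro h hh
    let h₀ : MvPowerSeries ι ℂ := rename e (killCompl e h)
    -- The derivatives of `h` in the free variables have order at least `k`. Up to degree `k`,
    -- therefore, only monomials in the variables of `e` occur in `h`, and these form `h₀`.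
    have hdiff : ((k + 1 : ℕ) : ℕ∞) ≤ (h - h₀).order := by
      refine nat_le_order fun m hm => ?_
      by_cases hme : ∃ m', m = Finsupp.embDomain e m'
      · obtain ⟨m', rfl⟩ := hme
        rw [map_sub, coeff_embDomain_rename, coeff_killCompl, sub_self]
      · have h2 : coeff m h₀ = 0 := by
          refine coeff_rename_eq_zero _ _ ?_
          rintro ⟨m', hm'⟩
          exact hme ⟨m', by rw [Finsupp.embDomain_eq_mapDomain, hm']⟩
        obtain ⟨i, hi, hmi⟩ : ∃ i ∉ Set.range e, m i ≠ 0 := by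
          by_contra! hcon
          refine hme ⟨m.comapDomain e e.injective.injOn, ?_⟩
          ext i
          by_cases hi : i ∈ Set.range e
          · obtain ⟨i, rfl⟩ := hi
            rw [Finsupp.embDomain_apply_self, Finsupp.comapDomain_apply]
          · rw [Finsupp.embDomain_of_notMem_range _ _ _ hi, hcon i hi]
        rw [map_sub, h2, sub_zero]
        have hle : Finsupp.single i 1 ≤ m := by
          rw [Finsupp.single_le_iff]
          omega
        obtain ⟨m', rfl⟩ := exists_add_of_le hle
        have h3 := coeff_of_lt_order (d := m') (lt_of_lt_of_le (by
          rw [map_add, Finsupp.degree_single] at hm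
          exact_mod_cast (by omega : m'.degree < k)) (ih _ (hH h hh i hi)))
        rw [coeff_pderiv, add_comm m'] at h3
        exact (mul_eq_zero.1 h3).resolve_right (Nat.cast_add_one_ne_zero _)
    have hsub : subst a h₀ = h₀ := by
      simp only [h₀]
      rw [subst_rename _ ha0, rename_eq_subst]
      congr 1
      funext i
      exact hae i
    -- The substitution fixes `h₀` and kills `h`, so `h₀` inherits the order of `h - h₀`.
    have h4 : h₀ = - subst a (h - h₀) := by
      rw [subst_sub hs, ha h hh, hsub]
      ring
    have h5 : ((k + 1 : ℕ) : ℕ∞) ≤ h₀.order := by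
      rw [h4, order_neg]
      exact le_order_subst_of_le ha0 hdiff
    have : h = (h - h₀) + h₀ := by ring
    rw [this]
    exact le_order_add hdiff h5

end Taylor

section Invertible

variable {σ τ : Type*} [Finite σ] [Finite τ]

theorem IsFormalInvertible.bar {F : τ → MvPowerSeries σ ℂ} (hF : IsFormalInvertible F) :
    IsFormalInvertible fun i => bar (F i) := by
  obtain ⟨hF0, G, hG0, hFG, hGF⟩ := hF
  refine ⟨by simp [hF0], fun i => FormalCR.bar (G i), by simp [hG0], fun i => ?_, fun i => ?_⟩
  · rw [← bar_subst hG0, hFG, bar_X]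
  · rw [← bar_subst hF0, hGF, bar_X]

theorem IsFormalInvertible.exists_complexify {F : τ → MvPowerSeries σ ℂ}
    (hF : IsFormalInvertible F) : ∃ G : σ ⊕ σ → MvPowerSeries (τ ⊕ τ) ℂ,
      (∀ i, constantCoeff (G i) = 0) ∧ (∀ i, subst G (complexify F i) = X i) ∧
      ∀ i, subst (complexify F) (G i) = X i := by
  obtain ⟨hF0, G, hG0, hFG, hGF⟩ := hF
  refine ⟨complexify G, constantCoeff_complexify hG0, fun i => ?_, fun i => ?_⟩
  · rw [complexify_comp hG0]
    simp only [hFG]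
    rw [complexify_X]
  · rw [complexify_comp hF0]
    simp only [hGF]
    rw [complexify_X]

theorem IsFormalInvertible.complexify {F : τ → MvPowerSeries σ ℂ} (hF : IsFormalInvertible F) :
    IsFormalInvertible (complexify F) :=
  ⟨constantCoeff_complexify hF.1, hF.exists_complexify⟩

end Invertible

/-! ### Conjugation of fields and a tangent frame adapted to normal coordinates. -/

section Conjugation

variable {N d : ℕ}

/-- The conjugation `f(Z, ζ) ↦ f̄(ζ, Z)`. -/
def conj (f : SeriesZζ N) : SeriesZζ N := rename Sum.swap (bar f)

theorem conj_conj (f : SeriesZζ N) : conj (conj f) = f := by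
  rw [conj, conj, bar_rename, bar_bar]
  exact (renameEquiv ℂ (Equiv.sumComm (Fin N) (Fin N))).symm_apply_apply f

theorem conj_mul (f g : SeriesZζ N) : conj (f * g) = conj f * conj g := by
  rw [conj, bar_mul, map_mul]
  rfl

theorem conj_sum {ι : Type*} (s : Finset ι) (f : ι → SeriesZζ N) :
    conj (∑ i ∈ s, f i) = ∑ i ∈ s, conj (f i) := by
  rw [conj, bar_sum, map_sum]
  rfl

theorem constantCoeff_conj (f : SeriesZζ N) :
    constantCoeff (conj f) = starRingEnd ℂ (constantCoeff f) := by
  rw [conj, constantCoeff_rename, constantCoeff_bar]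

theorem vectorField_conj (a : Fin N → SeriesZζ N) (f : SeriesZζ N) :
    vectorField 0 (fun i => conj (a i)) (conj f) = conj (vectorField a 0 f) := by
  have h : ∀ j, pderiv ℂ (Sum.inr j) (conj f) = conj (pderiv ℂ (Sum.inl j) f) := by
    intro j
    have : (Sum.inr j : Fin N ⊕ Fin N) = Sum.swap (Sum.inl j) := rfl
    rw [conj, this, pderiv_rename_of_injective Sum.swap_leftInverse.injective, pderiv_bar]
    rfl
  simp [vectorField, derivation_sum_apply, conj_sum, conj_mul, h]

theorem isTangent_conj {ρ : Fin d → SeriesZζ N} (hρ : ∀ j, ρ j = conj (ρ j))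
    {a : Fin N → SeriesZζ N} (ha : IsTangent ρ (vectorField a 0)) :
    IsTangent ρ (vectorField 0 fun i => conj (a i)) := by
  obtain ⟨A, hA⟩ := ha
  refine ⟨A.map conj, funext fun j => ?_⟩
  rw [hρ j, vectorField_conj, congrFun hA j]
  simp only [Matrix.mulVec, dotProduct, conj_sum, conj_mul, Matrix.map_apply, ← hρ]

theorem bar_subst_conj {σ : Type*} {V : Fin N ⊕ Fin N → MvPowerSeries σ ℂ}
    (hV : ∀ i, constantCoeff (V i) = 0) (f : SeriesZζ N) :
    bar (subst V (conj f)) = subst (fun i => bar (V i.swap)) f := by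
  rw [bar_subst hV, conj, bar_rename, bar_bar, subst_rename _ (by simp [hV])]

end Conjugation

section CRFrame

variable {N n d : ℕ} {ρ : Fin d → SeriesZζ N} {Z : Fin N → MvPowerSeries (Fin n ⊕ Fin d) ℂ}
  {Q : Fin d → MvPowerSeries (Fin n ⊕ (Fin n ⊕ Fin d)) ℂ}

/-- The field `∂/∂z_j + ∑ₗ (∂Q_l/∂z_j)(z, χ, τ) ∂/∂w_l` in normal coordinates. -/
def graphField (Q : Fin d → MvPowerSeries (Fin n ⊕ (Fin n ⊕ Fin d)) ℂ) (j : Fin n) :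
    Derivation ℂ (MvPowerSeries ((Fin n ⊕ Fin d) ⊕ (Fin n ⊕ Fin d)) ℂ)
      (MvPowerSeries ((Fin n ⊕ Fin d) ⊕ (Fin n ⊕ Fin d)) ℂ) :=
  pderiv ℂ (Sum.inl (Sum.inl j)) +
    ∑ l, (rename (Sum.map Sum.inl id) (pderiv ℂ (Sum.inl j) (Q l)) :
      MvPowerSeries ((Fin n ⊕ Fin d) ⊕ (Fin n ⊕ Fin d)) ℂ) • pderiv ℂ (Sum.inl (Sum.inr l))

theorem graphField_apply (j : Fin n)
    (f : MvPowerSeries ((Fin n ⊕ Fin d) ⊕ (Fin n ⊕ Fin d)) ℂ) :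
    graphField Q j f = pderiv ℂ (Sum.inl (Sum.inl j)) f +
      ∑ l, rename (Sum.map Sum.inl id) (pderiv ℂ (Sum.inl j) (Q l)) *
        pderiv ℂ (Sum.inl (Sum.inr l)) f := by
  simp [graphField, derivation_sum_apply]

theorem graphField_sub (j : Fin n) (l : Fin d) :
    graphField Q j (X (Sum.inl (Sum.inr l)) - rename (Sum.map Sum.inl id) (Q l)) = 0 := by
  have hinj : Function.Injective (Sum.map Sum.inl id : Fin n ⊕ (Fin n ⊕ Fin d) →
      (Fin n ⊕ Fin d) ⊕ (Fin n ⊕ Fin d)) :=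
    Sum.map_injective.2 ⟨Sum.inl_injective, Function.injective_id⟩
  have h1 : ∀ m, pderiv ℂ (Sum.inl (Sum.inr m)) (rename (Sum.map Sum.inl id) (Q l) :
      MvPowerSeries ((Fin n ⊕ Fin d) ⊕ (Fin n ⊕ Fin d)) ℂ) = 0 := fun m =>
    pderiv_rename_of_notMem_range (by simp) _
  have h2 : pderiv ℂ (Sum.inl (Sum.inl j)) (rename (Sum.map Sum.inl id) (Q l) :
      MvPowerSeries ((Fin n ⊕ Fin d) ⊕ (Fin n ⊕ Fin d)) ℂ) =
      rename (Sum.map Sum.inl id) (pderiv ℂ (Sum.inl j) (Q l)) :=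
    pderiv_rename_of_injective hinj (Sum.inl j) (Q l)
  rw [graphField_apply]
  simp only [map_sub, h1, h2, pderiv_X']
  simp

/-- A frame of `(1,0)` vector fields tangent to `M`, adapted to normal coordinates. -/
theorem exists_tangent_frame (hZ : IsNormalCoordinates ρ Z Q) :
    ∃ a : Fin n → Fin N → SeriesZζ N, (∀ j, IsTangent ρ (vectorField (a j) 0)) ∧
      ∀ j f, subst (complexify Z) (vectorField (a j) 0 f) =
        graphField Q j (subst (complexify Z) f) := by
  obtain ⟨G, hG0, hZG, hGZ⟩ := hZ.invertible.exists_complexify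
  have hcZ := constantCoeff_complexify hZ.invertible.1
  have hsZ := hasSubst_of_constantCoeff_zero hcZ
  have hsG := hasSubst_of_constantCoeff_zero hG0
  let a : Fin n → Fin N → SeriesZζ N := fun j i =>
    subst G (graphField Q j (complexify Z (Sum.inl i)))
  have hcancel : ∀ f, subst (complexify Z) (subst G f) = f := by
    intro f
    rw [subst_subst hG0 hcZ]
    simp only [hGZ]
    exact congrFun subst_self f
  have hcancel' : ∀ f, subst G (subst (complexify Z) f) = f := by
    intro f
    rw [subst_subst hcZ hG0]
    simp only [hZG]
    exact congrFun subst_self f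
  have hrel : ∀ j f, subst (complexify Z) (vectorField (a j) 0 f) =
      graphField Q j (subst (complexify Z) f) := by
    intro j f
    rw [subst_derivation hcZ, derivation_subst hcZ]
    refine Finset.sum_congr rfl fun i _ => ?_
    congr 1
    rcases i with i | i
    · rw [vectorField_apply_X_inl, hcancel]
    · have h1 : ∀ s, pderiv ℂ (Sum.inl s) (complexify Z (Sum.inr i)) = 0 := fun s =>
        pderiv_rename_of_notMem_range (by simp) _
      rw [vectorField_apply_X_inr, Pi.zero_apply, subst_zero_right hsZ, graphField_apply]
      simp [h1]
  refine ⟨a, fun j => ?_, hrel⟩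
  obtain ⟨A, hA, hρ⟩ := hZ.defining
  obtain ⟨B, hAB, hBA⟩ := isUnit_iff_exists.1 hA
  let w : Fin d → MvPowerSeries ((Fin n ⊕ Fin d) ⊕ (Fin n ⊕ Fin d)) ℂ := fun l =>
    X (Sum.inl (Sum.inr l)) - rename (Sum.map Sum.inl id) (Q l)
  have hρ' : (fun l => subst (complexify Z) (ρ l)) = A.mulVec w := hρ
  have hw : w = B.mulVec fun l => subst (complexify Z) (ρ l) := by
    rw [hρ', Matrix.mulVec_mulVec, hBA, Matrix.one_mulVec]
  let D : Matrix (Fin d) (Fin d) (MvPowerSeries ((Fin n ⊕ Fin d) ⊕ (Fin n ⊕ Fin d)) ℂ) :=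
    A.map (graphField Q j) * B
  refine ⟨D.map (subst G), funext fun l => ?_⟩
  -- The graph field kills `w - Q`. On `ρ = A (w - Q)` only the derivative of `A` remains, and `B`
  -- converts `w - Q` back into `ρ`.
  have h1 : graphField Q j (subst (complexify Z) (ρ l)) =
      ∑ m, D l m * subst (complexify Z) (ρ m) := by
    have h2 : graphField Q j (subst (complexify Z) (ρ l)) = (A.map (graphField Q j)).mulVec w l := by
      rw [congrFun hρ' l, Matrix.mulVec, dotProduct, map_sum]
      refine Finset.sum_congr rfl fun m _ => ?_
      rw [Derivation.leibniz, graphField_sub, smul_zero, zero_add, smul_eq_mul, mul_comm]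
      rfl
    rw [h2, hw, Matrix.mulVec_mulVec]
    rfl
  rw [← hcancel' (vectorField (a j) 0 (ρ l)), hrel, h1, subst_sum hsG]
  simp only [subst_mul hsG, hcancel']
  rfl

end CRFrame

end

end FormalCR

namespace FormalCR

open MvPowerSeries

noncomputable section

/-! ### Segre points and their ranks. -/

section Rank

variable {σ ι τ : Type*} [Fintype σ] [Fintype ι] [Fintype τ]

/-- Adjoining variables on which `u` does not depend. -/
theorem genericRank_sumElim_X {g : ι → σ} (hg : Function.Injective g)
    {u : τ → MvPowerSeries σ ℂ} (hu : ∀ i s, pderiv ℂ (g i) (u s) = 0) :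
    genericRank (Sum.elim (fun i => X (g i)) u) = Fintype.card ι + genericRank u := by
  classical
  let K := FractionRing (MvPowerSeries σ ℂ)
  let q : ι ⊕ τ → MvPowerSeries σ ℂ := Sum.elim (fun i => X (g i)) u
  let e := LinearEquiv.sumArrowLequivProdArrow ι τ K K
  let T := (LinearMap.range (jacobian q).mulVecLin).map e.toLinearMap
  have hq₁ : ∀ (Y : σ → K) i, (jacobian q).mulVec Y (Sum.inl i) = Y (g i) := by
    intro Y i
    simp only [Matrix.mulVec, dotProduct, jacobian, Matrix.of_apply, q, Sum.elim_inl, pderiv_X']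
    rw [Finset.sum_eq_single (g i)]
    · simp
    · intro b _ hb
      simp [Ne.symm hb]
    · simp
  have hq₂ : ∀ (Y : σ → K) s, (jacobian q).mulVec Y (Sum.inr s) = (jacobian u).mulVec Y s :=
    fun _ _ => rfl
  have hTfin : Module.finrank K T = genericRank q := e.finrank_map_eq _
  have hfst : T.map (LinearMap.fst K _ _) = ⊤ := by
    refine eq_top_iff.2 fun y _ => ?_
    refine ⟨_, ⟨_, ⟨Function.extend g y 0, rfl⟩, rfl⟩, funext fun i => ?_⟩
    exact (hq₁ _ i).trans (hg.extend_apply y 0 i)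
  have hcomap : T.comap (LinearMap.inr K _ _) = LinearMap.range (jacobian u).mulVecLin := by
    ext b
    constructor
    · rintro ⟨_, ⟨Y, rfl⟩, hY⟩
      refine ⟨Y, funext fun s => ?_⟩
      exact congrFun (congrArg Prod.snd hY) s
    · rintro ⟨Y, rfl⟩
      refine ⟨_, ⟨fun j => if j ∈ Set.range g then 0 else Y j, rfl⟩, Prod.ext ?_ ?_⟩
      · funext i
        refine (hq₁ _ i).trans ?_
        simp
      · funext s
        refine (hq₂ _ s).trans ?_
        simp only [Matrix.mulVecLin_apply, Matrix.mulVec, dotProduct, LinearMap.inr_apply]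
        refine Finset.sum_congr rfl fun j _ => ?_
        split_ifs with hj
        · obtain ⟨i, rfl⟩ := hj
          simp [jacobian, hu]
        · rfl
  have h := Submodule.finrank_eq_finrank_map_fst_add T
  rw [hTfin, hfst, hcomap, finrank_top, Module.finrank_fintype_fun_eq_card] at h
  exact h

end Rank

section Segre

variable {N n d : ℕ} {ρ : Fin d → SeriesZζ N} {Z : Fin N → MvPowerSeries (Fin n ⊕ Fin d) ℂ}
  {Q : Fin d → MvPowerSeries (Fin n ⊕ (Fin n ⊕ Fin d)) ℂ}

theorem IsNormalCoordinates.constantCoeff_eq_zero (hZ : IsNormalCoordinates ρ Z Q) (j : Fin d) :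
    constantCoeff (Q j) = 0 := by
  have h := congrArg constantCoeff (hZ.normal_left j)
  rwa [constantCoeff_subst_of_constantCoeff_zero (by rintro (i | i) <;> simp), constantCoeff_X] at h

theorem constantCoeff_segreMap (hQ : ∀ j, constantCoeff (Q j) = 0) (k : ℕ) (s : Fin n ⊕ Fin d) :
    constantCoeff (segreMap Q k s) = 0 := by
  induction k generalizing s with
  | zero => simp [segreMap]
  | succ k ih =>
    rcases s with i | j
    · simp [segreMap]
    · simp only [segreMap, Sum.elim_inr]
      rw [constantCoeff_subst_of_constantCoeff_zero, hQ]
      rintro (i | i) <;> simp [ih]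

/-- The shift of the blocks of variables of a Segre mapping. -/
abbrev shift (k n : ℕ) : Fin k × Fin n → Fin (k + 1) × Fin n := Prod.map Fin.succ id

theorem shift_injective (k n : ℕ) : Function.Injective (shift k n) :=
  (Fin.succ_injective k).prodMap Function.injective_id

theorem zero_notMem_range_shift {k : ℕ} (j : Fin n) :
    ((0 : Fin (k + 1)), j) ∉ Set.range (shift k n) := by
  rintro ⟨⟨a, b⟩, h⟩
  exact Fin.succ_ne_zero a (congrArg Prod.fst h)

/-- The point `(v^{k+1}(z, χ¹, …), v̄^k(χ¹, …))` of the complexification of `M`, in normal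
coordinates. -/
def segrePoint (Q : Fin d → MvPowerSeries (Fin n ⊕ (Fin n ⊕ Fin d)) ℂ) (k : ℕ) :
    (Fin n ⊕ Fin d) ⊕ (Fin n ⊕ Fin d) → MvPowerSeries (Fin (k + 1) × Fin n) ℂ :=
  Sum.elim (segreMap Q (k + 1)) fun s => rename (shift k n) (bar (segreMap Q k s))

theorem constantCoeff_segrePoint (hQ : ∀ j, constantCoeff (Q j) = 0) (k : ℕ)
    (s : (Fin n ⊕ Fin d) ⊕ (Fin n ⊕ Fin d)) : constantCoeff (segrePoint Q k s) = 0 := by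
  rcases s with s | s <;> simp [segrePoint, constantCoeff_segreMap hQ]

theorem segrePoint_inl_inr (k : ℕ) (j : Fin d) : segrePoint Q k (Sum.inl (Sum.inr j)) =
    subst (fun s => segrePoint Q k (Sum.map Sum.inl id s)) (Q j) := by
  have : (fun s => segrePoint Q k (Sum.map Sum.inl id s)) =
      Sum.elim (fun i => X (0, i)) (fun s => rename (shift k n) (bar (segreMap Q k s))) := by
    funext s
    rcases s with s | s <;> rfl
  rw [this]
  rfl

theorem pderiv_segrePoint_inr (k : ℕ) (j : Fin n) (s : Fin n ⊕ Fin d) :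
    pderiv ℂ (0, j) (segrePoint Q k (Sum.inr s)) = 0 :=
  pderiv_rename_of_notMem_range (zero_notMem_range_shift j) _

theorem pderiv_segrePoint_inl_inl (k : ℕ) (i j : Fin n) :
    pderiv ℂ (0, j) (segrePoint Q k (Sum.inl (Sum.inl i))) = if i = j then 1 else 0 := by
  have : segrePoint Q k (Sum.inl (Sum.inl i)) = X (0, i) := rfl
  rw [this, pderiv_X']
  simp

/-- In a Segre point the variable `z` moves only `z` and `w = Q(z, χ, τ)`, so `∂/∂z_j` is related to
the graph field. -/
theorem pderiv_subst_segrePoint (hQ : ∀ j, constantCoeff (Q j) = 0) (k : ℕ) (j : Fin n)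
    (F : MvPowerSeries ((Fin n ⊕ Fin d) ⊕ (Fin n ⊕ Fin d)) ℂ) :
    pderiv ℂ (0, j) (subst (segrePoint Q k) F) = subst (segrePoint Q k) (graphField Q j F) := by
  have hp := constantCoeff_segrePoint hQ k
  have hs := hasSubst_of_constantCoeff_zero hp
  have h1 : ∀ l, pderiv ℂ (0, j) (segrePoint Q k (Sum.inl (Sum.inr l))) =
      subst (segrePoint Q k) (rename (Sum.map Sum.inl id) (pderiv ℂ (Sum.inl j) (Q l))) := by
    intro l
    rw [segrePoint_inl_inr, pderiv_subst (fun i => hp _), subst_rename _ hp, Fintype.sum_sum_type]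
    simp [pderiv_segrePoint_inr, pderiv_segrePoint_inl_inl]
  rw [pderiv_subst hp, graphField_apply, subst_add hs, subst_sum hs]
  simp only [Fintype.sum_sum_type, pderiv_segrePoint_inr, pderiv_segrePoint_inl_inl, h1,
    subst_mul hs]
  simp [mul_comm]

theorem IsNormalCoordinates.isGraph (hZ : IsNormalCoordinates ρ Z Q) :
    IsGraph (fun j => subst (complexify Z) (ρ j)) Q := hZ.defining

theorem IsNormalCoordinates.isRealSeries (hM : IsFormalGeneric ρ) (hZ : IsNormalCoordinates ρ Z Q)
    (j : Fin d) : IsRealSeries (subst (complexify Z) (ρ j)) :=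
  IsRealSeries.subst_complexify (hM.real j) hZ.invertible.1

/-- The point `segrePoint` in the original coordinates. -/
def segreVector (Z : Fin N → MvPowerSeries (Fin n ⊕ Fin d) ℂ)
    (Q : Fin d → MvPowerSeries (Fin n ⊕ (Fin n ⊕ Fin d)) ℂ) (k : ℕ) (i : Fin N ⊕ Fin N) :
    MvPowerSeries (Fin (k + 1) × Fin n) ℂ :=
  subst (segrePoint Q k) (complexify Z i)

theorem constantCoeff_segreVector (hZ : IsNormalCoordinates ρ Z Q) (k : ℕ) (i : Fin N ⊕ Fin N) :
    constantCoeff (segreVector Z Q k i) = 0 := by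
  rw [segreVector, constantCoeff_subst_of_constantCoeff_zero
    (constantCoeff_segrePoint hZ.constantCoeff_eq_zero k),
    constantCoeff_complexify hZ.invertible.1]

theorem subst_segreVector (hZ : IsNormalCoordinates ρ Z Q) (k : ℕ) (f : SeriesZζ N) :
    subst (segreVector Z Q k) f = subst (segrePoint Q k) (subst (complexify Z) f) :=
  (subst_subst (constantCoeff_complexify hZ.invertible.1)
    (constantCoeff_segrePoint hZ.constantCoeff_eq_zero k) f).symm

theorem subst_segreVector_eq_zero (hZ : IsNormalCoordinates ρ Z Q) (k : ℕ) (j : Fin d) :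
    subst (segreVector Z Q k) (ρ j) = 0 := by
  rw [subst_segreVector hZ]
  refine (hZ.isGraph.subst_eq_zero_iff
    (constantCoeff_segrePoint hZ.constantCoeff_eq_zero k)).2 (fun j => ?_) j
  rfl

theorem genericRank_segreVector_inl (hZ : IsNormalCoordinates ρ Z Q) (k : ℕ) :
    genericRank (fun i => segreVector Z Q k (Sum.inl i)) = genericRank (segreMap Q (k + 1)) := by
  have hQ := hZ.constantCoeff_eq_zero
  rw [← genericRank_subst_of_isFormalInvertible (constantCoeff_segreMap hQ (k + 1)) hZ.invertible]
  congr 1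
  funext i
  exact subst_complexify_inl (constantCoeff_segrePoint hQ k) i

theorem genericRank_segreVector_inr (hZ : IsNormalCoordinates ρ Z Q) (k : ℕ) :
    genericRank (fun i => segreVector Z Q k (Sum.inr i)) = genericRank (segreMap Q k) := by
  have hQ := hZ.constantCoeff_eq_zero
  rw [← genericRank_rename_bar (shift_injective k n) (segreMap Q k),
    ← genericRank_subst_of_isFormalInvertible (by simp [constantCoeff_segreMap hQ])
      hZ.invertible.bar]
  congr 1
  funext i
  exact subst_complexify_inr (constantCoeff_segrePoint hQ k) i

/-- The Segre point and `(z, v̄^k)` are formal functions of each other, since `w = Q(z, v̄^k)`. The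
`n` variables `z` do not occur in `v̄^k`. -/
theorem genericRank_segreVector (hZ : IsNormalCoordinates ρ Z Q) (k : ℕ) :
    genericRank (segreVector Z Q k) = n + genericRank (segreMap Q k) := by
  have hQ := hZ.constantCoeff_eq_zero
  have hp := constantCoeff_segrePoint hQ k
  have hs := hasSubst_of_constantCoeff_zero hp
  have h1 : genericRank (segreVector Z Q k) = genericRank (segrePoint Q k) :=
    genericRank_subst_of_isFormalInvertible hp hZ.invertible.complexify
  let q : Fin n ⊕ (Fin n ⊕ Fin d) → MvPowerSeries (Fin (k + 1) × Fin n) ℂ :=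
    Sum.elim (fun i => X (0, i)) (fun s => rename (shift k n) (bar (segreMap Q k s)))
  have hq0 : ∀ s, constantCoeff (q s) = 0 := by
    rintro (s | s) <;> simp [q, constantCoeff_segreMap hQ]
  have hqs := hasSubst_of_constantCoeff_zero hq0
  have h2 : genericRank q = n + genericRank (segreMap Q k) := by
    rw [genericRank_sumElim_X (Prod.mk_right_injective 0) fun i s =>
      pderiv_rename_of_notMem_range (zero_notMem_range_shift i) _, Fintype.card_fin,
      genericRank_rename_bar (shift_injective k n)]
  have h3 : genericRank (segrePoint Q k) ≤ genericRank q := by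
    have := genericRank_subst_le hq0
      (Sum.elim (Sum.elim (fun i => X (Sum.inl i)) Q) fun s => X (Sum.inr s))
    refine le_of_eq_of_le (congrArg _ (funext fun s => ?_)) this
    rcases s with (s | s) | s
    · exact (subst_X (R := ℂ) hqs (Sum.inl s)).symm
    · rfl
    · exact (subst_X (R := ℂ) hqs (Sum.inr s)).symm
  have h4 : genericRank q ≤ genericRank (segrePoint Q k) := by
    have := genericRank_subst_le hp (fun s : Fin n ⊕ (Fin n ⊕ Fin d) => X (Sum.map Sum.inl id s))
    refine le_of_eq_of_le (congrArg _ (funext fun s => ?_)) this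
    rw [subst_X hs]
    rcases s with s | s <;> rfl
  rw [h1, ← h2]
  exact le_antisymm h3 h4

end Segre

end

end FormalCR

namespace FormalCR

open MvPowerSeries

noncomputable section

/-! ### Vanishing along the Segre maps and the equivalence. -/

section Vanishing

variable {N n d : ℕ} {ρ : Fin d → SeriesZζ N} {Z : Fin N → MvPowerSeries (Fin n ⊕ Fin d) ℂ}
  {Q : Fin d → MvPowerSeries (Fin n ⊕ (Fin n ⊕ Fin d)) ℂ}

theorem bar_segreVector_swap (hZ : IsNormalCoordinates ρ Z Q) (k : ℕ) (i : Fin N ⊕ Fin N) :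
    bar (segreVector Z Q k i.swap) = subst (fun s => bar (segrePoint Q k s.swap)) (complexify Z i) := by
  have hp := constantCoeff_segrePoint hZ.constantCoeff_eq_zero k
  have hp' : ∀ s, constantCoeff (bar (segrePoint Q k (Sum.swap s))) = 0 := by simp [hp]
  rcases i with i | i
  · rw [Sum.swap_inl, segreVector, subst_complexify_inr hp, subst_complexify_inl hp',
      bar_subst (fun _ => hp _), bar_bar]
    rfl
  · rw [Sum.swap_inr, segreVector, subst_complexify_inl hp, subst_complexify_inr hp',
      bar_subst (fun _ => hp _)]
    rfl

/-- Restricting `z` to the value it has at the preceding Segre point of the same type recovers,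
up to conjugation, the preceding Segre point. -/
theorem exists_subst_segrePoint (hM : IsFormalGeneric ρ) (hZ : IsNormalCoordinates ρ Z Q) (k : ℕ) :
    ∃ a : Fin (k + 2) × Fin n → MvPowerSeries (Fin (k + 2) × Fin n) ℂ,
      (∀ i, constantCoeff (a i) = 0) ∧ (∀ i, a (shift (k + 1) n i) = X (shift (k + 1) n i)) ∧
      ∀ s, subst a (segrePoint Q (k + 1) s) =
        rename (shift (k + 1) n) (bar (segrePoint Q k s.swap)) := by
  have hQ := hZ.constantCoeff_eq_zero
  -- Block `0` is replaced by the `z`-component of `v^k` in the blocks from `2` on. This is `z¹`, or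
  -- `0` when `k = 0`.
  let a : Fin (k + 2) × Fin n → MvPowerSeries (Fin (k + 2) × Fin n) ℂ := fun i =>
    Fin.cases (motive := fun _ => MvPowerSeries (Fin (k + 2) × Fin n) ℂ)
      (rename (shift (k + 1) n) (rename (shift k n) (segreMap Q k (Sum.inl i.2))))
      (fun l => X (Fin.succ l, i.2)) i.1
  have ha0 : ∀ i, constantCoeff (a i) = 0 := by
    rintro ⟨l, i⟩
    refine Fin.cases ?_ (fun l => ?_) l
    · simp [a, constantCoeff_segreMap hQ]
    · simp [a]
  have hs := hasSubst_of_constantCoeff_zero ha0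
  have hp := constantCoeff_segrePoint hQ (k + 1)
  refine ⟨a, ha0, fun i => rfl, ?_⟩
  have hren : ∀ f : MvPowerSeries (Fin (k + 1) × Fin n) ℂ,
      subst a (rename (shift (k + 1) n) f) = rename (shift (k + 1) n) f := by
    intro f
    rw [subst_rename _ ha0, rename_eq_subst]
    rfl
  have hr : ∀ s, subst a (segrePoint Q (k + 1) (Sum.inr s)) =
      rename (shift (k + 1) n) (bar (segrePoint Q k (Sum.inl s))) := fun s => hren _
  have hz : ∀ i, subst a (segrePoint Q (k + 1) (Sum.inl (Sum.inl i))) =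
      rename (shift (k + 1) n) (bar (segrePoint Q k (Sum.inr (Sum.inl i)))) := by
    intro i
    have h1 : segrePoint Q (k + 1) (Sum.inl (Sum.inl i)) = X (0, i) := rfl
    have h2 : segrePoint Q k (Sum.inr (Sum.inl i)) =
      rename (shift k n) (bar (segreMap Q k (Sum.inl i))) := rfl
    rw [h1, h2, subst_X hs, bar_rename, bar_bar]
    rfl
  have hw : ∀ j, subst a (segrePoint Q (k + 1) (Sum.inl (Sum.inr j))) =
      rename (shift (k + 1) n) (bar (segrePoint Q k (Sum.inr (Sum.inr j)))) := by
    have hp' : ∀ s : (Fin n ⊕ Fin d) ⊕ (Fin n ⊕ Fin d), constantCoeff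
        (rename (shift (k + 1) n) (bar (segrePoint Q k s.swap))) = 0 := by
      simp [constantCoeff_segrePoint hQ k]
    -- By reality the swapped conjugate of a Segre point also satisfies the equations. Its `w` is
    -- therefore the value of `Q` at its other coordinates, which is what the substitution produces.
    have hzero : ∀ j, subst (fun s : (Fin n ⊕ Fin d) ⊕ (Fin n ⊕ Fin d) =>
        rename (shift (k + 1) n) (bar (segrePoint Q k s.swap)))
          (subst (complexify Z) (ρ j)) = 0 := by
      intro j
      have hpk := constantCoeff_segrePoint hQ k
      rw [← rename_subst _ (by simp [hpk]), ← (hZ.isRealSeries hM j).bar_subst hpk,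
        ← subst_segreVector hZ, subst_segreVector_eq_zero hZ, bar_zero, map_zero]
    intro j
    have h1 := (hZ.isGraph.subst_eq_zero_iff hp').1 hzero j
    rw [segrePoint_inl_inr, subst_subst (fun s => hp _) ha0]
    refine Eq.trans ?_ h1.symm
    congr 1
    funext s
    rcases s with s | s
    · exact hz s
    · exact hr s
  rintro ((i | j) | s)
  · exact hz i
  · exact hw j
  · exact hr s

/-- A set of functions vanishing at `0` that is stable under a tangent frame and its conjugate
vanishes along all Segre mappings. -/
theorem subst_segreVector_eq_zero_of_stable (hM : IsFormalGeneric ρ)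
    (hZ : IsNormalCoordinates ρ Z Q) {a : Fin n → Fin N → SeriesZζ N}
    (ha : ∀ j f, subst (complexify Z) (vectorField (a j) 0 f) =
      graphField Q j (subst (complexify Z) f)) (k : ℕ) :
    ∀ J : Set (SeriesZζ N), (∀ f ∈ J, constantCoeff f = 0) →
      (∀ j, ∀ f ∈ J, vectorField (a j) 0 f ∈ J) →
      (∀ j, ∀ f ∈ J, vectorField 0 (fun i => conj (a j i)) f ∈ J) →
      ∀ f ∈ J, subst (segreVector Z Q k) f = 0 := by
  have hQ := hZ.constantCoeff_eq_zero
  have hderiv : ∀ k j f, pderiv ℂ (0, j) (subst (segreVector Z Q k) f) =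
      subst (segreVector Z Q k) (vectorField (a j) 0 f) := by
    intro k j f
    rw [subst_segreVector hZ, subst_segreVector hZ, pderiv_subst_segrePoint hQ, ha]
  have hstable : ∀ (k : ℕ) (J : Set (SeriesZζ N)), (∀ j, ∀ f ∈ J, vectorField (a j) 0 f ∈ J) →
      ∀ h ∈ (subst (segreVector Z Q k) : SeriesZζ N → _) '' J,
      ∀ i ∉ Set.range (⟨shift k n, shift_injective k n⟩ : Fin k × Fin n ↪ _),
        pderiv ℂ i h ∈ (subst (segreVector Z Q k) : SeriesZζ N → _) '' J := by
    rintro k J hJ _ ⟨f, hf, rfl⟩ ⟨l, j⟩ hi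
    obtain rfl : l = 0 := by
      by_contra hl
      obtain ⟨l, rfl⟩ := Fin.exists_succ_eq.2 hl
      exact hi ⟨(l, j), rfl⟩
    exact ⟨_, hJ j f hf, (hderiv k j f).symm⟩
  induction k with
  | zero =>
    intro J hJ0 hJ _ f hf
    -- For `k = 0` all variables belong to the block `z`, and the vanishing of constant terms is
    -- enough.
    refine eq_zero_of_pderiv_mem ⟨shift 0 n, shift_injective 0 n⟩ (hstable 0 J hJ) (a := 0)
      (fun i => map_zero _) (fun i => Fin.elim0 i.1) ?_ ⟨f, hf, rfl⟩
    rintro _ ⟨f, hf, rfl⟩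
    have h0 : constantCoeff (subst (segreVector Z Q 0) f) = 0 := by
      rw [constantCoeff_subst_of_constantCoeff_zero (constantCoeff_segreVector hZ 0), hJ0 f hf]
    rw [subst_zero_eq_C_constantCoeff, h0, map_zero, map_zero]
  | succ k ih =>
    intro J hJ0 hJ hJ' f hf
    obtain ⟨c, hc0, hcX, hc⟩ := exists_subst_segrePoint hM hZ k
    refine eq_zero_of_pderiv_mem ⟨shift (k + 1) n, shift_injective (k + 1) n⟩
      (hstable (k + 1) J hJ) hc0 hcX ?_ ⟨f, hf, rfl⟩
    rintro _ ⟨f, hf, rfl⟩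
    have hpk := constantCoeff_segrePoint hQ k
    have hpk' : ∀ s, constantCoeff (bar (segrePoint Q k (Sum.swap s))) = 0 := by simp [hpk]
    have hcZ := constantCoeff_complexify hZ.invertible.1
    -- The frame and its conjugate exchange roles on `conj '' J`. For this reason the induction
    -- hypothesis must cover all sets `J`.
    have h1 : subst (segreVector Z Q k) (conj f) = 0 := by
      refine ih (conj '' J) ?_ ?_ ?_ _ ⟨f, hf, rfl⟩
      · rintro _ ⟨f, hf, rfl⟩
        rw [constantCoeff_conj, hJ0 f hf, map_zero]
      · rintro j _ ⟨f, hf, rfl⟩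
        refine ⟨_, hJ' j f hf, ?_⟩
        have := vectorField_conj (a j) (conj f)
        rw [conj_conj] at this
        rw [this, conj_conj]
      · rintro j _ ⟨f, hf, rfl⟩
        exact ⟨_, hJ j f hf, (vectorField_conj (a j) f).symm⟩
    have h2 := bar_subst_conj (constantCoeff_segreVector hZ k) f
    rw [h1, bar_zero] at h2
    simp only [bar_segreVector_swap hZ] at h2
    rw [← subst_subst hcZ hpk'] at h2
    change subst c (subst (segreVector Z Q (k + 1)) f) = 0
    rw [subst_segreVector hZ, subst_subst (constantCoeff_segrePoint hQ (k + 1)) hc0]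
    simp only [hc]
    rw [← rename_subst _ hpk', ← h2, map_zero]

/-- The dimension of `𝔤_M(0)` bounds the ranks of the Segre mappings. -/
theorem add_genericRank_segreMap_le (hM : IsFormalGeneric ρ) (hZ : IsNormalCoordinates ρ Z Q)
    (k : ℕ) : n + genericRank (segreMap Q k) ≤
      Module.finrank ℂ ((crLieAlgebra ρ).toSubmodule.map (evalAtZero N)) := by
  obtain ⟨a, hatan, ha⟩ := exists_tangent_frame hZ
  obtain ⟨m, f, hm, hli, hf⟩ := exists_isKilledBy (crLieAlgebra ρ)
    fun b X hX => smul_mem_crLieAlgebra ρ b hX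
  -- A word applied to `X f` is the word extended by `X` applied to `f`.
  have hmem : ∀ X ∈ crLieAlgebra ρ, ∀ f, IsKilledBy (crLieAlgebra ρ) f →
      IsKilledBy (crLieAlgebra ρ) (X f) := by
    intro X hX f hf l hl
    have := hf (l ++ [X]) (by
      intro Y hY
      rcases List.mem_append.1 hY with hY | hY
      · exact hl Y hY
      · rw [List.mem_singleton.1 hY]
        exact hX)
    rwa [applyWord_append] at this
  have hv : ∀ s, subst (segreVector Z Q k) (f s) = 0 := fun s =>
    subst_segreVector_eq_zero_of_stable hM hZ ha k {f | IsKilledBy (crLieAlgebra ρ) f}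
      (fun f hf => hf [] (by simp))
      (fun j f hf => hmem _ (LieSubalgebra.subset_lieSpan (Submodule.subset_span
        ⟨hatan j, Or.inl ⟨_, rfl⟩⟩)) f hf)
      (fun j f hf => hmem _ (LieSubalgebra.subset_lieSpan (Submodule.subset_span
        ⟨isTangent_conj hM.real (hatan j), Or.inr ⟨_, rfl⟩⟩)) f hf) (f s) (hf s)
  have h := genericRank_add_card_le (constantCoeff_segreVector hZ k) hli hv
  rw [genericRank_segreVector hZ, Fintype.card_fin, ← hm] at h
  have h' : n + genericRank (segreMap Q k) ≤
      Module.finrank ℂ ((crLieAlgebra ρ).toSubmodule.map (valueAtZero (Fin N ⊕ Fin N))) := by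
    omega
  exact h'

theorem genericRank_segreMap_le_succ (hN : n + d = N) (hM : IsFormalGeneric ρ)
    (hZ : IsNormalCoordinates ρ Z Q) (k : ℕ) :
    genericRank (segreMap Q k) ≤ genericRank (segreMap Q (k + 1)) ∧
      (genericRank (segreMap Q k) = genericRank (segreMap Q (k + 1)) →
        Module.finrank ℂ ((crLieAlgebra ρ).toSubmodule.map (evalAtZero N)) ≤
          n + genericRank (segreMap Q k)) := by
  have h := genericRank_le_and_finrank_le hN hM (constantCoeff_segreVector hZ k)
    (subst_segreVector_eq_zero hZ k)
  rw [genericRank_segreVector_inl hZ, genericRank_segreVector_inr hZ,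
    genericRank_segreVector hZ] at h
  -- The equality of ranks for the `ζ`-projection always holds; the one for the `Z`-projection says
  -- that the rank stalls.
  exact ⟨by omega, fun he => h.2 (by omega) (by omega)⟩

theorem genericRank_segreMap_one (hZ : IsNormalCoordinates ρ Z Q) :
    n ≤ genericRank (segreMap Q 1) := by
  have hv := constantCoeff_segreMap hZ.constantCoeff_eq_zero 1
  let Φ : Fin n ⊕ Empty → MvPowerSeries (Fin n ⊕ Fin d) ℂ :=
    Sum.elim (fun i => X (Sum.inl i)) Empty.elim
  let u : Empty → MvPowerSeries (Fin 1 × Fin n) ℂ := Empty.elim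
  have h : (fun s => subst (segreMap Q 1) (Φ s)) = Sum.elim (fun i => X (0, i)) u := by
    funext s
    rcases s with s | s
    · exact subst_X (R := ℂ) (hasSubst_of_constantCoeff_zero hv) (Sum.inl s)
    · exact s.elim
  have hle := genericRank_subst_le hv Φ
  rw [h, genericRank_sumElim_X (Prod.mk_right_injective 0) fun _ s => s.elim,
    Fintype.card_fin] at hle
  omega

theorem isFiniteType_iff (hN : n + d = N) (hM : IsFormalGeneric ρ)
    (hZ : IsNormalCoordinates ρ Z Q) :
    IsFiniteType ρ ↔ ∃ k₁ ≤ d + 1, ∀ k ≥ k₁, genericRank (segreMap Q k) = N := by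
  have hcard : ∀ k, genericRank (segreMap Q k) ≤ N := by
    intro k
    have := genericRank_le_card (segreMap Q k)
    rwa [Fintype.card_sum, Fintype.card_fin, Fintype.card_fin, hN] at this
  constructor
  · intro hfin
    unfold IsFiniteType at hfin
    -- Until it reaches `N`, the rank grows by at least one at each step: stalling would give `2N -
    -- d ≤ n + Rk`, where `2N - d = N + n`. The value `k = d` accounts for the bound `d + 1`.
    have hgrow : ∀ k, min N (n + k) ≤ genericRank (segreMap Q (k + 1)) := by
      intro k
      induction k with
      | zero => exact (min_le_right _ _).trans (genericRank_segreMap_one hZ)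
      | succ k ih =>
        have h := genericRank_segreMap_le_succ hN hM hZ (k + 1)
        have := hcard (k + 1)
        by_cases he : genericRank (segreMap Q (k + 1)) = genericRank (segreMap Q (k + 1 + 1))
        · have := h.2 he
          omega
        · omega
    refine ⟨d + 1, le_rfl, fun k hk => ?_⟩
    obtain ⟨k, rfl⟩ := Nat.exists_eq_add_of_le' (le_trans (Nat.le_add_left 1 d) hk)
    have := hgrow k
    have := hcard (k + 1)
    omega
  · rintro ⟨k, -, hk⟩
    have h1 := add_genericRank_segreMap_le hM hZ k
    have h2 := finrank_evalAtZero_add_le hM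
    rw [hk k le_rfl] at h1
    unfold IsFiniteType
    omega

end Vanishing

end

end FormalCR

theorem theorem3p1p9 {N n d : ℕ} (hN : n + d = N) (ρ : Fin d → FormalCR.SeriesZζ N)
    (hM : FormalCR.IsFormalGeneric ρ) :
    (∃ (Z : Fin N → MvPowerSeries (Fin n ⊕ Fin d) ℂ)
      (Q : Fin d → MvPowerSeries (Fin n ⊕ (Fin n ⊕ Fin d)) ℂ), FormalCR.IsNormalCoordinates ρ Z Q) ∧
    ∀ (Z : Fin N → MvPowerSeries (Fin n ⊕ Fin d) ℂ)
      (Q : Fin d → MvPowerSeries (Fin n ⊕ (Fin n ⊕ Fin d)) ℂ), FormalCR.IsNormalCoordinates ρ Z Q →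
      (FormalCR.IsFiniteType ρ ↔ ∃ k₁ ≤ d + 1, ∀ k ≥ k₁, FormalCR.genericRank (FormalCR.segreMap Q k) = N) :=
  ⟨FormalCR.exists_isNormalCoordinates hN ρ hM, fun _ _ hZ => FormalCR.isFiniteType_iff hN hM hZ⟩
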